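/- **Conventions.** A *symmetric monoidal model category* is a bicomplete closed symmetric monoidal category $(\mathscr C,\otimes,\mathbb 1)$ with a model structure satisfying the pushout-product axiom (for cofibrations $f:A\to B$ and $g:X\to Y$ the map $f\square g: A\otimes Y\cup_{A\otimes X}B\otimes X\to B\otimes Y$ is a cofibration, which is acyclic if $f$ or $g$ is) and the unit axiom (for every cofibrant replacement $q:c\mathbb 1\to\mathbb 1$, that is, a weak equivalence with $c\mathbb 1$ cofibrant, and every cofibrant $X$, the map $c\mathbb 1\otimes X\to\mathbb 1\otimes X\cong X$ is a weak equivalence). A *strong symmetric monoidal Quillen equivalence* between such categories is a Quillen equivalence $F\dashv G$ with $F$ strong symmetric monoidal (so $G$ is lax symmetric monoidal, through the adjunction) such that for every cofibrant replacement $q: c\mathbb 1\to\mathbb 1$ of the unit of the source of $F$ the map $F(c\mathbb 1)\to F(\mathbb 1)\cong\mathbb 1$ is a weak equivalence. $\mathscr C$ is *cofibrantly generated (with smallness)* if there are sets of maps $I$ and $J$ such that the acyclic fibrations (resp. fibrations) are the maps with the right lifting property against $I$ (resp. $J$), and the domains of the maps in $I$ (resp. $J$) are small relative to transfinite sequences of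 pushouts of coproducts of maps $i\otimes X$ with $X\in\mathscr C$ and $i\in I$ (resp. $i\in J$). It satisfies the *monoid axiom* if every transfinite composite of pushouts of maps $j\otimes X$, with $j$ an acyclic cofibration and $X\in\mathscr C$, is a weak equivalence. For a monoid $R$ in $\mathscr C$, a map of left $R$-modules is called a weak equivalence (resp. fibration) if it is one in $\mathscr C$, and a cofibration if it has the left lifting property with respect to all maps of $R$-modules that are both fibrations and weak equivalences. *Quillen invariance of modules* holds in $\mathscr C$ if for every weak equivalence $\theta:R\to R'$ of (not necessarily commutative) monoids in $\mathscr C$ the adjunction $R'\otimes_R-:\mathrm{Mod}_R\rightleftarrows\mathrm{Mod}_{R'}:\mathrm{res}_\theta$ is a Quillen equivalence. **Lemma.** Let $\mathscr C$ and $\mathscr D$ be cofibrantly generated (with smallness) symmetric monoidal model categories which satisfy the monoid axiom and in which Quillen invariance of modules holds. Let $F:\mathscr C\rightleftarrows\mathscr D:G$ be a strong symmetric monoidal Quillen equivalence such that $F$ preserves all weak equivalences, and let $S$ be a commutative monoid in $\mathscr C$ (not necessarily cofibrant). Then: 1. $\mathrm{Mod}_S(\mathscr C)$ and $\mathrm{Mod}_{FS}(\mathscr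 D)$, with the classes of maps above and the relative tensor products $M\otimes_S N=\mathrm{coeq}(M\otimes S\otimes N\rightrightarrows M\otimes N)$ and $\otimes_{FS}$, are symmetric monoidal model categories. 2. Let $F:\mathrm{Mod}_S(\mathscr C)\rightleftarrows\mathrm{Mod}_{FS}(\mathscr D):G$ be the adjunction induced by $F\dashv G$: $FS$ acts on $FM$ by $FS\otimes FM\cong F(S\otimes M)\to FM$, $S$ acts on $GN$ by the adjunct $S\otimes GN\to GN$ of $F(S\otimes GN)\cong FS\otimes FGN\to FS\otimes N\to N$, and hom-sets correspond as under $F\dashv G$. It is a strong symmetric monoidal Quillen equivalence, where the strong symmetric monoidal structure of $F$ on modules is the one induced from $\mathscr C$ and $\mathscr D$: the isomorphism $F(M\otimes_S N)\cong FM\otimes_{FS}FN$ is compatible, under the projections from $F(M\otimes N)$ and $FM\otimes FN$, with $F(M\otimes N)\cong FM\otimes FN$, and the unit isomorphism from the image of the unit $S$-module to the unit $FS$-module is the identity of $FS$. -/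

import Mathlib

open CategoryTheory MonoidalCategory Limits HomotopicalAlgebra
open scoped CategoryTheory.Obj
universe v u v₁ u₁ v₂ u₂

noncomputable section

namespace CategoryTheory.Mod

variable {C : Type u} [Category.{v} C] [MonoidalCategory C]

section Basic
variable {R : C} [MonObj R]

/-- The action map of an `R`-module. -/
def act (M : Mod C R) : R ⊗ M.X ⟶ M.X := M.mod.smul

@[simp]
lemma one_act (M : Mod C R) : MonObj.one ▷ M.X ≫ M.act = (λ_ M.X).hom := M.mod.one_smul

@[simp]
lemma one_act_assoc (M : Mod C R) {Z' : C} (k : _ ⟶ Z') :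
    MonObj.one ▷ M.X ≫ M.act ≫ k =
      (λ_ M.X).hom ≫ k := by
  rw [reassoc_of% @one_act]

lemma mul_act (M : Mod C R) :
    MonObj.mul ▷ M.X ≫ M.act = (α_ R R M.X).hom ≫ R ◁ M.act ≫ M.act := M.mod.mul_smul

lemma mul_act_assoc (M : Mod C R) {Z' : C} (k : _ ⟶ Z') :
    MonObj.mul ▷ M.X ≫ M.act ≫ k =
      (α_ R R M.X).hom ≫ R ◁ M.act ≫ M.act ≫ k := by
  rw [reassoc_of% @mul_act]

@[simp]
lemma act_hom {M N : Mod C R} (f : M ⟶ N) : M.act ≫ f.hom = R ◁ f.hom ≫ N.act :=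
  IsModHom.smul_hom

@[simp]
lemma act_hom_assoc {M N : Mod C R} (f : M ⟶ N) {Z' : C} (k : _ ⟶ Z') :
    M.act ≫ f.hom ≫ k =
      R ◁ f.hom ≫ N.act ≫ k := by
  rw [reassoc_of% @act_hom]

/-- Constructor for modules in terms of the tensor product of `C`. -/
def ofAct (X : C) (a : R ⊗ X ⟶ X) (h₁ : MonObj.one ▷ X ≫ a = (λ_ X).hom)
    (h₂ : MonObj.mul ▷ X ≫ a = (α_ R R X).hom ≫ R ◁ a ≫ a) : Mod C R :=
  letI : ModObj R X := { smul := a, one_smul := h₁, mul_smul := h₂ }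
  ⟨X⟩

/-- Constructor for morphisms of modules in terms of the tensor product of `C`. -/
def ofHom {M N : Mod C R} (f : M.X ⟶ N.X) (h : M.act ≫ f = R ◁ f ≫ N.act) : M ⟶ N :=
  letI : IsModHom R f := { smul_hom := h }
  ⟨f⟩

@[simp] lemma ofHom_hom {M N : Mod C R} (f : M.X ⟶ N.X) (h) : (ofHom (M := M) (N := N) f h).hom = f := rfl

/-- Constructor for isomorphisms of modules. -/
def ofIso {M N : Mod C R} (e : M.X ≅ N.X) (h : M.act ≫ e.hom = R ◁ e.hom ≫ N.act) : M ≅ N where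
  hom := ofHom e.hom h
  inv := ofHom e.inv (by rw [← cancel_mono e.hom]; simp [h, ← whiskerLeft_comp_assoc])
  hom_inv_id := by ext; simp
  inv_hom_id := by ext; simp

@[simp] lemma ofIso_hom_hom {M N : Mod C R} (e : M.X ≅ N.X) (h) : (ofIso (M := M) (N := N) e h).hom.hom = e.hom := rfl
@[simp] lemma ofIso_inv_hom {M N : Mod C R} (e : M.X ≅ N.X) (h) : (ofIso (M := M) (N := N) e h).inv.hom = e.inv := rfl

/-- A monoid as a module over itself. -/
abbrev tUnit (S : C) [MonObj S] : Mod C S := { X := S, mod := ModObj.regular S }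

@[simp] lemma tUnit_act (S : C) [MonObj S] : (tUnit S).act = MonObj.mul (X := S) := rfl

end Basic

section Tensor
variable [SymmetricCategory C] {S : C} [MonObj S]

/-- The right action of a commutative monoid on a (left) module. -/
def ract (M : Mod C S) : M.X ⊗ S ⟶ M.X := (β_ M.X S).hom ≫ M.act

@[simp]
lemma ract_one (M : Mod C S) : M.X ◁ MonObj.one ≫ M.ract = (ρ_ M.X).hom := by
  simp [ract]

@[simp]
lemma ract_one_assoc (M : Mod C S) {Z' : C} (k : _ ⟶ Z') :
    M.X ◁ MonObj.one ≫ M.ract ≫ k =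
      (ρ_ M.X).hom ≫ k := by
  rw [reassoc_of% @ract_one]

lemma ract_hom {M N : Mod C S} (f : M ⟶ N) : M.ract ≫ f.hom = f.hom ▷ S ≫ N.ract := by
  simp [ract]

lemma ract_hom_assoc {M N : Mod C S} (f : M ⟶ N) {Z' : C} (k : _ ⟶ Z') :
    M.ract ≫ f.hom ≫ k =
      f.hom ▷ S ≫ N.ract ≫ k := by
  rw [reassoc_of% @ract_hom]

lemma ract_mul [IsCommMonObj S] (M : Mod C S) :
    M.X ◁ MonObj.mul ≫ M.ract = (α_ M.X S S).inv ≫ M.ract ▷ S ≫ M.ract := by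
  have h : M.X ◁ MonObj.mul ≫ M.ract =
    M.X ◁ (β_ S S).hom ≫ (β_ M.X (S ⊗ S)).hom ≫ MonObj.mul ▷ M.X ≫ M.act := by
    simp only [ract]
    rw [← BraidedCategory.braiding_naturality_right_assoc, ← whiskerLeft_comp_assoc, IsCommMonObj.mul_comm]
  rw [h, mul_act]
  simp only [ract, comp_whiskerRight, Category.assoc, BraidedCategory.braiding_naturality_left_assoc,
    BraidedCategory.braiding_tensor_right_hom]
  simp

lemma ract_mul_assoc [IsCommMonObj S] (M : Mod C S) {Z' : C} (k : _ ⟶ Z') :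
    M.X ◁ MonObj.mul ≫ M.ract ≫ k =
      (α_ M.X S S).inv ≫ M.ract ▷ S ≫ M.ract ≫ k := by
  rw [reassoc_of% @ract_mul]

lemma act_ract [IsCommMonObj S] (M : Mod C S) :
    M.act ▷ S ≫ M.ract = (α_ S M.X S).hom ≫ S ◁ M.ract ≫ M.act := by
  have h : S ◁ M.act ≫ M.act = (α_ S S M.X).inv ≫ MonObj.mul ▷ M.X ≫ M.act := by
    rw [mul_act, Iso.inv_hom_id_assoc]
  simp only [ract, BraidedCategory.braiding_naturality_left_assoc, whiskerLeft_comp,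
    Category.assoc, h, BraidedCategory.braiding_tensor_left_hom, Iso.hom_inv_id_assoc]
  rw [← comp_whiskerRight_assoc, IsCommMonObj.mul_comm]

lemma act_ract_assoc [IsCommMonObj S] (M : Mod C S) {Z' : C} (k : _ ⟶ Z') :
    M.act ▷ S ≫ M.ract ≫ k =
      (α_ S M.X S).hom ≫ S ◁ M.ract ≫ M.act ≫ k := by
  rw [reassoc_of% @act_ract]

@[simp] lemma tUnit_ract [IsCommMonObj S] : (tUnit S).ract = MonObj.mul (X := S) :=
  IsCommMonObj.mul_comm S

lemma preservesColimits_tensorRight [∀ X : C, PreservesColimitsOfSize.{0, 0} (tensorLeft X)] (X : C) :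
    PreservesColimitsOfSize.{0, 0} (tensorRight X) :=
  preservesColimits_of_natIso (BraidedCategory.tensorLeftIsoTensorRight X)

attribute [local instance] preservesColimits_tensorRight

variable [HasCoequalizers C]

/-- The underlying object of `M ⊗[S] N`: the coequalizer of the two maps
`(M ⊗ S) ⊗ N ⟶ M ⊗ N` given by the actions of `S` on `M` and on `N`. -/
def qX (M N : Mod C S) : C :=
  coequalizer (M.ract ▷ N.X) ((α_ M.X S N.X).hom ≫ M.X ◁ N.act)

/-- The projection `M ⊗ N ⟶ M ⊗[S] N`. -/
def qπ (M N : Mod C S) : M.X ⊗ N.X ⟶ qX M N := coequalizer.π _ _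

lemma qπ_condition (M N : Mod C S) :
    M.ract ▷ N.X ≫ qπ M N = (α_ M.X S N.X).hom ≫ M.X ◁ N.act ≫ qπ M N :=
  (coequalizer.condition (M.ract ▷ N.X) ((α_ M.X S N.X).hom ≫ M.X ◁ N.act)).trans
    (Category.assoc _ _ _)

lemma qπ_condition_assoc (M N : Mod C S) {Z' : C} (k : _ ⟶ Z') :
    M.ract ▷ N.X ≫ qπ M N ≫ k =
      (α_ M.X S N.X).hom ≫ M.X ◁ N.act ≫ qπ M N ≫ k := by
  rw [reassoc_of% @qπ_condition]

instance (M N : Mod C S) : Epi (qπ M N) :=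
  inferInstanceAs (Epi (coequalizer.π _ _))

/-- The universal property of `M ⊗[S] N`. -/
def qdesc {M N : Mod C S} {W : C} (f : M.X ⊗ N.X ⟶ W)
    (h : M.ract ▷ N.X ≫ f = (α_ M.X S N.X).hom ≫ M.X ◁ N.act ≫ f) : qX M N ⟶ W :=
  coequalizer.desc f (by simpa using h)

@[simp]
lemma qπ_qdesc {M N : Mod C S} {W : C} (f : M.X ⊗ N.X ⟶ W) (h) : qπ M N ≫ qdesc f h = f :=
  coequalizer.π_desc _ _

@[simp]
lemma qπ_qdesc_assoc {M N : Mod C S} {W : C} (f : M.X ⊗ N.X ⟶ W) (h) {Z' : C} (k : _ ⟶ Z') :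
    qπ M N ≫ qdesc f h ≫ k =
      f ≫ k := by
  rw [reassoc_of% @qπ_qdesc]

variable [∀ X : C, PreservesColimitsOfSize.{0, 0} (tensorLeft X)]

instance (Z : C) (M N : Mod C S) : Epi (Z ◁ qπ M N) :=
  inferInstanceAs (Epi ((tensorLeft Z).map (coequalizer.π _ _)))

instance (Z : C) (M N : Mod C S) : Epi (qπ M N ▷ Z) :=
  inferInstanceAs (Epi ((tensorRight Z).map (coequalizer.π _ _)))

/-- The universal property of `Z ⊗ (M ⊗[S] N)`. -/
def qdescL {M N : Mod C S} {Z W : C} (f : Z ⊗ (M.X ⊗ N.X) ⟶ W)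
    (h : Z ◁ (M.ract ▷ N.X) ≫ f = Z ◁ (α_ M.X S N.X).hom ≫ Z ◁ M.X ◁ N.act ≫ f) :
    Z ⊗ qX M N ⟶ W :=
  Cofork.IsColimit.desc
    (isColimitOfHasCoequalizerOfPreservesColimit (tensorLeft Z) (M.ract ▷ N.X)
      ((α_ M.X S N.X).hom ≫ M.X ◁ N.act)) f (by simpa using h)

@[simp]
lemma qπ_qdescL {M N : Mod C S} {Z W : C} (f : Z ⊗ (M.X ⊗ N.X) ⟶ W) (h) :
    Z ◁ qπ M N ≫ qdescL f h = f :=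
  Cofork.IsColimit.π_desc' (isColimitOfHasCoequalizerOfPreservesColimit (tensorLeft Z)
    (M.ract ▷ N.X) ((α_ M.X S N.X).hom ≫ M.X ◁ N.act)) f (by simpa using h)

@[simp]
lemma qπ_qdescL_assoc {M N : Mod C S} {Z W : C} (f : Z ⊗ (M.X ⊗ N.X) ⟶ W) (h) {Z' : C} (k : _ ⟶ Z') :
    Z ◁ qπ M N ≫ qdescL f h ≫ k =
      f ≫ k := by
  rw [reassoc_of% @qπ_qdescL]

/-- The universal property of `(M ⊗[S] N) ⊗ Z`. -/
def qdescR {M N : Mod C S} {Z W : C} (f : (M.X ⊗ N.X) ⊗ Z ⟶ W)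
    (h : (M.ract ▷ N.X) ▷ Z ≫ f = (α_ M.X S N.X).hom ▷ Z ≫ (M.X ◁ N.act) ▷ Z ≫ f) :
    qX M N ⊗ Z ⟶ W :=
  Cofork.IsColimit.desc
    (isColimitOfHasCoequalizerOfPreservesColimit (tensorRight Z) (M.ract ▷ N.X)
      ((α_ M.X S N.X).hom ≫ M.X ◁ N.act)) f (by simpa using h)

@[simp]
lemma qπ_qdescR {M N : Mod C S} {Z W : C} (f : (M.X ⊗ N.X) ⊗ Z ⟶ W) (h) :
    qπ M N ▷ Z ≫ qdescR f h = f :=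
  Cofork.IsColimit.π_desc' (isColimitOfHasCoequalizerOfPreservesColimit (tensorRight Z)
    (M.ract ▷ N.X) ((α_ M.X S N.X).hom ≫ M.X ◁ N.act)) f (by simpa using h)

@[simp]
lemma qπ_qdescR_assoc {M N : Mod C S} {Z W : C} (f : (M.X ⊗ N.X) ⊗ Z ⟶ W) (h) {Z' : C} (k : _ ⟶ Z') :
    qπ M N ▷ Z ≫ qdescR f h ≫ k =
      f ≫ k := by
  rw [reassoc_of% @qπ_qdescR]

variable [IsCommMonObj S]

/-- The action of `S` on `M ⊗[S] N`. -/
def qact (M N : Mod C S) : S ⊗ qX M N ⟶ qX M N :=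
  qdescL ((α_ S M.X N.X).inv ≫ M.act ▷ N.X ≫ qπ M N) (by
    have h : S ◁ M.ract ≫ M.act = (α_ S M.X S).inv ≫ M.act ▷ S ≫ M.ract := by
      rw [act_ract, Iso.inv_hom_id_assoc]
    rw [associator_inv_naturality_middle_assoc, ← comp_whiskerRight_assoc, h]
    simp only [comp_whiskerRight, Category.assoc, qπ_condition, associator_naturality_left_assoc,
      ← whisker_exchange_assoc]
    simp)

@[simp]
lemma qπ_qact (M N : Mod C S) :
    S ◁ qπ M N ≫ qact M N = (α_ S M.X N.X).inv ≫ M.act ▷ N.X ≫ qπ M N :=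
  qπ_qdescL _ _

@[simp]
lemma qπ_qact_assoc (M N : Mod C S) {Z' : C} (k : _ ⟶ Z') :
    S ◁ qπ M N ≫ qact M N ≫ k =
      (α_ S M.X N.X).inv ≫ M.act ▷ N.X ≫ qπ M N ≫ k := by
  rw [reassoc_of% @qπ_qact]

/-- The relative tensor product `M ⊗[S] N` as an `S`-module. -/
def tObj (M N : Mod C S) : Mod C S :=
  ofAct (qX M N) (qact M N)
    (by
      rw [← cancel_epi (_ ◁ qπ M N), whisker_exchange_assoc, qπ_qact,
        associator_inv_naturality_left_assoc, ← comp_whiskerRight_assoc, one_act]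
      simp)
    (by
      rw [← cancel_epi (_ ◁ qπ M N), whisker_exchange_assoc, qπ_qact,
        associator_inv_naturality_left_assoc, ← comp_whiskerRight_assoc, mul_act,
        associator_naturality_right_assoc, ← whiskerLeft_comp_assoc, qπ_qact]
      simp)


/-- The projection `M ⊗ N ⟶ M ⊗[S] N`. -/
def tπ (M N : Mod C S) : M.X ⊗ N.X ⟶ (tObj M N).X := qπ M N

lemma tπ_condition (M N : Mod C S) :
    M.ract ▷ N.X ≫ tπ M N = (α_ M.X S N.X).hom ≫ M.X ◁ N.act ≫ tπ M N :=
  qπ_condition M N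

lemma tπ_condition_assoc (M N : Mod C S) {Z' : C} (k : _ ⟶ Z') :
    M.ract ▷ N.X ≫ tπ M N ≫ k =
      (α_ M.X S N.X).hom ≫ M.X ◁ N.act ≫ tπ M N ≫ k := by
  rw [reassoc_of% @tπ_condition]

instance (M N : Mod C S) : Epi (tπ M N) := inferInstanceAs (Epi (qπ M N))

instance (Z : C) (M N : Mod C S) : Epi (Z ◁ tπ M N) := inferInstanceAs (Epi (Z ◁ qπ M N))

instance (Z : C) (M N : Mod C S) : Epi (tπ M N ▷ Z) := inferInstanceAs (Epi (qπ M N ▷ Z))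

instance (Z W : C) (M N : Mod C S) : Epi (tπ M N ▷ Z ▷ W) :=
  inferInstanceAs (Epi ((tensorRight Z ⋙ tensorRight W).map (coequalizer.π _ _)))

instance (Z W : C) (M N : Mod C S) : Epi (Z ◁ W ◁ tπ M N) :=
  inferInstanceAs (Epi ((tensorLeft W ⋙ tensorLeft Z).map (coequalizer.π _ _)))

instance (Z W : C) (M N : Mod C S) : Epi (Z ◁ tπ M N ▷ W) :=
  inferInstanceAs (Epi ((tensorRight W ⋙ tensorLeft Z).map (coequalizer.π _ _)))

/-- The universal property of `M ⊗[S] N`. -/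
def tdesc {M N : Mod C S} {W : C} (f : M.X ⊗ N.X ⟶ W)
    (h : M.ract ▷ N.X ≫ f = (α_ M.X S N.X).hom ≫ M.X ◁ N.act ≫ f) : (tObj M N).X ⟶ W :=
  qdesc f h

@[simp]
lemma tπ_tdesc {M N : Mod C S} {W : C} (f : M.X ⊗ N.X ⟶ W) (h) : tπ M N ≫ tdesc f h = f :=
  qπ_qdesc f h

@[simp]
lemma tπ_tdesc_assoc {M N : Mod C S} {W : C} (f : M.X ⊗ N.X ⟶ W) (h) {Z' : C} (k : _ ⟶ Z') :
    tπ M N ≫ tdesc f h ≫ k =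
      f ≫ k := by
  rw [reassoc_of% @tπ_tdesc]

/-- The universal property of `Z ⊗ (M ⊗[S] N)`. -/
def tdescL {M N : Mod C S} {Z W : C} (f : Z ⊗ (M.X ⊗ N.X) ⟶ W)
    (h : Z ◁ (M.ract ▷ N.X) ≫ f = Z ◁ (α_ M.X S N.X).hom ≫ Z ◁ M.X ◁ N.act ≫ f) :
    Z ⊗ (tObj M N).X ⟶ W :=
  qdescL f h

@[simp]
lemma tπ_tdescL {M N : Mod C S} {Z W : C} (f : Z ⊗ (M.X ⊗ N.X) ⟶ W) (h) :
    Z ◁ tπ M N ≫ tdescL f h = f :=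
  qπ_qdescL f h

@[simp]
lemma tπ_tdescL_assoc {M N : Mod C S} {Z W : C} (f : Z ⊗ (M.X ⊗ N.X) ⟶ W) (h) {Z' : C} (k : _ ⟶ Z') :
    Z ◁ tπ M N ≫ tdescL f h ≫ k =
      f ≫ k := by
  rw [reassoc_of% @tπ_tdescL]

/-- The universal property of `(M ⊗[S] N) ⊗ Z`. -/
def tdescR {M N : Mod C S} {Z W : C} (f : (M.X ⊗ N.X) ⊗ Z ⟶ W)
    (h : (M.ract ▷ N.X) ▷ Z ≫ f = (α_ M.X S N.X).hom ▷ Z ≫ (M.X ◁ N.act) ▷ Z ≫ f) :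
    (tObj M N).X ⊗ Z ⟶ W :=
  qdescR f h

@[simp]
lemma tπ_tdescR {M N : Mod C S} {Z W : C} (f : (M.X ⊗ N.X) ⊗ Z ⟶ W) (h) :
    tπ M N ▷ Z ≫ tdescR f h = f :=
  qπ_qdescR f h

@[simp]
lemma tπ_tdescR_assoc {M N : Mod C S} {Z W : C} (f : (M.X ⊗ N.X) ⊗ Z ⟶ W) (h) {Z' : C} (k : _ ⟶ Z') :
    tπ M N ▷ Z ≫ tdescR f h ≫ k =
      f ≫ k := by
  rw [reassoc_of% @tπ_tdescR]

@[simp]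
lemma tπ_act (M N : Mod C S) :
    S ◁ tπ M N ≫ (tObj M N).act = (α_ S M.X N.X).inv ≫ M.act ▷ N.X ≫ tπ M N :=
  qπ_qact M N

@[simp]
lemma tπ_act_assoc (M N : Mod C S) {Z' : C} (k : _ ⟶ Z') :
    S ◁ tπ M N ≫ (tObj M N).act ≫ k =
      (α_ S M.X N.X).inv ≫ M.act ▷ N.X ≫ tπ M N ≫ k := by
  rw [reassoc_of% @tπ_act]

lemma tπ_ract (M N : Mod C S) :
    tπ M N ▷ S ≫ (tObj M N).ract = (α_ M.X N.X S).hom ≫ M.X ◁ N.ract ≫ tπ M N := by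
  simp only [ract, BraidedCategory.braiding_naturality_left_assoc, tπ_act,
    BraidedCategory.braiding_tensor_left_hom, Category.assoc, Iso.hom_inv_id_assoc]
  rw [← comp_whiskerRight_assoc]
  have := tπ_condition M N
  rw [ract] at this
  rw [this]
  simp

lemma tπ_ract_assoc (M N : Mod C S) {Z' : C} (k : _ ⟶ Z') :
    tπ M N ▷ S ≫ (tObj M N).ract ≫ k =
      (α_ M.X N.X S).hom ≫ M.X ◁ N.ract ≫ tπ M N ≫ k := by
  rw [reassoc_of% @tπ_ract]

@[ext]
lemma tObj_hom_ext {M N P : Mod C S} {f g : tObj M N ⟶ P}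
    (h : tπ M N ≫ f.hom = tπ M N ≫ g.hom) : f = g := by
  ext
  rwa [← cancel_epi (tπ M N)]

/-- The functoriality of the relative tensor product. -/
def tHom {M M' N N' : Mod C S} (f : M ⟶ M') (g : N ⟶ N') : tObj M N ⟶ tObj M' N' :=
  ofHom (tdesc ((f.hom ⊗ₘ g.hom) ≫ tπ M' N') (by
      rw [MonoidalCategory.tensorHom_def, Category.assoc, ← comp_whiskerRight_assoc, ract_hom,
        comp_whiskerRight_assoc, ← whisker_exchange_assoc, tπ_condition,
        associator_naturality_right_assoc, associator_naturality_left_assoc,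
        ← whiskerLeft_comp_assoc, ← act_hom, whiskerLeft_comp_assoc, ← whisker_exchange_assoc]))
    (by
      rw [← cancel_epi (S ◁ tπ M N)]
      simp only [tπ_act_assoc, tπ_tdesc, ← whiskerLeft_comp_assoc]
      simp only [whiskerLeft_comp, Category.assoc, tπ_act, MonoidalCategory.tensorHom_def]
      rw [associator_inv_naturality_right_assoc, whisker_exchange_assoc,
        associator_inv_naturality_middle_assoc, ← comp_whiskerRight_assoc, act_hom,
        comp_whiskerRight_assoc])

@[simp]
lemma tπ_tHom {M M' N N' : Mod C S} (f : M ⟶ M') (g : N ⟶ N') :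
    tπ M N ≫ (tHom f g).hom = (f.hom ⊗ₘ g.hom) ≫ tπ M' N' := by
  simp [tHom]

@[simp]
lemma tπ_tHom_assoc {M M' N N' : Mod C S} (f : M ⟶ M') (g : N ⟶ N') {Z' : C} (k : _ ⟶ Z') :
    tπ M N ≫ (tHom f g).hom ≫ k =
      (f.hom ⊗ₘ g.hom) ≫ tπ M' N' ≫ k := by
  rw [reassoc_of% @tπ_tHom]

/-- The left unitor. -/
def tLeftUnitor (M : Mod C S) : tObj (tUnit S) M ≅ M :=
  ofIso
    { hom := tdesc M.act (by simp [mul_act])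
      inv := (λ_ M.X).inv ≫ MonObj.one ▷ M.X ≫ tπ (tUnit S) M
      hom_inv_id := by
        rw [← cancel_epi (tπ _ _)]
        have h := tπ_condition (tUnit S) M
        rw [tUnit_ract, ← Iso.inv_comp_eq] at h
        rw [tπ_tdesc_assoc, leftUnitor_inv_naturality_assoc, whisker_exchange_assoc, ← h,
          associator_inv_naturality_left_assoc, ← comp_whiskerRight_assoc, MonObj.one_mul]
        simp
      inv_hom_id := by simp }
    (by
      rw [← cancel_epi (S ◁ tπ _ _)]
      simp only [tπ_act_assoc, tπ_tdesc, ← whiskerLeft_comp_assoc]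
      simp [mul_act])

@[simp]
lemma tπ_tLeftUnitor (M : Mod C S) : tπ (tUnit S) M ≫ (tLeftUnitor M).hom.hom = M.act := by
  simp [tLeftUnitor]

@[simp]
lemma tπ_tLeftUnitor_assoc (M : Mod C S) {Z' : C} (k : _ ⟶ Z') :
    tπ (tUnit S) M ≫ (tLeftUnitor M).hom.hom ≫ k =
      M.act ≫ k := by
  rw [reassoc_of% @tπ_tLeftUnitor]

lemma tBraiding_aux (M N : Mod C S) : M.ract ▷ N.X ≫ (β_ M.X N.X).hom ≫ tπ N M =
    (α_ M.X S N.X).hom ≫ M.X ◁ N.act ≫ (β_ M.X N.X).hom ≫ tπ N M := by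
  have h := tπ_condition N M
  rw [ract] at h ⊢
  simp only [BraidedCategory.braiding_naturality_left_assoc,
    BraidedCategory.braiding_naturality_right_assoc, comp_whiskerRight, Category.assoc,
    BraidedCategory.braiding_tensor_left_hom, BraidedCategory.braiding_tensor_right_hom] at h ⊢
  rw [← Iso.inv_comp_eq] at h
  rw [← h]
  rw [Iso.hom_inv_id_assoc, Iso.hom_inv_id_assoc, ← comp_whiskerRight_assoc (β_ S N.X).hom,
    SymmetricCategory.symmetry, id_whiskerRight, Category.id_comp]

/-- The braiding. -/
def tBraiding (M N : Mod C S) : tObj M N ≅ tObj N M :=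
  ofIso
    { hom := tdesc ((β_ M.X N.X).hom ≫ tπ N M) (tBraiding_aux M N)
      inv := tdesc ((β_ N.X M.X).hom ≫ tπ M N) (tBraiding_aux N M)
      hom_inv_id := by
        rw [← cancel_epi (tπ _ _)]
        simp
      inv_hom_id := by
        rw [← cancel_epi (tπ _ _)]
        simp }
    (by
      rw [← cancel_epi (S ◁ tπ _ _)]
      simp only [tπ_act_assoc, tπ_tdesc, ← whiskerLeft_comp_assoc]
      simp only [whiskerLeft_comp, Category.assoc, tπ_act]
      have h := tπ_condition N M
      rw [ract, ← Iso.inv_comp_eq, comp_whiskerRight_assoc] at h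
      rw [BraidedCategory.braiding_naturality_left_assoc, ← h,
        BraidedCategory.braiding_tensor_left_hom]
      simp only [Category.assoc, Iso.inv_hom_id_assoc, Iso.hom_inv_id_assoc]
      rw [← comp_whiskerRight_assoc (β_ S N.X).hom,
        SymmetricCategory.symmetry, id_whiskerRight, Category.id_comp])

@[simp]
lemma tπ_tBraiding (M N : Mod C S) :
    tπ M N ≫ (tBraiding M N).hom.hom = (β_ M.X N.X).hom ≫ tπ N M := by
  simp [tBraiding]

@[simp]
lemma tπ_tBraiding_assoc (M N : Mod C S) {Z' : C} (k : _ ⟶ Z') :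
    tπ M N ≫ (tBraiding M N).hom.hom ≫ k =
      (β_ M.X N.X).hom ≫ tπ N M ≫ k := by
  rw [reassoc_of% @tπ_tBraiding]

/-- The right unitor. -/
def tRightUnitor (M : Mod C S) : tObj M (tUnit S) ≅ M := tBraiding _ _ ≪≫ tLeftUnitor M

@[simp]
lemma tπ_tRightUnitor (M : Mod C S) : tπ M (tUnit S) ≫ (tRightUnitor M).hom.hom = M.ract := by
  simp [tRightUnitor, ract]

@[simp]
lemma tπ_tRightUnitor_assoc (M : Mod C S) {Z' : C} (k : _ ⟶ Z') :
    tπ M (tUnit S) ≫ (tRightUnitor M).hom.hom ≫ k =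
      M.ract ≫ k := by
  rw [reassoc_of% @tπ_tRightUnitor]

/-- Auxiliary morphism for the associator. -/
def tAssocHomAux (M N P : Mod C S) : (tObj M N).X ⊗ P.X ⟶ (tObj M (tObj N P)).X :=
  tdescR ((α_ M.X N.X P.X).hom ≫ M.X ◁ tπ N P ≫ tπ M (tObj N P)) (by
    rw [associator_naturality_left_assoc, associator_naturality_middle_assoc,
      ← whisker_exchange_assoc, tπ_condition, associator_naturality_right_assoc,
      ← whiskerLeft_comp_assoc, tπ_act]
    simp)

@[simp]
lemma tπ_tAssocHomAux (M N P : Mod C S) : tπ M N ▷ P.X ≫ tAssocHomAux M N P =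
    (α_ M.X N.X P.X).hom ≫ M.X ◁ tπ N P ≫ tπ M (tObj N P) :=
  tπ_tdescR _ _

@[simp]
lemma tπ_tAssocHomAux_assoc (M N P : Mod C S) {Z' : C} (k : _ ⟶ Z') :
    tπ M N ▷ P.X ≫ tAssocHomAux M N P ≫ k =
      (α_ M.X N.X P.X).hom ≫ M.X ◁ tπ N P ≫ tπ M (tObj N P) ≫ k := by
  rw [reassoc_of% @tπ_tAssocHomAux]

/-- Auxiliary morphism for the associator. -/
def tAssocInvAux (M N P : Mod C S) : M.X ⊗ (tObj N P).X ⟶ (tObj (tObj M N) P).X :=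
  tdescL ((α_ M.X N.X P.X).inv ≫ tπ M N ▷ P.X ≫ tπ (tObj M N) P) (by
    rw [associator_inv_naturality_middle_assoc, associator_inv_naturality_right_assoc,
      whisker_exchange_assoc]
    have h := tπ_condition (tObj M N) P
    have h2 := tπ_ract M N
    rw [← Iso.inv_comp_eq] at h h2
    rw [← h, associator_inv_naturality_left_assoc, ← comp_whiskerRight_assoc (tπ M N ▷ S), ← comp_whiskerRight_assoc (M.X ◁ N.ract), ← h2]
    simp)

@[simp]
lemma tπ_tAssocInvAux (M N P : Mod C S) : M.X ◁ tπ N P ≫ tAssocInvAux M N P =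
    (α_ M.X N.X P.X).inv ≫ tπ M N ▷ P.X ≫ tπ (tObj M N) P :=
  tπ_tdescL _ _

@[simp]
lemma tπ_tAssocInvAux_assoc (M N P : Mod C S) {Z' : C} (k : _ ⟶ Z') :
    M.X ◁ tπ N P ≫ tAssocInvAux M N P ≫ k =
      (α_ M.X N.X P.X).inv ≫ tπ M N ▷ P.X ≫ tπ (tObj M N) P ≫ k := by
  rw [reassoc_of% @tπ_tAssocInvAux]

/-- The associator. -/
def tAssociator (M N P : Mod C S) : tObj (tObj M N) P ≅ tObj M (tObj N P) :=
  ofIso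
    { hom := tdesc (tAssocHomAux M N P) (by
        rw [← cancel_epi ((tπ M N ▷ S) ▷ P.X)]
        rw [← comp_whiskerRight_assoc, tπ_ract, associator_naturality_left_assoc,
          ← whisker_exchange_assoc]
        simp only [comp_whiskerRight, Category.assoc, tπ_tAssocHomAux]
        rw [associator_naturality_middle_assoc, ← whiskerLeft_comp_assoc, tπ_condition]
        simp)
      inv := tdesc (tAssocInvAux M N P) (by
        rw [← cancel_epi ((M.X ⊗ S) ◁ tπ N P), whisker_exchange_assoc,
          associator_naturality_right_assoc, ← whiskerLeft_comp_assoc, tπ_act]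
        simp only [whiskerLeft_comp, Category.assoc, tπ_tAssocInvAux]
        rw [associator_inv_naturality_left_assoc, ← comp_whiskerRight_assoc, tπ_condition]
        simp)
      hom_inv_id := by
        rw [← cancel_epi (tπ _ _), ← cancel_epi (tπ M N ▷ P.X)]
        simp
      inv_hom_id := by
        rw [← cancel_epi (tπ _ _), ← cancel_epi (M.X ◁ tπ N P)]
        simp }
    (by
      rw [← cancel_epi (S ◁ tπ _ _), ← cancel_epi (S ◁ tπ _ _ ▷ _)]
      simp only [tπ_act_assoc, tπ_tdesc, ← whiskerLeft_comp_assoc, tπ_tAssocHomAux]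
      simp only [whiskerLeft_comp, Category.assoc, tπ_act]
      rw [associator_inv_naturality_middle_assoc, ← comp_whiskerRight_assoc, tπ_act]
      simp only [comp_whiskerRight, Category.assoc, tπ_tAssocHomAux]
      rw [associator_inv_naturality_right_assoc, whisker_exchange_assoc]
      simp)

@[simp]
lemma tπ_tAssociator (M N P : Mod C S) :
    tπ M N ▷ P.X ≫ tπ (tObj M N) P ≫ (tAssociator M N P).hom.hom =
    (α_ M.X N.X P.X).hom ≫ M.X ◁ tπ N P ≫ tπ M (tObj N P) := by
  simp [tAssociator]

@[simp]
lemma tπ_tAssociator_assoc (M N P : Mod C S) {Z' : C} (k : _ ⟶ Z') :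
    tπ M N ▷ P.X ≫ tπ (tObj M N) P ≫ (tAssociator M N P).hom.hom ≫ k =
      (α_ M.X N.X P.X).hom ≫ M.X ◁ tπ N P ≫ tπ M (tObj N P) ≫ k := by
  rw [reassoc_of% @tπ_tAssociator]

instance : MonoidalCategoryStruct (Mod C S) where
  tensorObj M N := tObj M N
  whiskerLeft M _ _ f := tHom (𝟙 M) f
  whiskerRight f N := tHom f (𝟙 N)
  tensorHom f g := tHom f g
  tensorUnit := tUnit S
  associator := tAssociator
  leftUnitor := tLeftUnitor
  rightUnitor := tRightUnitor

/-- The canonical projection `M ⊗ N ⟶ M ⊗[S] N`. -/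
def π (M N : Mod C S) : M.X ⊗ N.X ⟶ (M ⊗ N).X := tπ M N

lemma π_condition (M N : Mod C S) :
    M.ract ▷ N.X ≫ π M N = (α_ M.X S N.X).hom ≫ M.X ◁ N.act ≫ π M N :=
  tπ_condition M N

lemma π_condition_assoc (M N : Mod C S) {Z' : C} (k : _ ⟶ Z') :
    M.ract ▷ N.X ≫ π M N ≫ k =
      (α_ M.X S N.X).hom ≫ M.X ◁ N.act ≫ π M N ≫ k := by
  rw [reassoc_of% @π_condition]

instance (M N : Mod C S) : Epi (π M N) := inferInstanceAs (Epi (tπ M N))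
instance (Z : C) (M N : Mod C S) : Epi (Z ◁ π M N) := inferInstanceAs (Epi (Z ◁ tπ M N))
instance (Z : C) (M N : Mod C S) : Epi (π M N ▷ Z) := inferInstanceAs (Epi (tπ M N ▷ Z))
instance (Z W : C) (M N : Mod C S) : Epi (π M N ▷ Z ▷ W) := inferInstanceAs (Epi (tπ M N ▷ Z ▷ W))
instance (Z W : C) (M N : Mod C S) : Epi (Z ◁ W ◁ π M N) := inferInstanceAs (Epi (Z ◁ W ◁ tπ M N))

@[simp]
lemma π_tensorHom {M M' N N' : Mod C S} (f : M ⟶ M') (g : N ⟶ N') :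
    π M N ≫ (f ⊗ₘ g).hom = (f.hom ⊗ₘ g.hom) ≫ π M' N' := tπ_tHom f g

@[simp]
lemma π_tensorHom_assoc {M M' N N' : Mod C S} (f : M ⟶ M') (g : N ⟶ N') {Z' : C} (k : _ ⟶ Z') :
    π M N ≫ (f ⊗ₘ g).hom ≫ k =
      (f.hom ⊗ₘ g.hom) ≫ π M' N' ≫ k := by
  rw [reassoc_of% @π_tensorHom]

@[simp]
lemma π_whiskerLeft (M : Mod C S) {N N' : Mod C S} (g : N ⟶ N') :
    π M N ≫ (M ◁ g).hom = M.X ◁ g.hom ≫ π M N' :=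
  (tπ_tHom (𝟙 M) g).trans (by simp [π])

@[simp]
lemma π_whiskerLeft_assoc (M : Mod C S) {N N' : Mod C S} (g : N ⟶ N') {Z' : C} (k : _ ⟶ Z') :
    π M N ≫ (M ◁ g).hom ≫ k =
      M.X ◁ g.hom ≫ π M N' ≫ k := by
  rw [reassoc_of% @π_whiskerLeft]

@[simp]
lemma π_whiskerRight {M M' : Mod C S} (f : M ⟶ M') (N : Mod C S) :
    π M N ≫ (f ▷ N).hom = f.hom ▷ N.X ≫ π M' N :=
  (tπ_tHom f (𝟙 N)).trans (by simp [π])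

@[simp]
lemma π_whiskerRight_assoc {M M' : Mod C S} (f : M ⟶ M') (N : Mod C S) {Z' : C} (k : _ ⟶ Z') :
    π M N ≫ (f ▷ N).hom ≫ k =
      f.hom ▷ N.X ≫ π M' N ≫ k := by
  rw [reassoc_of% @π_whiskerRight]

@[simp]
lemma π_leftUnitor (M : Mod C S) : π (𝟙_ (Mod C S)) M ≫ (λ_ M).hom.hom = M.act :=
  tπ_tLeftUnitor M

@[simp]
lemma π_leftUnitor_assoc (M : Mod C S) {Z' : C} (k : _ ⟶ Z') :
    π (𝟙_ (Mod C S)) M ≫ (λ_ M).hom.hom ≫ k =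
      M.act ≫ k := by
  rw [reassoc_of% @π_leftUnitor]

@[simp]
lemma π_rightUnitor (M : Mod C S) : π M (𝟙_ (Mod C S)) ≫ (ρ_ M).hom.hom = M.ract :=
  tπ_tRightUnitor M

@[simp]
lemma π_rightUnitor_assoc (M : Mod C S) {Z' : C} (k : _ ⟶ Z') :
    π M (𝟙_ (Mod C S)) ≫ (ρ_ M).hom.hom ≫ k =
      M.ract ≫ k := by
  rw [reassoc_of% @π_rightUnitor]

@[simp]
lemma π_associator (M N P : Mod C S) :
    π M N ▷ P.X ≫ π (M ⊗ N) P ≫ (α_ M N P).hom.hom =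
    (α_ M.X N.X P.X).hom ≫ M.X ◁ π N P ≫ π M (N ⊗ P) :=
  tπ_tAssociator M N P

@[simp]
lemma π_associator_assoc (M N P : Mod C S) {Z' : C} (k : _ ⟶ Z') :
    π M N ▷ P.X ≫ π (M ⊗ N) P ≫ (α_ M N P).hom.hom ≫ k =
      (α_ M.X N.X P.X).hom ≫ M.X ◁ π N P ≫ π M (N ⊗ P) ≫ k := by
  rw [reassoc_of% @π_associator]

@[simp]
lemma whiskerLeft_π_act (M N : Mod C S) :
    S ◁ π M N ≫ (M ⊗ N).act = (α_ S M.X N.X).inv ≫ M.act ▷ N.X ≫ π M N :=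
  tπ_act M N

@[simp]
lemma whiskerLeft_π_act_assoc (M N : Mod C S) {Z' : C} (k : _ ⟶ Z') :
    S ◁ π M N ≫ (M ⊗ N).act ≫ k =
      (α_ S M.X N.X).inv ≫ M.act ▷ N.X ≫ π M N ≫ k := by
  rw [reassoc_of% @whiskerLeft_π_act]

@[simp]
lemma π_tBraiding (M N : Mod C S) :
    π M N ≫ Mod.Hom.hom (M := M ⊗ N) (N := N ⊗ M) (tBraiding M N).hom =
      (β_ M.X N.X).hom ≫ π N M :=
  tπ_tBraiding M N

@[simp]
lemma π_tBraiding_assoc (M N : Mod C S) {Z' : C} (k : _ ⟶ Z') :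
    π M N ≫ Mod.Hom.hom (M := M ⊗ N) (N := N ⊗ M) (tBraiding M N).hom ≫ k =
      (β_ M.X N.X).hom ≫ π N M ≫ k := by
  rw [reassoc_of% @π_tBraiding]

lemma tensor_hom_ext {M N P : Mod C S} {f g : M ⊗ N ⟶ P}
    (h : π M N ≫ f.hom = π M N ≫ g.hom) : f = g := tObj_hom_ext h

lemma tensor₃_hom_ext {M N P Q : Mod C S} {f g : (M ⊗ N) ⊗ P ⟶ Q}
    (h : π M N ▷ P.X ≫ π (M ⊗ N) P ≫ f.hom = π M N ▷ P.X ≫ π (M ⊗ N) P ≫ g.hom) : f = g :=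
  tensor_hom_ext ((cancel_epi _).1 h)

instance : MonoidalCategory (Mod C S) := MonoidalCategory.ofTensorHom
  (id_tensorHom_id := fun M N ↦ tensor_hom_ext (by simp))
  (id_tensorHom := fun M _ _ f ↦ rfl)
  (tensorHom_id := fun f N ↦ rfl)
  (tensorHom_comp_tensorHom := fun f₁ f₂ g₁ g₂ ↦ tensor_hom_ext (by simp))
  (associator_naturality := fun {X₁ X₂ X₃ Y₁ Y₂ Y₃} f₁ f₂ f₃ ↦ tensor₃_hom_ext (by
    have h : π X₁ X₂ ▷ X₃.X ≫ ((f₁ ⊗ₘ f₂).hom ⊗ₘ f₃.hom) =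
        ((f₁.hom ⊗ₘ f₂.hom) ⊗ₘ f₃.hom) ≫ π Y₁ Y₂ ▷ Y₃.X := by
      simp only [MonoidalCategory.tensorHom_def (_ : (_ : C) ⟶ _), Category.assoc,
        whisker_exchange, ← comp_whiskerRight_assoc, π_tensorHom]
    have h' : X₁.X ◁ π X₂ X₃ ≫ (f₁.hom ⊗ₘ (f₂ ⊗ₘ f₃).hom) =
        (f₁.hom ⊗ₘ f₂.hom ⊗ₘ f₃.hom) ≫ Y₁.X ◁ π Y₂ Y₃ := by
      simp only [MonoidalCategory.tensorHom_def (_ : (_ : C) ⟶ _), Category.assoc,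
        whisker_exchange_assoc, ← whiskerLeft_comp, π_tensorHom]
    simp only [comp_hom', π_tensorHom_assoc, reassoc_of% h, π_associator, π_associator_assoc,
      π_tensorHom, reassoc_of% h', MonoidalCategory.associator_naturality_assoc]))
  (leftUnitor_naturality := fun {M N} f ↦ tensor_hom_ext (by
    rw [comp_hom', comp_hom', π_tensorHom_assoc, π_leftUnitor_assoc, π_leftUnitor, act_hom]
    simp
    rfl))
  (rightUnitor_naturality := fun f ↦ tensor_hom_ext (by
    rw [comp_hom', comp_hom', π_tensorHom_assoc, π_rightUnitor_assoc, π_rightUnitor, ract_hom]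
    simp
    rfl))
  (pentagon := fun M N P Q ↦ tensor_hom_ext (by
    change _ ≫ ((α_ M N P).hom ▷ Q ≫ (α_ M (N ⊗ P) Q).hom ≫ M ◁ (α_ N P Q).hom).hom = _
    rw [← cancel_epi (π _ _ ▷ _), ← cancel_epi (π _ _ ▷ _ ▷ _)]
    simp only [comp_hom', π_whiskerRight_assoc, π_associator_assoc]
    rw [← comp_whiskerRight_assoc (π (M ⊗ N) P), ← comp_whiskerRight_assoc (π M N ▷ P.X),
      π_associator, associator_naturality_left_assoc, ← whisker_exchange_assoc, π_associator]
    simp only [comp_whiskerRight, Category.assoc, π_associator_assoc, π_whiskerLeft,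
      associator_naturality_middle_assoc, ← whiskerLeft_comp_assoc, π_associator]
    simp))
  (triangle := fun M N ↦ tensor₃_hom_ext (by
    change _ ≫ _ ≫ ((α_ M (𝟙_ (Mod C S)) N).hom ≫ M ◁ (λ_ N).hom).hom =
      _ ≫ _ ≫ ((ρ_ M).hom ▷ N).hom
    simp only [comp_hom', π_whiskerRight, ← comp_whiskerRight_assoc, π_rightUnitor,
      π_associator_assoc, π_whiskerLeft, ← whiskerLeft_comp_assoc, π_leftUnitor]
    exact (π_condition M N).symm))

@[simp]
lemma π_associator_inv (M N P : Mod C S) :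
    M.X ◁ π N P ≫ π M (N ⊗ P) ≫ (α_ M N P).inv.hom =
    (α_ M.X N.X P.X).inv ≫ π M N ▷ P.X ≫ π (M ⊗ N) P := by
  have h : (α_ M N P).hom.hom ≫ (α_ M N P).inv.hom = 𝟙 _ := by
    rw [← comp_hom', Iso.hom_inv_id, id_hom']
  rw [← cancel_epi (α_ M.X N.X P.X).hom, ← π_associator_assoc, h]
  simp

@[simp]
lemma π_associator_inv_assoc (M N P : Mod C S) {Z' : C} (k : _ ⟶ Z') :
    M.X ◁ π N P ≫ π M (N ⊗ P) ≫ (α_ M N P).inv.hom ≫ k =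
      (α_ M.X N.X P.X).inv ≫ π M N ▷ P.X ≫ π (M ⊗ N) P ≫ k := by
  rw [reassoc_of% @π_associator_inv]

instance : SymmetricCategory (Mod C S) where
  braiding := tBraiding
  braiding_naturality_right M _ _ f := tensor_hom_ext (by
    simp only [comp_hom', π_whiskerLeft_assoc, π_tBraiding, π_tBraiding_assoc, π_whiskerRight]
    simp)
  braiding_naturality_left f M := tensor_hom_ext (by
    simp only [comp_hom', π_whiskerRight_assoc, π_tBraiding, π_tBraiding_assoc, π_whiskerLeft]
    simp)
  hexagon_forward M N P := tensor₃_hom_ext (by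
    simp only [comp_hom', π_associator_assoc, π_tBraiding_assoc, π_whiskerRight_assoc,
      BraidedCategory.braiding_naturality_right_assoc, π_associator]
    rw [← comp_whiskerRight_assoc, π_tBraiding, comp_whiskerRight_assoc, π_associator_assoc,
      π_whiskerLeft, ← whiskerLeft_comp_assoc, π_tBraiding]
    simp)
  hexagon_reverse M N P := tensor_hom_ext (by
    rw [← cancel_epi (_ ◁ π _ _)]
    simp only [comp_hom', π_associator_inv_assoc, π_tBraiding_assoc, π_whiskerLeft_assoc,
      BraidedCategory.braiding_naturality_left_assoc, π_associator_inv]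
    rw [← whiskerLeft_comp_assoc, π_tBraiding, whiskerLeft_comp_assoc, π_associator_inv_assoc,
      π_whiskerRight, ← comp_whiskerRight_assoc, π_tBraiding]
    simp)
  symmetry M N := tensor_hom_ext (by
    simp only [comp_hom', π_tBraiding_assoc, π_tBraiding]
    simp)

@[simp]
lemma π_braiding (M N : Mod C S) : π M N ≫ (β_ M N).hom.hom = (β_ M.X N.X).hom ≫ π N M :=
  tπ_tBraiding M N

@[simp]
lemma π_braiding_assoc (M N : Mod C S) {Z' : C} (k : _ ⟶ Z') :
    π M N ≫ (β_ M N).hom.hom ≫ k =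
      (β_ M.X N.X).hom ≫ π N M ≫ k := by
  rw [reassoc_of% @π_braiding]

end Tensor
end CategoryTheory.Mod


section ModelStructure

namespace CategoryTheory.Mod

variable {C : Type u} [Category.{v} C] [MonoidalCategory C] (R : C) [MonObj R]

/-- Weak equivalences of modules are the maps which are weak equivalences in `C`. -/
instance [CategoryWithWeakEquivalences C] : CategoryWithWeakEquivalences (Mod C R) where
  weakEquivalences := (weakEquivalences C).inverseImage (forget R)

/-- Fibrations of modules are the maps which are fibrations in `C`. -/
instance [CategoryWithFibrations C] : CategoryWithFibrations (Mod C R) where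
  fibrations := (fibrations C).inverseImage (forget R)

/-- Cofibrations of modules are the maps with the left lifting property with respect to
the maps of modules which are both fibrations and weak equivalences. -/
instance [CategoryWithWeakEquivalences C] [CategoryWithFibrations C] :
    CategoryWithCofibrations (Mod C R) where
  cofibrations := (trivialFibrations (Mod C R)).llp

instance [HasTerminal C] : HasTerminal (Mod C R) := by
  let T : Mod C R := ofAct (⊤_ C) (terminal.from _) (terminal.hom_ext _ _) (terminal.hom_ext _ _)
  have (M : Mod C R) : Unique (M ⟶ T) :=
    { default := ofHom (terminal.from _) (terminal.hom_ext _ _)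
      uniq f := by ext; exact terminal.hom_ext _ _ }
  exact hasTerminal_of_unique T

instance [HasInitial C] [∀ X : C, PreservesColimitsOfSize.{0, 0} (tensorLeft X)] :
    HasInitial (Mod C R) := by
  let t (X : C) : IsInitial (X ⊗ (⊥_ C)) :=
    IsInitial.isInitialObj (tensorLeft X) _ initialIsInitial
  let T : Mod C R := ofAct (⊥_ C) ((t R).to _) ((t _).hom_ext _ _) ((t _).hom_ext _ _)
  have (M : Mod C R) : Unique (T ⟶ M) :=
    { default := ofHom (initial.to _) ((t R).hom_ext _ _)
      uniq f := by ext; exact initial.hom_ext _ _ }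
  exact hasInitial_of_unique T

end CategoryTheory.Mod

namespace HomotopicalAlgebra

/-- A symmetric monoidal model category: a bicomplete closed symmetric monoidal category with a
model structure satisfying the pushout-product axiom and the unit axiom. -/
class IsSymmetricMonoidalModelCategory (C : Type u) [Category.{v} C] [MonoidalCategory C]
    [SymmetricCategory C] [CategoryWithWeakEquivalences C] [CategoryWithCofibrations C]
    [CategoryWithFibrations C] : Prop
    extends HasLimitsOfSize.{v, v} C, HasColimitsOfSize.{v, v} C where
  /-- The given weak equivalences, cofibrations and fibrations form a model structure. -/
  exists_modelCategory : ∃ m : ModelCategory C,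
    m.categoryWithWeakEquivalences = ‹CategoryWithWeakEquivalences C› ∧
    m.categoryWithCofibrations = ‹CategoryWithCofibrations C› ∧
    m.categoryWithFibrations = ‹CategoryWithFibrations C›
  closed : Nonempty (MonoidalClosed C)
  /-- Here `sq` is a pushout `Y₁ ⊗ X₂ ⟶ P ⟵ X₁ ⊗ Y₂` of `f₁ ▷ X₂` and `X₁ ◁ f₂`, and
  `sq.ι : P ⟶ Y₁ ⊗ Y₂` is the pushout-product of `f₁` and `f₂`. -/
  pushoutProduct {X₁ Y₁ X₂ Y₂ : C} (f₁ : X₁ ⟶ Y₁) (f₂ : X₂ ⟶ Y₂)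
    [Cofibration f₁] [Cofibration f₂] (sq : (curriedTensor C).PushoutObjObj f₁ f₂) :
    Cofibration sq.ι ∧ (WeakEquivalence f₁ ∨ WeakEquivalence f₂ → WeakEquivalence sq.ι)
  unit {Q : C} [IsCofibrant Q] (q : Q ⟶ 𝟙_ C) [WeakEquivalence q] (X : C) [IsCofibrant X] :
    WeakEquivalence (q ▷ X ≫ (λ_ X).hom)

section

variable {C : Type u} [Category.{v} C] [MonoidalCategory C] [SymmetricCategory C]
  [CategoryWithWeakEquivalences C] [CategoryWithCofibrations C] [CategoryWithFibrations C]
  [IsSymmetricMonoidalModelCategory C]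

instance (X : C) : PreservesColimitsOfSize.{0, 0} (tensorLeft X) :=
  letI := (IsSymmetricMonoidalModelCategory.closed (C := C)).some
  (ihom.adjunction X).leftAdjoint_preservesColimits

end

section

variable {C : Type u} [Category.{v} C]

/-- `A` is small relative to relative `W`-cell complexes: for some regular cardinal `κ`, the
functor `Hom(A, -)` preserves the colimits of all `κ`-filtered transfinite sequences of
pushouts of coproducts of maps in `W`. -/
def IsSmallRelativeTo (A : C) (W : MorphismProperty C) : Prop :=
  ∃ κ : Cardinal.{v}, ∃ _ : Fact κ.IsRegular, ∀ (J : Type v) [LinearOrder J] [SuccOrder J]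
    [OrderBot J] [WellFoundedLT J] [IsCardinalFiltered J κ] {X Y : C} (f : X ⟶ Y)
    (h : (MorphismProperty.coproducts.{v} W).pushouts.TransfiniteCompositionOfShape J f),
    PreservesColimit h.F (coyoneda.obj (Opposite.op A))

variable [MonoidalCategory C]

/-- The maps `i ⊗ X : A ⊗ X ⟶ B ⊗ X` for `i : A ⟶ B` in `W` and `X` in `C`. -/
inductive tensorMaps (W : MorphismProperty C) : MorphismProperty C
  | mk {A B : C} (i : A ⟶ B) (hi : W i) (X : C) : tensorMaps W (i ▷ X)

variable (C) [CategoryWithWeakEquivalences C] [CategoryWithCofibrations C]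
  [CategoryWithFibrations C]

/-- The monoid axiom: every transfinite composition of pushouts of maps `i ⊗ X`, where `i` is a
trivial cofibration, is a weak equivalence. -/
def MonoidAxiom : Prop :=
  MorphismProperty.transfiniteCompositions.{v} (tensorMaps (trivialCofibrations C)).pushouts ≤
    weakEquivalences C

/-- The model category `C` is cofibrantly generated by sets `I` and `J` of maps, whose domains are
small relative to cell complexes built from the maps `i ⊗ X` with `i` in `I` (resp. `J`). -/
def IsCofibrantlyGenerated : Prop :=
  ∃ I J : MorphismProperty C,
    MorphismProperty.IsSmall.{v} I ∧ MorphismProperty.IsSmall.{v} J ∧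
    trivialFibrations C = I.rlp ∧ fibrations C = J.rlp ∧
    (∀ ⦃A B : C⦄ (i : A ⟶ B), I i → IsSmallRelativeTo A (tensorMaps I)) ∧
    (∀ ⦃A B : C⦄ (j : A ⟶ B), J j → IsSmallRelativeTo A (tensorMaps J))

end

section

variable {C : Type u₁} [Category.{v₁} C] [CategoryWithWeakEquivalences C]
  [CategoryWithCofibrations C] [CategoryWithFibrations C]
  {D : Type u₂} [Category.{v₂} D] [CategoryWithWeakEquivalences D]
  [CategoryWithCofibrations D] [CategoryWithFibrations D]

/-- A Quillen adjunction: the left adjoint preserves cofibrations and trivial cofibrations. -/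
structure IsQuillenAdjunction {F : C ⥤ D} {G : D ⥤ C} (adj : F ⊣ G) : Prop where
  cofibrations_le : cofibrations C ≤ (cofibrations D).inverseImage F
  trivialCofibrations_le : trivialCofibrations C ≤ (trivialCofibrations D).inverseImage F

/-- A Quillen equivalence: a Quillen adjunction such that, for `X` cofibrant and `Y` fibrant, a
map `F X ⟶ Y` is a weak equivalence if and only if its adjunct `X ⟶ G Y` is. -/
structure IsQuillenEquivalence [HasInitial C] [HasTerminal D] {F : C ⥤ D} {G : D ⥤ C}
    (adj : F ⊣ G) : Prop extends IsQuillenAdjunction adj where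
  weakEquivalence_iff (X : C) [IsCofibrant X] (Y : D) [IsFibrant Y] (f : F.obj X ⟶ Y) :
    WeakEquivalence f ↔ WeakEquivalence (adj.homEquiv X Y f)

/-- A strong symmetric monoidal Quillen equivalence: a Quillen equivalence whose left adjoint `F`
is strong symmetric monoidal, and such that `F(Q) ⟶ F(𝟙) ≅ 𝟙` is a weak equivalence for every
cofibrant replacement `Q ⟶ 𝟙` of the unit of `C`. (The right adjoint is lax symmetric monoidal
through the adjunction.) -/
structure IsStrongSymmetricMonoidalQuillenEquivalence [MonoidalCategory C] [SymmetricCategory C]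
    [MonoidalCategory D] [SymmetricCategory D] [HasInitial C] [HasTerminal D] {F : C ⥤ D}
    [F.Braided] {G : D ⥤ C} (adj : F ⊣ G) : Prop extends IsQuillenEquivalence adj where
  unit (Q : C) [IsCofibrant Q] (q : Q ⟶ 𝟙_ C) [WeakEquivalence q] :
    WeakEquivalence (F.map q ≫ Functor.OplaxMonoidal.η F)

end

/-- Quillen invariance of modules: for every weak equivalence `θ : R ⟶ R'` of monoids in `C`,
restriction of scalars along `θ` is the right adjoint in a Quillen equivalence between `R`-modules
and `R'`-modules. -/
def QuillenInvarianceOfModules (C : Type u) [Category.{v} C] [MonoidalCategory C]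
    [SymmetricCategory C] [CategoryWithWeakEquivalences C] [CategoryWithCofibrations C]
    [CategoryWithFibrations C] [IsSymmetricMonoidalModelCategory C] : Prop :=
  ∀ (R R' : C) [MonObj R] [MonObj R'] (θ : R ⟶ R') [IsMonHom θ] [WeakEquivalence θ],
    ∃ (ext : Mod C R ⥤ Mod C R') (adj : ext ⊣ Mod.comap θ), IsQuillenEquivalence adj

end HomotopicalAlgebra

end ModelStructure

section InducedAdjunction

open Functor.LaxMonoidal Functor.OplaxMonoidal

namespace CategoryTheory

variable {C : Type u₁} [Category.{v₁} C] [MonoidalCategory C]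
  {D : Type u₂} [Category.{v₂} D] [MonoidalCategory D]

/-- The functor from `S`-modules to `F S`-modules induced by a strong monoidal functor `F`: the
action of `F S` on `F M` is `F S ⊗ F M ≅ F (S ⊗ M) ⟶ F M`. -/
def mapMod (F : C ⥤ D) [F.Monoidal] (S : C) [MonObj S] : Mod C S ⥤ Mod D (F.obj S) where
  obj M := Mod.ofAct (F.obj M.X) (Functor.LaxMonoidal.μ F S M.X ≫ F.map M.act)
    (by
      rw [Functor.obj.η_def, comp_whiskerRight_assoc, μ_natural_left_assoc, ← F.map_comp,
        Mod.one_act, Functor.LaxMonoidal.left_unitality])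
    (by
      rw [Functor.obj.μ_def, comp_whiskerRight_assoc, μ_natural_left_assoc, ← F.map_comp,
        Mod.mul_act]
      simp)
  map {M N} f := Mod.ofHom (F.map f.hom) (by
    have h : (Functor.LaxMonoidal.μ F S M.X ≫ F.map M.act) ≫ F.map f.hom =
        F.obj S ◁ F.map f.hom ≫ Functor.LaxMonoidal.μ F S N.X ≫ F.map N.act := by
      rw [μ_natural_right_assoc, Category.assoc, ← F.map_comp, ← F.map_comp, Mod.act_hom]
    exact h)
  map_id M := by ext; exact F.map_id _
  map_comp f g := by ext; exact F.map_comp _ _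

variable {F : C ⥤ D} [F.Monoidal] {G : D ⥤ C} (adj : F ⊣ G) (S : C)

lemma act_comp_homEquiv_iff {X : C} {Y : D} (a : S ⊗ X ⟶ X) (b : F.obj S ⊗ Y ⟶ Y)
    (f : F.obj X ⟶ Y) :
    (Functor.LaxMonoidal.μ F S X ≫ F.map a) ≫ f = F.obj S ◁ f ≫ b ↔
      a ≫ adj.homEquiv _ _ f = S ◁ adj.homEquiv _ _ f ≫
        adj.homEquiv _ _
          (Functor.OplaxMonoidal.δ F S (G.obj Y) ≫ F.obj S ◁ adj.counit.app Y ≫ b) := by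
  have h : F.map (adj.homEquiv _ _ f) ≫ adj.counit.app Y = f :=
    (adj.homEquiv_counit _ _ _).symm.trans ((adj.homEquiv _ _).symm_apply_apply f)
  rw [← adj.homEquiv_naturality_left, ← adj.homEquiv_naturality_left, Equiv.apply_eq_iff_eq,
    ← δ_natural_right_assoc, ← whiskerLeft_comp_assoc, h,
    Category.assoc, ← cancel_epi (Functor.OplaxMonoidal.δ F S X)]
  simp

variable [MonObj S]

lemma map_one_whiskerRight_act (N : Mod D (F.obj S)) {Z : C} (c : F.obj Z ⟶ N.X) :
    F.map (MonObj.one (X := S) ▷ Z) ≫ Functor.OplaxMonoidal.δ F S Z ≫ F.obj S ◁ c ≫ N.act =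
      F.map (λ_ Z).hom ≫ c := by
  have h := N.one_act
  rw [Functor.obj.η_def] at h
  have h2 : F.map MonObj.one ▷ N.X ≫ N.act =
      Functor.OplaxMonoidal.η F ▷ N.X ≫ (λ_ N.X).hom := by
    rw [← h, ← comp_whiskerRight_assoc, Functor.Monoidal.η_ε_assoc]
  rw [← δ_natural_left_assoc, ← whisker_exchange_assoc, h2, whisker_exchange_assoc]
  simp

lemma map_mul_whiskerRight_act (N : Mod D (F.obj S)) {Z : C} (c : F.obj Z ⟶ N.X)
    (t : S ⊗ Z ⟶ Z)
    (ht : F.map t ≫ c = Functor.OplaxMonoidal.δ F S Z ≫ F.obj S ◁ c ≫ N.act) :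
    F.map (MonObj.mul (X := S) ▷ Z) ≫ F.map t ≫ c =
      F.map (α_ S S Z).hom ≫ F.map (S ◁ t) ≫ F.map t ≫ c := by
  have h := N.mul_act
  rw [Functor.obj.μ_def] at h
  have h2 : F.map MonObj.mul ▷ N.X ≫ N.act =
      Functor.OplaxMonoidal.δ F S S ▷ N.X ≫ (α_ _ _ _).hom ≫ F.obj S ◁ N.act ≫ N.act := by
    rw [← h, ← comp_whiskerRight_assoc, Functor.Monoidal.δ_μ_assoc]
  rw [ht, ← δ_natural_left_assoc, ← whisker_exchange_assoc, h2, ← δ_natural_right_assoc,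
    ← whiskerLeft_comp_assoc (F.obj S) (F.map _), ht, whisker_exchange_assoc]
  simp

/-- The functor from `F S`-modules to `S`-modules induced by the right adjoint `G` of a strong
monoidal functor `F`: the action of `S` on `G N` is adjunct to
`F (S ⊗ G N) ≅ F S ⊗ F (G N) ⟶ F S ⊗ N ⟶ N`. -/
def mapModRightAdjoint : Mod D (F.obj S) ⥤ Mod C S where
  obj N := Mod.ofAct (G.obj N.X)
    (adj.homEquiv _ _
      (Functor.OplaxMonoidal.δ F S (G.obj N.X) ≫ F.obj S ◁ adj.counit.app N.X ≫ N.act))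
    (by
      rw [← adj.homEquiv_naturality_left, ← Equiv.eq_symm_apply, adj.homEquiv_counit]
      exact map_one_whiskerRight_act S N (adj.counit.app N.X))
    (by
      refine (adj.homEquiv _ _).symm.injective ?_
      simp only [adj.homEquiv_counit, F.map_comp, Category.assoc]
      exact map_mul_whiskerRight_act S N (adj.counit.app N.X) _
        ((adj.homEquiv_counit _ _ _).symm.trans ((adj.homEquiv _ _).symm_apply_apply _)))
  map {N N'} f := Mod.ofHom (G.map f.hom) (by
    have h : adj.homEquiv _ _ (Functor.OplaxMonoidal.δ F S (G.obj N.X) ≫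
          F.obj S ◁ adj.counit.app N.X ≫ N.act) ≫ G.map f.hom =
        S ◁ G.map f.hom ≫ adj.homEquiv _ _ (Functor.OplaxMonoidal.δ F S (G.obj N'.X) ≫
          F.obj S ◁ adj.counit.app N'.X ≫ N'.act) := by
      rw [← adj.homEquiv_naturality_right, ← adj.homEquiv_naturality_left]
      congr 1
      have h := adj.counit.naturality f.hom
      dsimp only [Functor.comp_map, Functor.id_map, Functor.comp_obj, Functor.id_obj] at h
      rw [← δ_natural_right_assoc, ← whiskerLeft_comp_assoc, h]
      simp
    exact h)
  map_id M := by ext; exact G.map_id _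
  map_comp f g := by ext; exact G.map_comp _ _

/-- The adjunction between `S`-modules and `F S`-modules induced by `F ⊣ G`. -/
def mapModAdjunction : mapMod F S ⊣ mapModRightAdjoint adj S :=
  Adjunction.mkOfHomEquiv
    { homEquiv M N :=
        { toFun f := Mod.ofHom (adj.homEquiv _ _ f.hom)
            ((act_comp_homEquiv_iff adj S _ _ f.hom).1 (Mod.act_hom f))
          invFun g := Mod.ofHom ((adj.homEquiv _ _).symm g.hom)
            ((act_comp_homEquiv_iff adj S M.act N.act _).2 (by
              have h : (adj.homEquiv M.X N.X) ((adj.homEquiv M.X N.X).symm g.hom) = g.hom :=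
                (adj.homEquiv M.X N.X).apply_symm_apply _
              exact (congrArg (M.act ≫ ·) h).trans ((Mod.act_hom g).trans
                (congrArg (fun k : M.X ⟶ G.obj N.X ↦
                  S ◁ k ≫ ((mapModRightAdjoint adj S).obj N).act) h.symm))))
          left_inv f := by ext; exact (adj.homEquiv _ _).symm_apply_apply _
          right_inv g := by ext; exact (adj.homEquiv _ _).apply_symm_apply _ }
      homEquiv_naturality_left_symm f g := by
        ext; exact adj.homEquiv_naturality_left_symm _ _
      homEquiv_naturality_right f g := by
        ext; exact adj.homEquiv_naturality_right _ _ }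

/-- The canonical map from the image of the unit `S`-module to the unit `F S`-module: it is the
identity of `F S`. -/
def mapModUnit [SymmetricCategory C] [HasCoequalizers C]
    [∀ X : C, PreservesColimitsOfSize.{0, 0} (tensorLeft X)] [SymmetricCategory D]
    [HasCoequalizers D] [∀ X : D, PreservesColimitsOfSize.{0, 0} (tensorLeft X)]
    (F : C ⥤ D) [F.Braided] (S : C) [MonObj S] [IsCommMonObj S] :
    (mapMod F S).obj (𝟙_ (Mod C S)) ⟶ 𝟙_ (Mod D (F.obj S)) :=
  Mod.ofHom (M := (mapMod F S).obj (Mod.tUnit S)) (N := Mod.tUnit (F.obj S)) (𝟙 (F.obj S)) (by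
    have h : (Functor.LaxMonoidal.μ F S S ≫ F.map (MonObj.mul (X := S))) ≫ 𝟙 (F.obj S) =
        F.obj S ◁ 𝟙 (F.obj S) ≫ Functor.LaxMonoidal.μ F S S ≫ F.map (MonObj.mul (X := S)) := by
      simp
    exact h)

end CategoryTheory

end InducedAdjunction

end

/-!
Let `S` be a commutative monoid in a cofibrantly generated symmetric monoidal model category `C`
which satisfies the monoid axiom.

Fibrations and weak equivalences of `S`-modules are created by the forgetful functor, so they are
detected by lifting against the free maps `S ⊗ i`, for `i` in the generating sets `I` and `J`.
Modules are monadic over `C`, and the underlying map of a relative cell complex of modules is a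
transfinite composition of pushouts of maps `s ⊗ S`. Hence the smallness conditions in `C` permit
the small object argument for modules (`Mod.hasSmallObjectArgument_free`), and the monoid axiom says
that cell complexes on free trivial cofibrations are weak equivalences; this gives the model
structure (`Mod.exists_modelCategory`). Modules are closed monoidal by the objects of linear maps.
By closedness, lifting properties of pushout-products may be checked on generators
(`hasLiftingProperty_pushoutProduct`), and the free module functor is strong monoidal
(`Mod.freeTensorIso`), so the pushout-product axiom descends from `C`.

The unit axiom is more delicate, as `S` need not be cofibrant in any sense. For a cofibrant
replacement `K ⟶ 𝟙` in `C`, the free module `S ⊗ K ⟶ S` is a unit up to weak equivalence for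
free modules on cofibrant objects, by the unit axiom in `C` and Ken Brown's lemma. Rephrased through
the adjoint maps `N ⟶ Hom(S ⊗ K, N)`, which for fibrant `N` are tested on maps out of such free
modules, this extends to all cofibrant modules (`weakEquivalence_whiskerRight_leftUnitor`). Then `S ⊗ K` is
compared with a cofibrant replacement of `S` as an `S`-module: by the two-out-of-six property the
lift between them is a weak equivalence (`unit_axiom_of_weakEquivalence`).

As a left adjoint, `F` preserves the coequalizers that define relative tensor products, whence the
comparison map `FM ⊗[F S] FN ⟶ F (M ⊗[S] N)` is invertible; its coherence is checked after composing
with the epimorphisms `FM ⊗ FN ⟶ FM ⊗[F S] FN`. The right adjoint on modules is `G` on underlying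
objects, so it is right Quillen. Finally, `F` preserves all weak equivalences: replacing an object `X`
of `C` by a cofibrant one shows that for every fibrant `Y` a map `F X ⟶ Y` is a weak equivalence if
and only if its adjunct is (`weakEquivalence_homEquiv_iff`). It applies to the underlying objects of
modules, although these need not be cofibrant, and shows that the adjunction on modules is a Quillen
equivalence.
-/

/-! ### Weak equivalences are detected in the homotopy category -/

namespace HomotopicalAlgebra

section Saturation

variable {M : Type u} [Category.{v} M] [ModelCategory M]

/-- A map of bifibrant objects which becomes invertible in the homotopy category is a weak
equivalence. After a factorization, one may assume that the map is a fibration; the covering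
homotopy property then rectifies its homotopy inverse to a section `s`, and the map is a retract
of the endomorphism `p ≫ s`, which is homotopic to the identity. -/
lemma weakEquivalence_of_isIso_map_of_bifibrant {H : Type u₁} [Category.{v₁} H] (L : M ⥤ H)
    [L.IsLocalization (weakEquivalences M)] {A B : M} [IsCofibrant A] [IsFibrant A]
    [IsCofibrant B] [IsFibrant B] (f : A ⟶ B) [IsIso (L.map f)] : WeakEquivalence f := by
  let d := MorphismProperty.factorizationData (trivialCofibrations M) (fibrations M) f
  obtain ⟨_, _⟩ := (mem_trivialCofibrations_iff d.i).1 d.hi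
  have : Fibration d.p := (fibration_iff _).2 d.hp
  have : IsFibrant d.Z := isFibrant_of_fibration d.p
  have : IsCofibrant d.Z := isCofibrant_of_cofibration d.i
  have : IsIso (L.map d.i) :=
    Localization.inverts L (weakEquivalences M) d.i (mem_weakEquivalences _)
  have : IsIso (L.map d.p) := by
    have : IsIso (L.map d.i ≫ L.map d.p) := by
      rw [← L.map_comp, d.fac]; infer_instance
    exact IsIso.of_isIso_comp_left (L.map d.i) _
  obtain ⟨g, hg⟩ := map_surjective_of_isLocalization L B d.Z (inv (L.map d.p))
  obtain ⟨P, _, ⟨h⟩⟩ := ((LeftHomotopyRel.iff_map_eq L B B (f := g ≫ d.p) (g := 𝟙 B)).2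
    (by simp [hg])).exists_good_cylinder
  obtain ⟨s, h', hs⟩ := h.covering_homotopy d.p g
  have hsp : s ≫ d.p = 𝟙 B := by rw [← h'.h₁, Category.assoc, hs, h.h₁]
  have hL : L.map s = inv (L.map d.p) := by
    rw [← cancel_mono (L.map d.p), ← L.map_comp, hsp]; simp
  have h₁ : WeakEquivalence (d.p ≫ s) := by
    obtain ⟨P, ⟨h⟩⟩ := (LeftHomotopyRel.iff_map_eq L d.Z d.Z (f := d.p ≫ s) (g := 𝟙 _)).2
      (by simp [hL])
    exact h.weakEquivalence_iff.2 inferInstance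
  have h₂ : RetractArrow d.p (d.p ≫ s) :=
    { i := Arrow.homMk (𝟙 _) s
      r := Arrow.homMk (𝟙 _) d.p (by simp [hsp])
      retract := by ext <;> simp [hsp] }
  have : WeakEquivalence d.p :=
    (weakEquivalence_iff _).2 (MorphismProperty.of_retract h₂ (mem_weakEquivalences _))
  rw [← d.fac]
  infer_instance

/-- The weak equivalences of a model category are the maps inverted by the localization
functor. -/
lemma weakEquivalence_of_isIso_map {H : Type u₁} [Category.{v₁} H] (L : M ⥤ H)
    [L.IsLocalization (weakEquivalences M)] {A B : M} (f : A ⟶ B) [IsIso (L.map f)] :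
    WeakEquivalence f := by
  have hw {X Y : M} (w : X ⟶ Y) [WeakEquivalence w] : IsIso (L.map w) :=
    Localization.inverts L (weakEquivalences M) w (mem_weakEquivalences _)
  -- a cofibrant replacement of `f`
  obtain ⟨B', _, q, _, _⟩ := CofibrantObject.HoCat.exists_resolution B
  let d := MorphismProperty.factorizationData (cofibrations M) (trivialFibrations M)
    (initial.to A)
  obtain ⟨_, _⟩ := (mem_trivialFibrations_iff d.p).1 d.hp
  have : IsCofibrant d.Z := by
    have : Cofibration d.i := (cofibration_iff _).2 d.hi
    rwa [isCofibrant_iff, Subsingleton.elim (initial.to d.Z) d.i]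
  have sq : CommSq (initial.to B') (initial.to d.Z) q (d.p ≫ f) := ⟨by simp⟩
  -- a fibrant replacement of this replacement
  let e := MorphismProperty.factorizationData (trivialCofibrations M) (fibrations M)
    (terminal.from d.Z)
  let e' := MorphismProperty.factorizationData (trivialCofibrations M) (fibrations M)
    (terminal.from B')
  obtain ⟨_, _⟩ := (mem_trivialCofibrations_iff e.i).1 e.hi
  obtain ⟨_, _⟩ := (mem_trivialCofibrations_iff e'.i).1 e'.hi
  have : IsFibrant e.Z := by
    have : Fibration e.p := (fibration_iff _).2 e.hp
    rwa [isFibrant_iff, Subsingleton.elim (terminal.from e.Z) e.p]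
  have : IsFibrant e'.Z := by
    have : Fibration e'.p := (fibration_iff _).2 e'.hp
    rwa [isFibrant_iff, Subsingleton.elim (terminal.from e'.Z) e'.p]
  have : IsCofibrant e.Z := isCofibrant_of_cofibration e.i
  have : IsCofibrant e'.Z := isCofibrant_of_cofibration e'.i
  have sq' : CommSq (sq.lift ≫ e'.i) e.i (terminal.from e'.Z) (terminal.from _) := ⟨by simp⟩
  have h₁ : sq.lift ≫ q = d.p ≫ f := sq.fac_right
  have h₂ : e.i ≫ sq'.lift = sq.lift ≫ e'.i := sq'.fac_left
  have := hw q
  have := hw d.p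
  have := hw e.i
  have := hw e'.i
  have : IsIso (L.map sq.lift) := by
    have : IsIso (L.map sq.lift ≫ L.map q) := by
      rw [← L.map_comp, h₁, L.map_comp]; infer_instance
    exact IsIso.of_isIso_comp_right _ (L.map q)
  have : IsIso (L.map sq'.lift) := by
    have : IsIso (L.map e.i ≫ L.map sq'.lift) := by
      rw [← L.map_comp, h₂, L.map_comp]; infer_instance
    exact IsIso.of_isIso_comp_left (L.map e.i) _
  have := weakEquivalence_of_isIso_map_of_bifibrant L sq'.lift
  have : WeakEquivalence (sq.lift ≫ e'.i) := by rw [← h₂]; infer_instance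
  have := weakEquivalence_of_postcomp sq.lift e'.i
  have : WeakEquivalence (d.p ≫ f) := by rw [← h₁]; infer_instance
  exact weakEquivalence_of_precomp d.p f

end Saturation

end HomotopicalAlgebra

namespace HomotopicalAlgebra

section Detection

variable {M : Type u} [Category.{v} M] [ModelCategory M]

instance {X Y : M} (w : X ⟶ Y) [WeakEquivalence w] :
    IsIso ((weakEquivalences M).Q.map w) :=
  Localization.inverts _ (weakEquivalences M) w (mem_weakEquivalences _)

/-- A map is a weak equivalence if it induces bijections on the maps into all fibrant objects in
the homotopy category. -/
lemma weakEquivalence_of_bijective_precomp {A B : M} (f : A ⟶ B)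
    (hf : ∀ (Y : M) [IsFibrant Y], Function.Bijective
      fun g : (weakEquivalences M).Q.obj B ⟶ (weakEquivalences M).Q.obj Y ↦
        (weakEquivalences M).Q.map f ≫ g) : WeakEquivalence f := by
  have : IsIso ((weakEquivalences M).Q.map f) := by
    refine isIso_of_coyoneda_map_bijective _ (fun T ↦ ?_)
    let Y := (weakEquivalences M).Q.objPreimage T
    let d := MorphismProperty.factorizationData (trivialCofibrations M) (fibrations M)
      (terminal.from Y)
    obtain ⟨_, _⟩ := (mem_trivialCofibrations_iff d.i).1 d.hi
    have : IsFibrant d.Z := by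
      have : Fibration d.p := (fibration_iff _).2 d.hp
      rwa [isFibrant_iff, Subsingleton.elim (terminal.from d.Z) d.p]
    let e : T ≅ (weakEquivalences M).Q.obj d.Z :=
      ((weakEquivalences M).Q.objObjPreimageIso T).symm ≪≫
        asIso ((weakEquivalences M).Q.map d.i)
    obtain ⟨h₁, h₂⟩ := hf d.Z
    refine ⟨fun a b hab ↦ ?_, fun c ↦ ?_⟩
    · rw [← cancel_mono e.hom]
      exact h₁ (by simpa using (congrArg (· ≫ e.hom) hab))
    · obtain ⟨g, hg⟩ := h₂ (c ≫ e.hom)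
      exact ⟨g ≫ e.inv, by simp [reassoc_of% hg]⟩
  exact weakEquivalence_of_isIso_map (weakEquivalences M).Q f

/-- A map is a weak equivalence if it induces bijections on the maps out of all cofibrant objects
in the homotopy category. -/
lemma weakEquivalence_of_bijective_postcomp {A B : M} (f : A ⟶ B)
    (hf : ∀ (X : M) [IsCofibrant X], Function.Bijective
      fun g : (weakEquivalences M).Q.obj X ⟶ (weakEquivalences M).Q.obj A ↦
        g ≫ (weakEquivalences M).Q.map f) : WeakEquivalence f := by
  have : IsIso ((weakEquivalences M).Q.map f) := by
    refine isIso_of_yoneda_map_bijective _ (fun T ↦ ?_)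
    obtain ⟨X, _, p, _, _⟩ := CofibrantObject.HoCat.exists_resolution
      ((weakEquivalences M).Q.objPreimage T)
    let e : (weakEquivalences M).Q.obj X ≅ T :=
      asIso ((weakEquivalences M).Q.map p) ≪≫ (weakEquivalences M).Q.objObjPreimageIso T
    obtain ⟨h₁, h₂⟩ := hf X
    refine ⟨fun a b hab ↦ ?_, fun c ↦ ?_⟩
    · rw [← cancel_epi e.hom]
      exact h₁ (by simpa using (congrArg (e.hom ≫ ·) hab))
    · obtain ⟨g, hg⟩ := h₂ (e.hom ≫ c)
      exact ⟨e.inv ≫ g, by simpa using congrArg (e.inv ≫ ·) hg⟩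
  exact weakEquivalence_of_isIso_map (weakEquivalences M).Q f

/-- The two-out-of-six property: if `f ≫ g` and `g ≫ h` are weak equivalences, then so is `h`. -/
lemma weakEquivalence_of_twoOutOfSix {A B C D : M} (f : A ⟶ B) (g : B ⟶ C) (h : C ⟶ D)
    [WeakEquivalence (f ≫ g)] [WeakEquivalence (g ≫ h)] : WeakEquivalence h := by
  let Q := (weakEquivalences M).Q
  have h₁ : IsIso (Q.map f ≫ Q.map g) := by rw [← Q.map_comp]; infer_instance
  have h₂ : IsIso (Q.map g ≫ Q.map h) := by rw [← Q.map_comp]; infer_instance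
  have : IsSplitEpi (Q.map g) := ⟨⟨⟨inv (Q.map f ≫ Q.map g) ≫ Q.map f, by simp⟩⟩⟩
  have : Mono (Q.map g) := by
    have : Mono (Q.map g ≫ Q.map h) := inferInstance
    exact mono_of_mono _ (Q.map h)
  have : IsIso (Q.map g) := isIso_of_mono_of_isSplitEpi _
  have : IsIso (Q.map h) := IsIso.of_isIso_comp_left (Q.map g) _
  exact weakEquivalence_of_isIso_map Q h

end Detection

/-! ### Quillen adjunctions and their derived adjunctions -/

section QuillenAdjunction

variable {M : Type u₁} [Category.{v₁} M] [ModelCategory M]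
  {N : Type u₂} [Category.{v₂} N] [ModelCategory N]
  {L : M ⥤ N} {R : N ⥤ M} {adj : L ⊣ R}

/-- An adjunction whose right adjoint preserves fibrations and trivial fibrations is a Quillen
adjunction. -/
lemma IsQuillenAdjunction.of_rightAdjoint
    (h₁ : fibrations N ≤ (fibrations M).inverseImage R)
    (h₂ : trivialFibrations N ≤ (trivialFibrations M).inverseImage R) :
    IsQuillenAdjunction adj where
  cofibrations_le X Y f hf := by
    rw [MorphismProperty.inverseImage_iff, ← trivialFibrations_llp]
    intro A B p hp
    rw [adj.hasLiftingProperty_iff]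
    rw [← trivialFibrations_llp] at hf
    exact hf _ (h₂ _ hp)
  trivialCofibrations_le X Y f hf := by
    rw [MorphismProperty.inverseImage_iff, ← fibrations_llp]
    intro A B p hp
    rw [adj.hasLiftingProperty_iff]
    rw [← fibrations_llp] at hf
    exact hf _ (h₁ _ hp)

namespace IsQuillenAdjunction

variable (h : IsQuillenAdjunction adj)
include h

lemma cofibration_map {X Y : M} (f : X ⟶ Y) [Cofibration f] : Cofibration (L.map f) :=
  (cofibration_iff _).2 (h.cofibrations_le _ (mem_cofibrations f))

lemma weakEquivalence_map_of_cofibration {X Y : M} (f : X ⟶ Y) [Cofibration f]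
    [WeakEquivalence f] : WeakEquivalence (L.map f) :=
  ((mem_trivialCofibrations_iff _).1
    (h.trivialCofibrations_le _ (mem_trivialCofibrations f))).2

lemma fibration_map {X Y : N} (f : X ⟶ Y) [Fibration f] : Fibration (R.map f) := by
  rw [fibration_iff, ← trivialCofibrations_rlp]
  intro A B i hi
  rw [← adj.hasLiftingProperty_iff]
  have := h.trivialCofibrations_le _ hi
  rw [MorphismProperty.inverseImage_iff, ← fibrations_llp] at this
  exact this _ (mem_fibrations f)

lemma weakEquivalence_map_of_fibration {X Y : N} (f : X ⟶ Y) [Fibration f]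
    [WeakEquivalence f] : WeakEquivalence (R.map f) := by
  refine ((mem_trivialFibrations_iff _).1 ?_).2
  rw [← cofibrations_rlp]
  intro A B i hi
  rw [← adj.hasLiftingProperty_iff]
  have := h.cofibrations_le _ hi
  rw [MorphismProperty.inverseImage_iff, ← trivialFibrations_llp] at this
  exact this _ (mem_trivialFibrations f)

lemma isCofibrant_obj (X : M) [IsCofibrant X] : IsCofibrant (L.obj X) := by
  have := adj.leftAdjoint_preservesColimits
  have := h.cofibration_map (initial.to X)
  exact (isCofibrant_iff_of_isInitial (L.map (initial.to X))
    (IsInitial.isInitialObj L _ initialIsInitial)).2 this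

lemma isFibrant_obj (Y : N) [IsFibrant Y] : IsFibrant (R.obj Y) := by
  have := adj.rightAdjoint_preservesLimits
  have := h.fibration_map (terminal.from Y)
  exact (isFibrant_iff_of_isTerminal (R.map (terminal.from Y))
    (IsTerminal.isTerminalObj R _ terminalIsTerminal)).2 this

/-- Ken Brown's lemma: a left Quillen functor preserves the weak equivalences between cofibrant
objects. -/
lemma weakEquivalence_map {X Y : M} [IsCofibrant X] [IsCofibrant Y] (f : X ⟶ Y)
    [WeakEquivalence f] : WeakEquivalence (L.map f) := by
  let b : CofibrantBrownFactorization f := Classical.arbitrary _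
  have := (cofibration_iff b.i).2 b.hi
  have := h.weakEquivalence_map_of_cofibration b.i
  have := h.weakEquivalence_map_of_cofibration b.s
  have : WeakEquivalence (L.map b.s ≫ L.map b.p) := by
    rw [← L.map_comp, b.s_p]; infer_instance
  have := weakEquivalence_of_precomp (L.map b.s) (L.map b.p)
  rw [← b.fac, L.map_comp]
  infer_instance

/-- The adjunction bijection of a Quillen adjunction is compatible with homotopy: good path objects
are preserved by `R`, and good cylinders by `L`. -/
lemma Q_map_homEquiv_iff {X : M} {Y : N} [IsCofibrant X] [IsFibrant Y] (f g : L.obj X ⟶ Y) :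
    (weakEquivalences N).Q.map f = (weakEquivalences N).Q.map g ↔
      (weakEquivalences M).Q.map (adj.homEquiv _ _ f) =
        (weakEquivalences M).Q.map (adj.homEquiv _ _ g) := by
  have := h.isCofibrant_obj X
  have := h.isFibrant_obj Y
  constructor
  · rw [← RightHomotopyRel.iff_map_eq, ← RightHomotopyRel.iff_map_eq]
    intro H
    obtain ⟨P, _, ⟨H⟩⟩ := H.exists_good_pathObject
    have := h.weakEquivalence_map_of_fibration P.p₀
    have : WeakEquivalence (R.map P.ι ≫ R.map P.p₀) := by
      rw [← R.map_comp, P.ι_p₀]; infer_instance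
    have : WeakEquivalence (R.map P.ι) := weakEquivalence_of_postcomp _ (R.map P.p₀)
    exact ⟨{ toPrepathObject := P.toPrepathObject.map R
             weakEquivalence_ι := this },
      ⟨{ h := adj.homEquiv _ _ H.h
         h₀ := by
          refine (adj.homEquiv_naturality_right _ _).symm.trans ?_
          rw [H.h₀]
         h₁ := by
          refine (adj.homEquiv_naturality_right _ _).symm.trans ?_
          rw [H.h₁] }⟩⟩
  · rw [← LeftHomotopyRel.iff_map_eq, ← LeftHomotopyRel.iff_map_eq]
    intro H
    obtain ⟨P, _, ⟨H⟩⟩ := H.exists_good_cylinder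
    have := h.weakEquivalence_map_of_cofibration P.i₀
    have : WeakEquivalence (L.map P.i₀ ≫ L.map P.π) := by
      rw [← L.map_comp, P.i₀_π]; infer_instance
    have : WeakEquivalence (L.map P.π) := weakEquivalence_of_precomp (L.map P.i₀) _
    exact ⟨{ toPrecylinder := P.toPrecylinder.map L
             weakEquivalence_π := this },
      ⟨{ h := (adj.homEquiv _ _).symm H.h
         h₀ := by
          refine (adj.homEquiv_naturality_left_symm _ _).symm.trans ?_
          rw [H.h₀, Equiv.symm_apply_apply]
         h₁ := by
          refine (adj.homEquiv_naturality_left_symm _ _).symm.trans ?_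
          rw [H.h₁, Equiv.symm_apply_apply] }⟩⟩

/-- The derived adjunction: for `X` cofibrant and `Y` fibrant, the adjunction induces a bijection
between maps `L X ⟶ Y` and maps `X ⟶ R Y` in the homotopy categories. -/
lemma exists_equiv (X : M) (Y : N) [IsCofibrant X] [IsFibrant Y] :
    ∃ e : ((weakEquivalences N).Q.obj (L.obj X) ⟶ (weakEquivalences N).Q.obj Y) ≃
        ((weakEquivalences M).Q.obj X ⟶ (weakEquivalences M).Q.obj (R.obj Y)),
      ∀ f : L.obj X ⟶ Y, e ((weakEquivalences N).Q.map f) =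
        (weakEquivalences M).Q.map (adj.homEquiv _ _ f) := by
  have := h.isCofibrant_obj X
  have := h.isFibrant_obj Y
  have s₁ := map_surjective_of_isLocalization (weakEquivalences N).Q (L.obj X) Y
  have s₂ := map_surjective_of_isLocalization (weakEquivalences M).Q X (R.obj Y)
  choose r hr using s₁
  have key (f : L.obj X ⟶ Y) : (weakEquivalences M).Q.map
      (adj.homEquiv _ _ (r ((weakEquivalences N).Q.map f))) =
        (weakEquivalences M).Q.map (adj.homEquiv _ _ f) :=
    (h.Q_map_homEquiv_iff _ _).1 (hr _)
  refine ⟨Equiv.ofBijective (fun a ↦ (weakEquivalences M).Q.map (adj.homEquiv _ _ (r a)))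
    ⟨fun a b hab ↦ ?_, fun c ↦ ?_⟩, key⟩
  · rw [← hr a, ← hr b]
    exact (h.Q_map_homEquiv_iff _ _).2 hab
  · obtain ⟨c, rfl⟩ := s₂ c
    obtain ⟨f, rfl⟩ := (adj.homEquiv _ _).surjective c
    exact ⟨_, key f⟩

end IsQuillenAdjunction

/-- Let `T ⊣ R` be a Quillen adjunction on `M` with conjugate natural transformations
`τ : T ⟶ 𝟭 M` and `σ : 𝟭 M ⟶ R`. In the homotopy category, composition with `τ` at a cofibrant
object and with `σ` at a fibrant object agree up to a bijection. -/
lemma IsQuillenAdjunction.bijective_precomp_iff {T R : M ⥤ M} {adj : T ⊣ R}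
    (h : IsQuillenAdjunction adj) {X Y : M} [IsCofibrant X] [IsFibrant Y]
    (τ : T.obj X ⟶ X) (σ : Y ⟶ R.obj Y)
    (hτσ : ∀ f : X ⟶ Y, adj.homEquiv _ _ (τ ≫ f) = f ≫ σ) :
    (Function.Bijective fun g : (weakEquivalences M).Q.obj X ⟶ (weakEquivalences M).Q.obj Y ↦
      (weakEquivalences M).Q.map τ ≫ g) ↔
    (Function.Bijective fun g : (weakEquivalences M).Q.obj X ⟶ (weakEquivalences M).Q.obj Y ↦
      g ≫ (weakEquivalences M).Q.map σ) := by
  obtain ⟨e, he⟩ := h.exists_equiv X Y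
  rw [← e.bijective.of_comp_iff']
  have : (e ∘ fun g : (weakEquivalences M).Q.obj X ⟶ (weakEquivalences M).Q.obj Y ↦
      (weakEquivalences M).Q.map τ ≫ g) = fun g ↦ g ≫ (weakEquivalences M).Q.map σ := by
    funext g
    obtain ⟨g, rfl⟩ := map_surjective_of_isLocalization (weakEquivalences M).Q X Y g
    rw [Function.comp_apply, ← Functor.map_comp, he, hτσ, Functor.map_comp]
  rw [this]

end QuillenAdjunction
end HomotopicalAlgebra

/-! ### Free modules, limits and colimits of modules -/

namespace CategoryTheory.Mod

section Free

variable {C : Type u} [Category.{v} C] [MonoidalCategory C] (R : C) [MonObj R]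

lemma mul_assoc_freeAct (A : C) :
    MonObj.mul ▷ (R ⊗ A) ≫ (α_ R R A).inv ≫ MonObj.mul ▷ A =
      (α_ R R (R ⊗ A)).hom ≫ R ◁ ((α_ R R A).inv ≫ MonObj.mul ▷ A) ≫
        (α_ R R A).inv ≫ MonObj.mul ▷ A := by
  rw [associator_inv_naturality_left_assoc, ← comp_whiskerRight, MonObj.mul_assoc,
    whiskerLeft_comp_assoc, associator_inv_naturality_middle_assoc]
  simp

/-- The free `R`-module functor `A ↦ R ⊗ A`. The underlying object of a free module unfolds to
`R ⊗ A` only by definition, so equations that involve both forms are first proved in `C`. -/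
def free : C ⥤ Mod C R where
  obj A := ofAct (R ⊗ A) ((α_ R R A).inv ≫ MonObj.mul ▷ A)
    (by rw [associator_inv_naturality_left_assoc, ← comp_whiskerRight, MonObj.one_mul]; simp)
    (mul_assoc_freeAct R A)
  map {A B} f := ofHom (R ◁ f) (by
    have h : ((α_ R R A).inv ≫ MonObj.mul ▷ A) ≫ R ◁ f =
        R ◁ R ◁ f ≫ (α_ R R B).inv ≫ MonObj.mul ▷ B := by
      rw [associator_inv_naturality_right_assoc, whisker_exchange, Category.assoc]
    exact h)
  map_id A := by ext; exact whiskerLeft_id _ _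
  map_comp f g := by ext; exact whiskerLeft_comp _ _ _

/-- The inclusion of the generators of a free module. -/
def freeι (A : C) : A ⟶ ((free R).obj A).X := (λ_ A).inv ≫ MonObj.one ▷ A

variable {R}

lemma whiskerLeft_freeι_act (A : C) :
    R ◁ freeι R A ≫ ((free R).obj A).act = 𝟙 (R ⊗ A) := by
  have h : R ◁ ((λ_ A).inv ≫ MonObj.one ▷ A) ≫ (α_ R R A).inv ≫ MonObj.mul ▷ A = 𝟙 (R ⊗ A) := by
    rw [whiskerLeft_comp_assoc, associator_inv_naturality_middle_assoc,
      ← comp_whiskerRight, MonObj.mul_one]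
    simp
  exact h

/-- The linear extension of a map to a module. -/
def freeDesc {A : C} {M : Mod C R} (g : A ⟶ M.X) : (free R).obj A ⟶ M :=
  ofHom (R ◁ g ≫ M.act) (by
    have h : ((α_ R R A).inv ≫ MonObj.mul ▷ A) ≫ R ◁ g ≫ M.act =
        R ◁ (R ◁ g ≫ M.act) ≫ M.act := by
      rw [Category.assoc, ← whisker_exchange_assoc, mul_act, associator_naturality_right_assoc]
      simp
    exact h)

lemma freeDesc_hom {A : C} {M : Mod C R} (g : A ⟶ M.X) :
    (freeDesc g).hom = R ◁ g ≫ M.act := rfl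

@[simp]
lemma freeι_freeDesc {A : C} {M : Mod C R} (g : A ⟶ M.X) :
    freeι R A ≫ (freeDesc g).hom = g := by
  have h : ((λ_ A).inv ≫ MonObj.one ▷ A) ≫ R ◁ g ≫ M.act = g := by
    rw [Category.assoc, ← whisker_exchange_assoc, one_act, leftUnitor_naturality]
    simp
  exact h

lemma free_hom_ext {A : C} {M : Mod C R} {f g : (free R).obj A ⟶ M}
    (h : freeι R A ≫ f.hom = freeι R A ≫ g.hom) : f = g := by
  have key (f : (free R).obj A ⟶ M) : R ◁ (freeι R A ≫ f.hom) ≫ M.act = f.hom := by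
    rw [whiskerLeft_comp_assoc, ← act_hom f, ← Category.assoc]
    exact (congrArg (· ≫ f.hom) (whiskerLeft_freeι_act A)).trans (Category.id_comp _)
  ext
  rw [← key f, ← key g, h]

lemma freeι_naturality {A B : C} (f : A ⟶ B) :
    freeι R A ≫ ((free R).map f).hom = f ≫ freeι R B := by
  have h : ((λ_ A).inv ≫ MonObj.one ▷ A) ≫ R ◁ f = f ≫ (λ_ B).inv ≫ MonObj.one ▷ B := by
    rw [Category.assoc, ← whisker_exchange, ← leftUnitor_inv_naturality_assoc]
  exact h

lemma freeι_naturality_assoc {A B : C} (f : A ⟶ B) {Z : C} (k : ((free R).obj B).X ⟶ Z) :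
    freeι R A ≫ ((free R).map f).hom ≫ k = f ≫ freeι R B ≫ k := by
  rw [reassoc_of% freeι_naturality (R := R) f]

lemma freeDesc_comp {A B : C} {M : Mod C R} (f : A ⟶ B) (g : B ⟶ M.X) :
    freeDesc (f ≫ g) = (free R).map f ≫ freeDesc g :=
  free_hom_ext (by
    rw [comp_hom', freeι_naturality_assoc, freeι_freeDesc, freeι_freeDesc])

variable (R)

/-- The adjunction between free modules and underlying objects. -/
noncomputable def freeAdj : free R ⊣ forget R :=
  Adjunction.mkOfHomEquiv
    { homEquiv A _ :=
        { toFun f := freeι R A ≫ f.hom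
          invFun g := freeDesc g
          left_inv _ := free_hom_ext (freeι_freeDesc _)
          right_inv _ := freeι_freeDesc _ }
      homEquiv_naturality_left_symm f g := freeDesc_comp f g
      homEquiv_naturality_right _ _ := (Category.assoc _ _ _).symm }

lemma freeAdj_counit_app (M : Mod C R) : ((freeAdj R).counit.app M).hom = M.act := by
  have h : (freeAdj R).counit.app M = freeDesc (𝟙 M.X) := rfl
  rw [h, freeDesc_hom, whiskerLeft_id]
  exact Category.id_comp _

lemma freeAdj_unit_app (A : C) : (freeAdj R).unit.app A = freeι R A := Category.comp_id _

instance : (forget (D := C) R).IsRightAdjoint := (freeAdj R).isRightAdjoint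
instance : (free R).IsLeftAdjoint := (freeAdj R).isLeftAdjoint

instance : (forget (D := C) R).Faithful where
  map_injective h := by ext; exact h

instance : (forget (D := C) R).ReflectsIsomorphisms where
  reflects {M N} f hf := by
    have : IsIso f.hom := hf
    exact ((ofIso (asIso f.hom) (act_hom f)).isIso_hom :)

lemma comparison_free_map_act {M N : Mod C R} {f : M.X ⟶ N.X}
    (h : (freeAdj R).toMonad.map f ≫ ((Monad.comparison (freeAdj R)).obj N).a =
      ((Monad.comparison (freeAdj R)).obj M).a ≫ f) : M.act ≫ f = R ◁ f ≫ N.act := by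
  have h' : R ◁ f ≫ ((freeAdj R).counit.app N).hom = ((freeAdj R).counit.app M).hom ≫ f := h
  rw [freeAdj_counit_app, freeAdj_counit_app] at h'
  exact h'.symm

lemma one_act_of_freeι {X : C} {a : R ⊗ X ⟶ X} (h : freeι R X ≫ a = 𝟙 X) :
    MonObj.one ▷ X ≫ a = (λ_ X).hom := by
  have h' : ((λ_ X).inv ≫ MonObj.one ▷ X) ≫ a = 𝟙 X := h
  rwa [Category.assoc, Iso.inv_comp_eq, Category.comp_id] at h'

lemma mul_act_of_free {X : C} {a : R ⊗ X ⟶ X} (h : ((free R).obj X).act ≫ a = R ◁ a ≫ a) :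
    MonObj.mul ▷ X ≫ a = (α_ R R X).hom ≫ R ◁ a ≫ a := by
  have h' : ((α_ R R X).inv ≫ MonObj.mul ▷ X) ≫ a = R ◁ a ≫ a := h
  rwa [Category.assoc, Iso.inv_comp_eq] at h'

/-- The module with the action of an algebra over the monad `R ⊗ -`. -/
def ofAlgebra (X : (freeAdj R).toMonad.Algebra) : Mod C R :=
  ofAct X.A X.a
    (one_act_of_freeι R ((congrArg (· ≫ X.a) (freeAdj_unit_app R X.A)).symm.trans X.unit))
    (mul_act_of_free R ((congrArg (· ≫ X.a)
      (freeAdj_counit_app R ((free R).obj X.A))).symm.trans X.assoc))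

instance : (Monad.comparison (freeAdj (C := C) R)).Full where
  map_surjective {M N} g := ⟨ofHom g.f (comparison_free_map_act R g.h), by ext; rfl⟩

instance : (Monad.comparison (freeAdj (C := C) R)).EssSurj where
  mem_essImage X := ⟨ofAlgebra R X, ⟨Monad.Algebra.isoMk (Iso.refl X.A) (by
    have h (M : Mod C R) : R ◁ 𝟙 M.X ≫ M.act = ((freeAdj R).counit.app M).hom ≫ 𝟙 M.X := by
      rw [freeAdj_counit_app, whiskerLeft_id, Category.id_comp]
      exact (Category.comp_id _).symm
    exact h (ofAlgebra R X))⟩⟩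

/-- Modules over `R` are the algebras over the monad `R ⊗ -`. -/
noncomputable instance : MonadicRightAdjoint (forget (D := C) R) where
  L := free R
  adj := freeAdj R
  eqv := { }

noncomputable instance : CreatesLimits (forget (D := C) R) := monadicCreatesLimits _

end Free

section Limits

variable {C : Type u} [Category.{v} C] [MonoidalCategory C] (R : C) [MonObj R]

instance [HasLimitsOfSize.{v, v} C] : HasLimitsOfSize.{v, v} (Mod C R) :=
  hasLimits_of_hasLimits_createsLimits (forget R)

variable [HasColimitsOfSize.{v, v} C] [PreservesColimitsOfSize.{v, v} (tensorLeft R)]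

instance preservesColimits_free_forget :
    PreservesColimitsOfSize.{v, v} (free R ⋙ forget R) :=
  inferInstanceAs (PreservesColimitsOfSize.{v, v} (tensorLeft R))

noncomputable instance : CreatesColimits (forget (D := C) R) where
  CreatesColimitsOfShape :=
    { CreatesColimit {K} :=
        have : PreservesColimitsOfSize.{v, v} (monadicLeftAdjoint (forget R) ⋙ forget R) :=
          preservesColimits_free_forget (C := C) R
        monadicCreatesColimitOfPreservesColimit _ K }

instance : HasColimitsOfSize.{v, v} (Mod C R) :=
  hasColimits_of_hasColimits_createsColimits (forget R)

instance : PreservesColimitsOfSize.{v, v} (forget (D := C) R) := inferInstance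

end Limits

end CategoryTheory.Mod

/-! ### The model structure on modules over a monoid -/

namespace HomotopicalAlgebra

section Generators

open MorphismProperty

/-- A model structure is obtained from sets of maps `I` and `J` which permit the small object
argument, if they detect trivial fibrations and fibrations, the cofibrations are the maps with the
left lifting property against the trivial fibrations, and `J`-cofibrations are weak
equivalences. -/
lemma exists_modelCategory_of_hasSmallObjectArgument {E : Type u} [Category.{v} E]
    [CategoryWithWeakEquivalences E] [CategoryWithCofibrations E] [CategoryWithFibrations E]
    [HasFiniteLimits E] [HasFiniteColimits E] [(weakEquivalences E).HasTwoOutOfThreeProperty]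
    (I J : MorphismProperty E) [HasSmallObjectArgument.{v} I] [HasSmallObjectArgument.{v} J]
    (hI : trivialFibrations E = I.rlp) (hJ : fibrations E = J.rlp)
    (hcof : cofibrations E = (trivialFibrations E).llp)
    (hJ' : J.rlp.llp ≤ weakEquivalences E) :
    ∃ m : ModelCategory E,
      m.categoryWithWeakEquivalences = ‹CategoryWithWeakEquivalences E› ∧
      m.categoryWithCofibrations = ‹CategoryWithCofibrations E› ∧
      m.categoryWithFibrations = ‹CategoryWithFibrations E› := by
  have hcof' : cofibrations E = I.rlp.llp := by rw [hcof, hI]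
  have h₁ : J.rlp.llp ≤ cofibrations E := by
    rw [hcof, ← hJ]
    exact antitone_llp inf_le_left
  have hfac : HasFactorization J.rlp.llp (fibrations E) := by
    rw [hJ]
    infer_instance
  have htcof : trivialCofibrations E = J.rlp.llp := by
    refine le_antisymm (fun A B f hf ↦ ?_) (le_inf h₁ hJ')
    have d := factorizationData J.rlp.llp (fibrations E) f
    have hp : weakEquivalences E d.p :=
      (weakEquivalences E).of_precomp d.i d.p (hJ' _ d.hi) (by rw [d.fac]; exact hf.2)
    have : HasLiftingProperty f d.p := (hcof ▸ hf.1 : (trivialFibrations E).llp f) d.p ⟨d.hp, hp⟩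
    exact of_retract (RetractArrow.ofLeftLiftingProperty d.fac) d.hi
  have : IsWeakFactorizationSystem (cofibrations E) (trivialFibrations E) :=
    { rlp := by rw [hcof', hI, rlp_llp_rlp]
      llp := hcof.symm
      hasFactorization := by
        rw [hcof', hI]
        infer_instance }
  have : IsWeakFactorizationSystem (trivialCofibrations E) (fibrations E) :=
    { rlp := by rw [htcof, hJ, rlp_llp_rlp]
      llp := by rw [htcof, hJ]
      hasFactorization := by
        rw [htcof]
        infer_instance }
  exact ⟨ModelCategory.mk' E, rfl, rfl, rfl⟩

/-- The model category structure whose classes of maps are the given ones. -/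
abbrev modelCategoryOfExists {E : Type u} [Category.{v} E]
    [CategoryWithWeakEquivalences E] [CategoryWithCofibrations E] [CategoryWithFibrations E]
    [HasFiniteLimits E] [HasFiniteColimits E]
    (h : ∃ m : ModelCategory E,
      m.categoryWithWeakEquivalences = ‹CategoryWithWeakEquivalences E› ∧
      m.categoryWithCofibrations = ‹CategoryWithCofibrations E› ∧
      m.categoryWithFibrations = ‹CategoryWithFibrations E›) : ModelCategory E where
  cm2 := by obtain ⟨_, rfl, rfl, rfl⟩ := h; infer_instance
  cm3a := by obtain ⟨_, rfl, rfl, rfl⟩ := h; infer_instance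
  cm3b := by obtain ⟨_, rfl, rfl, rfl⟩ := h; infer_instance
  cm3c := by obtain ⟨_, rfl, rfl, rfl⟩ := h; infer_instance
  cm4a := by obtain ⟨_, rfl, rfl, rfl⟩ := h; intros; infer_instance
  cm4b := by obtain ⟨_, rfl, rfl, rfl⟩ := h; intros; infer_instance
  cm5a := by obtain ⟨_, rfl, rfl, rfl⟩ := h; infer_instance
  cm5b := by obtain ⟨_, rfl, rfl, rfl⟩ := h; infer_instance

/-- The underlying model category of a symmetric monoidal model category. -/
abbrev IsSymmetricMonoidalModelCategory.modelCategory (C : Type u) [Category.{v} C]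
    [MonoidalCategory C] [SymmetricCategory C] [CategoryWithWeakEquivalences C]
    [CategoryWithCofibrations C] [CategoryWithFibrations C]
    [h : IsSymmetricMonoidalModelCategory C] : ModelCategory C :=
  modelCategoryOfExists h.exists_modelCategory

/-- A functor which preserves colimits sends pushouts of coproducts of maps in `W` to such maps for
`W'`, if it sends `W` into `W'` up to isomorphism. -/
lemma pushouts_coproducts_le_inverseImage {E : Type u₁} [Category.{v} E] {C : Type u}
    [Category.{v} C] (G : E ⥤ C) [PreservesColimitsOfSize.{v, v} G]
    {W : MorphismProperty E} {W' : MorphismProperty C} (h : W ≤ W'.isoClosure.inverseImage G) :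
    (coproducts.{v} W).pushouts ≤ ((coproducts.{v} W').pushouts).inverseImage G := by
  rintro X Y f ⟨A, B, i, g₁, g₂, hi, sq⟩
  refine pushouts_mk _ (sq.map G) ?_
  obtain ⟨T, ⟨X₁, X₂, c₁, c₂, h₁, h₂, φ, hφ⟩⟩ := (coproducts_iff _ _).1 hi
  refine (coproducts_iff _ _).2 ⟨T, ?_⟩
  have key (j : Discrete T) : ∃ (A B : C) (w : A ⟶ B) (_ : W' w),
      Nonempty (CategoryTheory.Arrow.mk w ≅ CategoryTheory.Arrow.mk (G.map (φ.app j))) := by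
    obtain ⟨A, B, w, hw, e⟩ := h _ (hφ j)
    exact ⟨A, B, w, hw, e⟩
  choose A B w hw e using key
  let e₁ (j : Discrete T) : A j ≅ G.obj (X₁.obj j) := CategoryTheory.Arrow.leftFunc.mapIso (e j).some
  let e₂ (j : Discrete T) : B j ≅ G.obj (X₂.obj j) := CategoryTheory.Arrow.rightFunc.mapIso (e j).some
  have he (j : Discrete T) : w j ≫ (e₂ j).hom = (e₁ j).hom ≫ G.map (φ.app j) :=
    (Arrow.w (e j).some.hom).symm
  refine colimitsOfShape.mk' (Discrete.functor fun t ↦ A ⟨t⟩) (Discrete.functor fun t ↦ B ⟨t⟩) _ _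
    ((IsColimit.precomposeHomEquiv (Discrete.natIso fun j ↦ e₁ j) _).symm
      (isColimitOfPreserves G h₁))
    ((IsColimit.precomposeHomEquiv (Discrete.natIso fun j ↦ e₂ j) _).symm
      (isColimitOfPreserves G h₂))
    (Discrete.natTrans fun j ↦ w j) (fun j ↦ hw j) _ (fun j ↦ ?_)
  have h₃ : c₁.ι.app j ≫ h₁.desc (Cocone.mk _ (φ ≫ c₂.ι)) = φ.app j ≫ c₂.ι.app j := h₁.fac _ _
  have h₄ : ((e₁ j).hom ≫ G.map (c₁.ι.app j)) ≫ G.map (h₁.desc (Cocone.mk _ (φ ≫ c₂.ι))) =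
      w j ≫ (e₂ j).hom ≫ G.map (c₂.ι.app j) := by
    rw [reassoc_of% he j, Category.assoc, ← G.map_comp, ← G.map_comp, h₃]
  exact h₄

end Generators

end HomotopicalAlgebra

namespace CategoryTheory.Mod

open MorphismProperty

section

variable {C : Type u} [Category.{v} C] [MonoidalCategory C] (R : C) [MonObj R]

/-- Maps of modules out of a free module are maps in the underlying category. -/
noncomputable def coyonedaFreeIso (A : C) :
    coyoneda.obj (Opposite.op ((free R).obj A)) ≅
      forget R ⋙ coyoneda.obj (Opposite.op A) :=
  NatIso.ofComponents (fun M ↦ ((freeAdj R).homEquiv A M).toIso) (fun f ↦ by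
    ext g
    exact (freeAdj R).homEquiv_naturality_right g f)

lemma strictMap_free_rlp {P Q : MorphismProperty C} (h : P.rlp = Q) :
    (P.strictMap (free R)).rlp = Q.inverseImage (forget R) := by
  subst h
  ext X Y p
  constructor
  · intro h _ _ i hi
    exact ((freeAdj R).hasLiftingProperty_iff _ _).1 (h _ ⟨hi⟩)
  · rintro h _ _ _ ⟨hi⟩
    exact ((freeAdj R).hasLiftingProperty_iff _ _).2 (h _ hi)

lemma inverseImage_forget_rlp {ι : Type v} {A B : ι → C} (i : ∀ k, A k ⟶ B k) :
    (ofHoms fun k ↦ (free R).map (i k)).rlp = (ofHoms i).rlp.inverseImage (forget R) := by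
  ext X Y p
  constructor
  · rintro h _ _ _ ⟨k⟩
    exact ((freeAdj R).hasLiftingProperty_iff _ _).1 (h _ ⟨k⟩)
  · rintro h _ _ _ ⟨k⟩
    exact ((freeAdj R).hasLiftingProperty_iff _ _).2 (h _ ⟨k⟩)

variable [SymmetricCategory C]

lemma isoClosure_tensorMaps_whiskerLeft (R : C) {W : MorphismProperty C} {A B : C} {i : A ⟶ B}
    (hi : W i) : (tensorMaps W).isoClosure (R ◁ i) :=
  ⟨_, _, _, .mk i hi R, ⟨Arrow.isoMk (β_ A R) (β_ B R) (by simp)⟩⟩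

variable [HasColimitsOfSize.{v, v} C] [PreservesColimitsOfSize.{v, v} (tensorLeft R)]

instance (J : Type v) [LinearOrder J] :
    PreservesWellOrderContinuousOfShape J (forget (D := C) R) where

/-- The underlying map of a pushout of coproducts of free maps on the `i k` is a pushout of coproducts
of maps `i k ⊗ X`. Therefore smallness of `T` relative to such maps in `C` gives smallness of the free
module on `T` relative to cell complexes of modules. -/
lemma preservesColimit_coyoneda_free {ι : Type v} {A B : ι → C} (i : ∀ k, A k ⟶ B k)
    {T : C} (κ : Cardinal.{v}) [Fact κ.IsRegular]
    (h : ∀ (J : Type v) [LinearOrder J] [SuccOrder J]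
      [OrderBot J] [WellFoundedLT J] [IsCardinalFiltered J κ] {X Y : C} (f : X ⟶ Y)
      (h : (coproducts.{v} (tensorMaps (ofHoms i))).pushouts.TransfiniteCompositionOfShape J f),
      PreservesColimit h.F (coyoneda.obj (Opposite.op T)))
    (J : Type v) [LinearOrder J] [SuccOrder J] [OrderBot J] [WellFoundedLT J]
    [IsCardinalFiltered J κ] {X Y : Mod C R} (f : X ⟶ Y)
    (hf : (coproducts.{v} (ofHoms fun k ↦
      (free R).map (i k))).pushouts.TransfiniteCompositionOfShape J f) :
    PreservesColimit hf.F (coyoneda.obj (Opposite.op ((free R).obj T))) := by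
  have hle : (coproducts.{v} (ofHoms fun k ↦ (free R).map (i k))).pushouts ≤
      ((coproducts.{v} (tensorMaps (ofHoms i))).pushouts).inverseImage (forget R) := by
    refine pushouts_coproducts_le_inverseImage _ ?_
    rintro _ _ _ ⟨k⟩
    exact isoClosure_tensorMaps_whiskerLeft R ⟨k⟩
  have : PreservesColimit (hf.F ⋙ forget R) (coyoneda.obj (Opposite.op T)) :=
    h J _ (hf.ofLE hle).map
  exact preservesColimit_of_natIso _ (coyonedaFreeIso R T).symm

/-- The smallness conditions in the base category permit the small object argument for the free
maps. -/
lemma hasSmallObjectArgument_free {ι : Type v} {A B : ι → C} (i : ∀ k, A k ⟶ B k)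
    (hi : ∀ k, IsSmallRelativeTo (A k) (tensorMaps (ofHoms i))) :
    HasSmallObjectArgument.{v} (ofHoms fun k ↦ (free R).map (i k)) := by
  choose κ hκ h using hi
  -- a regular cardinal which bounds the cardinals of smallness of all the domains
  let κ' : Cardinal.{v} := Order.succ (max Cardinal.aleph0 (Cardinal.sum κ))
  have hκ' : Fact κ'.IsRegular := ⟨Cardinal.isRegular_succ (le_max_left _ _)⟩
  have hle (k : ι) : κ k ≤ κ' :=
    ((Cardinal.le_sum κ k).trans (le_max_right _ _)).trans (Order.le_succ _)
  have hne : Nonempty κ'.ord.ToType := IsCardinalFiltered.nonempty κ'.ord.ToType κ'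
  let hbot : OrderBot κ'.ord.ToType := WellFoundedLT.toOrderBot _
  refine ⟨κ', hκ', hbot, { preservesColimit := ?_ }⟩
  rintro _ _ X Y _ ⟨k⟩ f hf
  have := IsCardinalFiltered.of_le κ'.ord.ToType (hle k)
  exact preservesColimit_coyoneda_free R i (κ k) (h k) _ f
    (hf.transfiniteCompositionOfShape.ofLE (by rw [ofHoms_homFamily]))

/-- A pushout of coproducts of free maps on maps in `P` has as underlying map a pushout of a single
`s ⊗ R` with `s` in `P`, where `s` is the coproduct of the maps involved: this is the shape of the
maps in the monoid axiom, which has no coproducts. -/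
lemma whiskerLeft_coproducts_pushouts {ι : Type v} {A B : ι → C} (i : ∀ k, A k ⟶ B k)
    {P : MorphismProperty C} (hi : ∀ k, P (i k)) [IsStableUnderCoproducts.{v} P] {X Y : Mod C R}
    (f : X ⟶ Y) (hf : (coproducts.{v} (ofHoms fun k ↦ (free R).map (i k))).pushouts f) :
    (tensorMaps P).pushouts f.hom := by
  obtain ⟨c⟩ := (nonempty_attachCells_iff _ _).2 hf
  let s : ∐ (fun k ↦ A (c.π k)) ⟶ ∐ (fun k ↦ B (c.π k)) := Limits.Sigma.map fun k ↦ i (c.π k)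
  have hs : P s := MorphismProperty.colimMap _ (fun k ↦ hi (c.π k.as))
  let e₁ := c.isColimit₁.coconePointUniqueUpToIso
    (isColimitCofanMkObjOfIsColimit (free R) _ _ (coproductIsCoproduct fun k ↦ A (c.π k)))
  let e₂ := c.isColimit₂.coconePointUniqueUpToIso
    (isColimitCofanMkObjOfIsColimit (free R) _ _ (coproductIsCoproduct fun k ↦ B (c.π k)))
  have he : e₁.hom ≫ (free R).map s = c.m ≫ e₂.hom := by
    refine c.isColimit₁.hom_ext fun ⟨k⟩ ↦ ?_
    have h₁ : c.cofan₁.inj k ≫ e₁.hom = (free R).map (Sigma.ι (fun k ↦ A (c.π k)) k) :=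
      c.isColimit₁.comp_coconePointUniqueUpToIso_hom _ _
    have h₂ : c.cofan₂.inj k ≫ e₂.hom = (free R).map (Sigma.ι (fun k ↦ B (c.π k)) k) :=
      c.isColimit₂.comp_coconePointUniqueUpToIso_hom _ _
    have h₃ : c.cofan₁.inj k ≫ e₁.hom ≫ (free R).map s = c.cofan₁.inj k ≫ c.m ≫ e₂.hom := by
      rw [c.hm_assoc, h₂, reassoc_of% h₁, ← Functor.map_comp, ← Functor.map_comp, Sigma.ι_map]
    exact h₃
  have hs' : (tensorMaps P).pushouts (R ◁ s) :=
    (MorphismProperty.arrow_mk_iso_iff _ (Arrow.isoMk (β_ R _) (β_ R _) (by simp))).2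
      (le_pushouts _ _ (tensorMaps.mk s hs R))
  have hm : (tensorMaps P).pushouts c.m.hom :=
    (MorphismProperty.arrow_mk_iso_iff _ ((forget R).mapArrow.mapIso
      (Arrow.isoMk e₁ e₂ he : Arrow.mk c.m ≅ Arrow.mk ((free R).map s)))).2 hs'
  exact MorphismProperty.of_isPushout (P := (tensorMaps P).pushouts)
    (c.isPushout.map (forget R)) hm

end

section

variable {C : Type u} [Category.{v} C] [MonoidalCategory C] [SymmetricCategory C]
  [CategoryWithWeakEquivalences C] [CategoryWithCofibrations C] [CategoryWithFibrations C]
  [IsSymmetricMonoidalModelCategory C]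

instance (X : C) : PreservesColimitsOfSize.{v, v} (tensorLeft X) :=
  letI := (IsSymmetricMonoidalModelCategory.closed (C := C)).some
  (ihom.adjunction X).leftAdjoint_preservesColimits

variable (R : C) [MonObj R]

/-- The modules over a monoid form a model category, by the small object argument: the monoid axiom
ensures that the relative cell complexes built from the free maps on trivial cofibrations are weak
equivalences. -/
lemma exists_modelCategory (hC : IsCofibrantlyGenerated C) (hC' : MonoidAxiom C) :
    ∃ m : ModelCategory (Mod C R),
      m.categoryWithWeakEquivalences = (inferInstance : CategoryWithWeakEquivalences (Mod C R)) ∧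
      m.categoryWithCofibrations = (inferInstance : CategoryWithCofibrations (Mod C R)) ∧
      m.categoryWithFibrations = (inferInstance : CategoryWithFibrations (Mod C R)) := by
  let := IsSymmetricMonoidalModelCategory.modelCategory C
  obtain ⟨I, J, hI, hJ, hI', hJ', hIs, hJs⟩ := hC
  obtain ⟨ι, A, B, i, rfl⟩ := (isSmall_iff_eq_ofHoms _).1 hI
  obtain ⟨ι', A', B', j, rfl⟩ := (isSmall_iff_eq_ofHoms _).1 hJ
  have := hasSmallObjectArgument_free R i fun k ↦ hIs _ ⟨k⟩
  have := hasSmallObjectArgument_free R j fun k ↦ hJs _ ⟨k⟩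
  have hj (k : ι') : trivialCofibrations C (j k) := by
    rw [← llp_eq_of_wfs (trivialCofibrations C) (fibrations C), hJ']
    exact le_llp_rlp _ _ ⟨k⟩
  have : (weakEquivalences (Mod C R)).HasTwoOutOfThreeProperty :=
    inferInstanceAs ((weakEquivalences C).inverseImage (forget R)).HasTwoOutOfThreeProperty
  have : IsStableUnderCoproducts.{v} (trivialCofibrations C) := by
    rw [← llp_eq_of_wfs (trivialCofibrations C) (fibrations C)]
    infer_instance
  refine exists_modelCategory_of_hasSmallObjectArgument (ofHoms fun k ↦ (free R).map (i k))
    (ofHoms fun k ↦ (free R).map (j k)) ?_ ?_ rfl ?_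
  · rw [inverseImage_forget_rlp, ← hI']
    rfl
  · rw [inverseImage_forget_rlp, ← hJ']
    rfl
  · -- `J`-cofibrations of modules are retracts of cell complexes, covered by the monoid axiom
    rw [llp_rlp_of_hasSmallObjectArgument]
    have : (weakEquivalences (Mod C R)).IsStableUnderRetracts :=
      inferInstanceAs ((weakEquivalences C).inverseImage (forget R)).IsStableUnderRetracts
    refine (retracts_monotone fun X Y f hf ↦ ?_).trans (retracts_le _)
    obtain ⟨T, _, _, _, _, ⟨h⟩⟩ := (transfiniteCompositions_iff _ _).1 hf
    refine hC' _ ((transfiniteCompositions_iff _ _).2 ⟨T, _, _, _, _,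
      ⟨(h.ofLE (W' := ((tensorMaps (trivialCofibrations C)).pushouts).inverseImage
        (forget R)) fun X Y g hg ↦ whiskerLeft_coproducts_pushouts R j hj g hg).map⟩⟩)

end

end CategoryTheory.Mod

/-! ### The closed structure on modules over a commutative monoid -/

namespace CategoryTheory.Mod

section Desc

variable {C : Type u} [Category.{v} C] [MonoidalCategory C] [SymmetricCategory C]
  {S : C} [MonObj S] [IsCommMonObj S]
  [HasCoequalizers C] [∀ X : C, PreservesColimitsOfSize.{0, 0} (tensorLeft X)]

lemma π_hom_linear {M X N : Mod C S} (f : M ⊗ X ⟶ N) :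
    M.act ▷ X.X ≫ π M X ≫ f.hom =
      (α_ S M.X X.X).hom ≫ S ◁ (π M X ≫ f.hom) ≫ N.act := by
  rw [whiskerLeft_comp_assoc, ← act_hom, whiskerLeft_π_act_assoc, Iso.hom_inv_id_assoc]

/-- A linear map out of a tensor product is a map which is linear in the first variable and
balanced. -/
noncomputable def desc {M X N : Mod C S} (g : M.X ⊗ X.X ⟶ N.X)
    (h₁ : M.act ▷ X.X ≫ g = (α_ S M.X X.X).hom ≫ S ◁ g ≫ N.act)
    (h₂ : M.ract ▷ X.X ≫ g = (α_ M.X S X.X).hom ≫ M.X ◁ X.act ≫ g) : M ⊗ X ⟶ N :=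
  ofHom (M := M ⊗ X) (tdesc g h₂) (by
    have h : π M X ≫ tdesc g h₂ = g := tπ_tdesc g h₂
    rw [← cancel_epi (S ◁ π M X), whiskerLeft_π_act_assoc, ← whiskerLeft_comp_assoc, h, h₁,
      Iso.inv_hom_id_assoc])

lemma π_desc {M X N : Mod C S} (g : M.X ⊗ X.X ⟶ N.X) (h₁) (h₂) :
    π M X ≫ (desc (N := N) g h₁ h₂).hom = g :=
  tπ_tdesc g h₂

end Desc

section Closed

variable {C : Type u} [Category.{v} C] [MonoidalCategory C] [MonoidalClosed C]

section

variable {R : C} [MonObj R]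

/-- A map into the internal hom equalizes the two maps defining `homX` exactly if its adjunct is
`R`-linear in the first variable. -/
lemma curry_condition_iff {M N : Mod C R} {A : C} (t : A ⟶ (ihom M.X).obj N.X) :
    t ≫ MonoidalClosed.curry (M.act ▷ (ihom M.X).obj N.X ≫ (ihom.ev M.X).app N.X) =
      t ≫ MonoidalClosed.curry ((α_ R M.X ((ihom M.X).obj N.X)).hom ≫
        R ◁ (ihom.ev M.X).app N.X ≫ N.act) ↔
    M.act ▷ A ≫ MonoidalClosed.uncurry t =
      (α_ R M.X A).hom ≫ R ◁ MonoidalClosed.uncurry t ≫ N.act := by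
  rw [← MonoidalClosed.curry_natural_left, ← MonoidalClosed.curry_natural_left,
    MonoidalClosed.curry_injective.eq_iff, whisker_exchange_assoc,
    associator_naturality_right_assoc, ← whiskerLeft_comp_assoc, MonoidalClosed.uncurry_eq]

variable [HasEqualizers C]

/-- The object of `R`-linear maps from `M` to `N`, as a subobject of the internal hom. -/
noncomputable def homX (M N : Mod C R) : C :=
  equalizer
    (MonoidalClosed.curry (M.act ▷ (ihom M.X).obj N.X ≫ (ihom.ev M.X).app N.X))
    (MonoidalClosed.curry ((α_ R M.X ((ihom M.X).obj N.X)).hom ≫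
      R ◁ (ihom.ev M.X).app N.X ≫ N.act))

/-- The inclusion of the linear maps in the internal hom. -/
noncomputable def homι (M N : Mod C R) : homX M N ⟶ (ihom M.X).obj N.X := equalizer.ι _ _

/-- The evaluation of linear maps. -/
noncomputable def homEv (M N : Mod C R) : M.X ⊗ homX M N ⟶ N.X :=
  MonoidalClosed.uncurry (homι M N)

lemma act_homEv (M N : Mod C R) :
    M.act ▷ homX M N ≫ homEv M N = (α_ R M.X (homX M N)).hom ≫ R ◁ homEv M N ≫ N.act :=
  (curry_condition_iff _).1 (equalizer.condition _ _)

/-- The universal property of `homX M N`: a pairing which is linear in the first variable factors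
through it. -/
noncomputable def homLift {M N : Mod C R} {A : C} (g : M.X ⊗ A ⟶ N.X)
    (hg : M.act ▷ A ≫ g = (α_ R M.X A).hom ≫ R ◁ g ≫ N.act) : A ⟶ homX M N :=
  equalizer.lift (MonoidalClosed.curry g) ((curry_condition_iff _).2 (by simpa using hg))

lemma homLift_homι {M N : Mod C R} {A : C} (g : M.X ⊗ A ⟶ N.X) (hg) :
    homLift g hg ≫ homι M N = MonoidalClosed.curry g :=
  equalizer.lift_ι _ _

@[simp]
lemma homLift_homEv {M N : Mod C R} {A : C} (g : M.X ⊗ A ⟶ N.X) (hg) :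
    M.X ◁ homLift g hg ≫ homEv M N = g := by
  rw [homEv, ← MonoidalClosed.uncurry_natural_left, homLift_homι, MonoidalClosed.uncurry_curry]

lemma homX_ext {M N : Mod C R} {A : C} {s t : A ⟶ homX M N}
    (h : M.X ◁ s ≫ homEv M N = M.X ◁ t ≫ homEv M N) : s = t := by
  rw [homEv, ← MonoidalClosed.uncurry_natural_left, ← MonoidalClosed.uncurry_natural_left,
    MonoidalClosed.uncurry_injective.eq_iff] at h
  exact equalizer.hom_ext h

lemma homLift_eq_of_eq {M N : Mod C R} {A B : C} {f : A ⟶ B} {g : M.X ⊗ B ⟶ N.X} {hg}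
    {k : M.X ⊗ A ⟶ N.X} {hk} (h : k = M.X ◁ f ≫ g) : homLift k hk = f ≫ homLift g hg :=
  homX_ext (by rw [homLift_homEv, whiskerLeft_comp_assoc, homLift_homEv, h])

lemma whiskerLeft_homEv_linear {M N : Mod C R} {A : C} (t : A ⟶ homX M N) :
    M.act ▷ A ≫ M.X ◁ t ≫ homEv M N =
      (α_ R M.X A).hom ≫ R ◁ (M.X ◁ t ≫ homEv M N) ≫ N.act := by
  rw [← whisker_exchange_assoc, act_homEv, associator_naturality_right_assoc,
    whiskerLeft_comp_assoc]

end

variable [HasEqualizers C] [SymmetricCategory C] {S : C} [MonObj S] [IsCommMonObj S]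

lemma homAct_linear (M N : Mod C S) :
    M.act ▷ (S ⊗ homX M N) ≫ (α_ M.X S (homX M N)).inv ≫ M.ract ▷ homX M N ≫ homEv M N =
      (α_ S M.X (S ⊗ homX M N)).hom ≫
        S ◁ ((α_ M.X S (homX M N)).inv ≫ M.ract ▷ homX M N ≫ homEv M N) ≫ N.act := by
  rw [associator_inv_naturality_left_assoc, ← comp_whiskerRight_assoc, act_ract]
  simp only [comp_whiskerRight, Category.assoc, act_homEv, whiskerLeft_comp,
    associator_naturality_middle_assoc]
  simp

/-- The module structure on the object of linear maps. -/
noncomputable def homAct (M N : Mod C S) : S ⊗ homX M N ⟶ homX M N :=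
  homLift ((α_ M.X S (homX M N)).inv ≫ M.ract ▷ homX M N ≫ homEv M N) (homAct_linear M N)

@[simp]
lemma homAct_homEv (M N : Mod C S) :
    M.X ◁ homAct M N ≫ homEv M N =
      (α_ M.X S (homX M N)).inv ≫ M.ract ▷ homX M N ≫ homEv M N :=
  homLift_homEv _ _

/-- The module of linear maps from `M` to `N`. -/
noncomputable def homObj (M N : Mod C S) : Mod C S :=
  ofAct (homX M N) (homAct M N)
    (homX_ext (by
      rw [whiskerLeft_comp_assoc, homAct_homEv, associator_inv_naturality_middle_assoc,
        ← comp_whiskerRight_assoc, ract_one]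
      simp))
    (homX_ext (by
      simp only [whiskerLeft_comp_assoc, homAct_homEv, associator_inv_naturality_middle_assoc,
        associator_inv_naturality_right_assoc]
      rw [← comp_whiskerRight_assoc, ract_mul, whisker_exchange_assoc, homAct_homEv]
      simp))

/-- A map into the module of linear maps is linear exactly if the corresponding pairing is
balanced. -/
lemma balanced_homEv_iff {M X N : Mod C S} (t : X.X ⟶ homX M N) :
    X.act ≫ t = S ◁ t ≫ homAct M N ↔
      M.ract ▷ X.X ≫ M.X ◁ t ≫ homEv M N =
        (α_ M.X S X.X).hom ≫ M.X ◁ X.act ≫ M.X ◁ t ≫ homEv M N := by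
  have h : M.ract ▷ X.X ≫ M.X ◁ t ≫ homEv M N =
      (α_ M.X S X.X).hom ≫ M.X ◁ (S ◁ t ≫ homAct M N) ≫ homEv M N := by
    rw [whiskerLeft_comp_assoc, homAct_homEv, ← whisker_exchange_assoc]
    simp
  rw [h, cancel_epi, ← whiskerLeft_comp_assoc]
  exact ⟨fun h ↦ by rw [h], fun h ↦ homX_ext h.symm⟩

variable [HasCoequalizers C] [∀ X : C, PreservesColimitsOfSize.{0, 0} (tensorLeft X)]

/-- The adjunction bijection for the module of linear maps. -/
noncomputable def homObjEquiv (M X N : Mod C S) : (M ⊗ X ⟶ N) ≃ (X ⟶ homObj M N) where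
  toFun f := ofHom (N := homObj M N) (homLift (π M X ≫ f.hom) (π_hom_linear f))
    ((balanced_homEv_iff _).2 (by
      rw [homLift_homEv, π_condition_assoc]))
  invFun g := desc (M.X ◁ (g.hom : X.X ⟶ homX M N) ≫ homEv M N)
    (whiskerLeft_homEv_linear (A := X.X) g.hom)
    ((balanced_homEv_iff _).1 (act_hom g))
  left_inv f := tensor_hom_ext ((π_desc _ _ _).trans (homLift_homEv _ (π_hom_linear f)))
  right_inv g := by
    ext
    exact homX_ext ((homLift_homEv _ (π_hom_linear _)).trans (π_desc _ _ _))

/-- The closed structure on modules over a commutative monoid. -/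
noncomputable instance : MonoidalClosed (Mod C S) where
  closed M :=
    { rightAdj := Adjunction.rightAdjointOfEquiv (F := tensorLeft M) (homObjEquiv M)
        (fun X' X N f g ↦ by
          ext
          exact homLift_eq_of_eq (hk := π_hom_linear (M ◁ f ≫ g)) (hg := π_hom_linear g)
            (by rw [comp_hom', π_whiskerLeft_assoc]))
      adj := Adjunction.adjunctionOfEquivRight (F := tensorLeft M) _ _ }

end Closed

end CategoryTheory.Mod

/-! ### Tensor products and pushout-products of free modules -/

namespace CategoryTheory.Mod

section FreeTensor

variable {C : Type u} [Category.{v} C] [MonoidalCategory C]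

section

variable {R : C} [MonObj R]

/-- A map out of `(R ⊗ A) ⊗ B` which is linear in the first variable is determined by its restriction
to `A ⊗ B`. -/
lemma free_linear_eq {A B : C} {N : Mod C R} {g : ((free R).obj A).X ⊗ B ⟶ N.X}
    (hg : ((free R).obj A).act ▷ B ≫ g =
      (α_ R ((free R).obj A).X B).hom ≫ R ◁ g ≫ N.act) :
    (α_ R A B).hom ≫ R ◁ (freeι R A ▷ B ≫ g) ≫ N.act = g := by
  have h : (R ◁ freeι R A) ▷ B ≫ ((free R).obj A).act ▷ B = 𝟙 ((R ⊗ A) ⊗ B) := by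
    rw [← comp_whiskerRight]
    exact (congrArg (· ▷ B) (whiskerLeft_freeι_act A)).trans (id_whiskerRight _ _)
  rw [whiskerLeft_comp_assoc, ← associator_naturality_middle_assoc, ← hg, ← Category.assoc]
  exact (congrArg (· ≫ g) h).trans (Category.id_comp _)

/-- The extension of a map `A ⊗ B ⟶ N` to `(R ⊗ A) ⊗ B`, linear in the first variable. -/
def freeExtend {A B : C} {N : Mod C R} (h : A ⊗ B ⟶ N.X) : ((free R).obj A).X ⊗ B ⟶ N.X :=
  (α_ R A B).hom ≫ R ◁ h ≫ N.act

lemma freeExtend_linear {A B : C} {N : Mod C R} (h : A ⊗ B ⟶ N.X) :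
    ((free R).obj A).act ▷ B ≫ freeExtend h =
      (α_ R ((free R).obj A).X B).hom ≫ R ◁ freeExtend h ≫ N.act := by
  have h' : ((α_ R R A).inv ≫ MonObj.mul ▷ A) ▷ B ≫ (α_ R A B).hom ≫ R ◁ h ≫ N.act =
      (α_ R (R ⊗ A) B).hom ≫ R ◁ ((α_ R A B).hom ≫ R ◁ h ≫ N.act) ≫ N.act := by
    rw [comp_whiskerRight_assoc, associator_naturality_left_assoc, ← whisker_exchange_assoc,
      mul_act]
    simp
  exact h'

lemma freeι_freeExtend {A B : C} {N : Mod C R} (h : A ⊗ B ⟶ N.X) :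
    freeι R A ▷ B ≫ freeExtend h = h := by
  have h' : ((λ_ A).inv ≫ MonObj.one ▷ A) ▷ B ≫ (α_ R A B).hom ≫ R ◁ h ≫ N.act = h := by
    rw [comp_whiskerRight_assoc, associator_naturality_left_assoc, ← whisker_exchange_assoc,
      one_act, leftUnitor_naturality]
    simp
  exact h'

end

variable [SymmetricCategory C] {S : C} [MonObj S] [IsCommMonObj S] [HasCoequalizers C]
  [∀ X : C, PreservesColimitsOfSize.{0, 0} (tensorLeft X)]

/-- The inclusion of the generators `A ⊗ B ⟶ (S ⊗ A) ⊗[S] (S ⊗ B)` of a tensor product of free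
modules. -/
noncomputable def freeι₂ (S : C) [MonObj S] [IsCommMonObj S] (A B : C) :
    A ⊗ B ⟶ ((free S).obj A ⊗ (free S).obj B).X :=
  freeι S A ▷ B ≫ ((free S).obj A).X ◁ freeι S B ≫ π _ _

lemma freeι₂_tensorHom {A B : C} {M N : Mod C S} (f : (free S).obj A ⟶ M)
    (g : (free S).obj B ⟶ N) :
    freeι₂ S A B ≫ (f ⊗ₘ g).hom =
      ((freeι S A ≫ f.hom) ⊗ₘ (freeι S B ≫ g.hom)) ≫ π M N := by
  rw [freeι₂, Category.assoc, Category.assoc, π_tensorHom, MonoidalCategory.tensorHom_def,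
    MonoidalCategory.tensorHom_def, Category.assoc, Category.assoc, whisker_exchange_assoc,
    comp_whiskerRight_assoc, whiskerLeft_comp_assoc]

variable [MonoidalClosed C] [HasEqualizers C]

lemma freeι₂_hom {A B : C} {N : Mod C S} (f : (free S).obj A ⊗ (free S).obj B ⟶ N)
    {t : B ⟶ homX ((free S).obj A) N}
    (ht : freeι S B ≫ homLift (π _ _ ≫ f.hom) (π_hom_linear f) = t) :
    freeι₂ S A B ≫ f.hom = freeι S A ▷ B ≫ ((free S).obj A).X ◁ t ≫ homEv ((free S).obj A) N := by
  rw [freeι₂, Category.assoc, Category.assoc, ← ht, whiskerLeft_comp_assoc, homLift_homEv]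

lemma free_tensor_hom_ext {A B : C} {N : Mod C S} {f g : (free S).obj A ⊗ (free S).obj B ⟶ N}
    (h : freeι₂ S A B ≫ f.hom = freeι₂ S A B ≫ g.hom) : f = g := by
  apply (homObjEquiv _ _ _).injective
  refine free_hom_ext (homX_ext (M := (free S).obj A) (N := N) ?_)
  rw [freeι₂_hom f rfl, freeι₂_hom g rfl] at h
  have key (t : B ⟶ homX ((free S).obj A) N) := free_linear_eq (whiskerLeft_homEv_linear t)
  refine (key _).symm.trans (Eq.trans ?_ (key _))
  exact congrArg (fun k ↦ (α_ S A B).hom ≫ S ◁ k ≫ N.act) h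

/-- The linear extension of a map `A ⊗ B ⟶ N` to the tensor product of free modules. -/
noncomputable def freeDesc₂ {A B : C} {N : Mod C S} (h : A ⊗ B ⟶ N.X) :
    (free S).obj A ⊗ (free S).obj B ⟶ N :=
  (homObjEquiv _ _ _).symm
    (freeDesc (M := homObj ((free S).obj A) N) (homLift (freeExtend h) (freeExtend_linear h)))

@[simp]
lemma freeι₂_freeDesc₂ {A B : C} {N : Mod C S} (h : A ⊗ B ⟶ N.X) :
    freeι₂ S A B ≫ (freeDesc₂ h).hom = h := by
  have h₁ : freeι S B ≫ ((homObjEquiv _ _ _ (freeDesc₂ h)).hom) =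
      homLift (freeExtend h) (freeExtend_linear h) := by
    rw [freeDesc₂, Equiv.apply_symm_apply]
    exact freeι_freeDesc _
  rw [freeι₂_hom _ h₁, homLift_homEv, freeι_freeExtend]

/-- The tensor product of the free modules on `A` and `B` is the free module on `A ⊗ B`. -/
noncomputable def freeTensorIso (S : C) [MonObj S] [IsCommMonObj S] (A B : C) :
    (free S).obj A ⊗ (free S).obj B ≅ (free S).obj (A ⊗ B) where
  hom := freeDesc₂ (freeι S (A ⊗ B))
  inv := freeDesc (freeι₂ S A B)
  hom_inv_id := free_tensor_hom_ext (by
    rw [comp_hom', reassoc_of% freeι₂_freeDesc₂, freeι_freeDesc]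
    exact (Category.comp_id _).symm)
  inv_hom_id := free_hom_ext (by
    rw [comp_hom', ← Category.assoc, freeι_freeDesc, freeι₂_freeDesc₂]
    exact (Category.comp_id _).symm)

lemma freeι₂_freeTensorIso_hom (A B : C) :
    freeι₂ S A B ≫ (freeTensorIso S A B).hom.hom = freeι S (A ⊗ B) :=
  freeι₂_freeDesc₂ _

lemma freeTensorIso_hom_naturality {A A' B B' : C} (f : A ⟶ A') (g : B ⟶ B') :
    ((free S).map f ⊗ₘ (free S).map g) ≫ (freeTensorIso S A' B').hom =
      (freeTensorIso S A B).hom ≫ (free S).map (f ⊗ₘ g) := by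
  refine free_tensor_hom_ext ?_
  have h : ((f ≫ freeι S A') ⊗ₘ (g ≫ freeι S B')) ≫ π _ _ = (f ⊗ₘ g) ≫ freeι₂ S A' B' := by
    rw [← MonoidalCategory.tensorHom_comp_tensorHom_assoc, MonoidalCategory.tensorHom_def (freeι S A'),
      freeι₂, Category.assoc]
  rw [comp_hom', comp_hom', reassoc_of% freeι₂_tensorHom, freeι_naturality, freeι_naturality,
    reassoc_of% h, freeι₂_freeTensorIso_hom, reassoc_of% freeι₂_freeTensorIso_hom,
    freeι_naturality]

/-- Under `freeTensorIso`, tensoring a free module with the linear extension `S ⊗ Q ⟶ S` of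
`q : Q ⟶ 𝟙` is the free map on tensoring with `q`. -/
lemma freeTensorIso_hom_unit {Q : C} (q : Q ⟶ 𝟙_ C) (A : C) :
    freeDesc (M := 𝟙_ (Mod C S)) (q ≫ MonObj.one (X := S)) ▷ (free S).obj A ≫
      (λ_ ((free S).obj A)).hom =
    (freeTensorIso S Q A).hom ≫ (free S).map (q ▷ A ≫ (λ_ A).hom) := by
  refine free_tensor_hom_ext ?_
  have h₂ : freeι S Q ▷ A ≫ (freeDesc (M := 𝟙_ (Mod C S)) (q ≫ MonObj.one (X := S))).hom ▷ A =
      (q ≫ MonObj.one (X := S)) ▷ A :=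
    (comp_whiskerRight _ _ _).symm.trans (congrArg (· ▷ A) (freeι_freeDesc _))
  have h₃ : S ◁ freeι S A ≫ ((free S).obj A).act = 𝟙 (S ⊗ A) := whiskerLeft_freeι_act A
  rw [comp_hom', comp_hom', reassoc_of% freeι₂_freeTensorIso_hom, freeι_naturality, freeι₂, Category.assoc,
    Category.assoc, π_whiskerRight_assoc, whisker_exchange_assoc, reassoc_of% h₂, π_leftUnitor]
  have h₄ : (q ≫ MonObj.one (X := S)) ▷ A =
      (q ▷ A ≫ (λ_ A).hom) ≫ (λ_ A).inv ≫ MonObj.one (X := S) ▷ A := by simp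
  exact (congrArg (_ ≫ ·) h₃).trans ((Category.comp_id _).trans h₄)

lemma freeTensorIso_hom_naturality_left {A A' : C} (f : A ⟶ A') (B : C) :
    (free S).map f ▷ (free S).obj B ≫ (freeTensorIso S A' B).hom =
      (freeTensorIso S A B).hom ≫ (free S).map (f ▷ B) := by
  simpa using freeTensorIso_hom_naturality (S := S) f (𝟙 B)

lemma freeTensorIso_hom_naturality_right (A : C) {B B' : C} (g : B ⟶ B') :
    (free S).obj A ◁ (free S).map g ≫ (freeTensorIso S A B').hom =
      (freeTensorIso S A B).hom ≫ (free S).map (A ◁ g) := by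
  simpa using freeTensorIso_hom_naturality (S := S) (𝟙 A) g

lemma freeTensorIso_inv_naturality_left {A A' : C} (f : A ⟶ A') (B : C) :
    (free S).map (f ▷ B) ≫ (freeTensorIso S A' B).inv =
      (freeTensorIso S A B).inv ≫ (free S).map f ▷ (free S).obj B := by
  rw [Iso.comp_inv_eq, Category.assoc, freeTensorIso_hom_naturality_left, Iso.inv_hom_id_assoc]

lemma freeTensorIso_inv_naturality_right (A : C) {B B' : C} (g : B ⟶ B') :
    (free S).map (A ◁ g) ≫ (freeTensorIso S A B').inv =
      (freeTensorIso S A B).inv ≫ (free S).obj A ◁ (free S).map g := by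
  rw [Iso.comp_inv_eq, Category.assoc, freeTensorIso_hom_naturality_right, Iso.inv_hom_id_assoc]

/-- The free module functor sends pushout-products to pushout-products. -/
noncomputable def freePushoutObjObj {X₁ Y₁ X₂ Y₂ : C} {f₁ : X₁ ⟶ Y₁}
    {f₂ : X₂ ⟶ Y₂} (sq : (curriedTensor C).PushoutObjObj f₁ f₂) :
    (curriedTensor (Mod C S)).PushoutObjObj ((free S).map f₁) ((free S).map f₂) where
  pt := (free S).obj sq.pt
  inl := (freeTensorIso S Y₁ X₂).hom ≫ (free S).map sq.inl
  inr := (freeTensorIso S X₁ Y₂).hom ≫ (free S).map sq.inr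
  isPushout := (sq.isPushout.map (free S)).of_iso (freeTensorIso S X₁ X₂).symm
    (freeTensorIso S Y₁ X₂).symm (freeTensorIso S X₁ Y₂).symm (Iso.refl _)
    (freeTensorIso_inv_naturality_left f₁ X₂) (freeTensorIso_inv_naturality_right X₁ f₂)
    (by simp) (by simp)
  ι := (free S).map sq.ι ≫ (freeTensorIso S Y₁ Y₂).inv
  inl_ι := by
    have h : (free S).map (sq.inl ≫ sq.ι) ≫ (freeTensorIso S Y₁ Y₂).inv =
        (freeTensorIso S Y₁ X₂).inv ≫ (free S).obj Y₁ ◁ (free S).map f₂ := by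
      rw [sq.inl_ι]
      exact freeTensorIso_inv_naturality_right Y₁ f₂
    rw [Category.assoc, ← Functor.map_comp_assoc, h, Iso.hom_inv_id_assoc]
    rfl
  inr_ι := by
    have h : (free S).map (sq.inr ≫ sq.ι) ≫ (freeTensorIso S Y₁ Y₂).inv =
        (freeTensorIso S X₁ Y₂).inv ≫ (free S).map f₁ ▷ (free S).obj Y₂ := by
      rw [sq.inr_ι]
      exact freeTensorIso_inv_naturality_left f₁ Y₂
    rw [Category.assoc, ← Functor.map_comp_assoc, h, Iso.hom_inv_id_assoc]
    rfl

/-- The lifting properties of a pushout-product of free maps are those of the pushout-product in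
the underlying category. -/
lemma freePushoutObjObj_hasLiftingProperty_iff {X₁ Y₁ X₂ Y₂ : C} {f₁ : X₁ ⟶ Y₁} {f₂ : X₂ ⟶ Y₂}
    (sq : (curriedTensor C).PushoutObjObj f₁ f₂) {M N : Mod C S} (p : M ⟶ N) :
    HasLiftingProperty (freePushoutObjObj (S := S) sq).ι p ↔ HasLiftingProperty sq.ι p.hom :=
  (HasLiftingProperty.iff_of_arrow_iso_left
    (Arrow.isoMk (Iso.refl _) (freeTensorIso S Y₁ Y₂) (by simp [freePushoutObjObj]) :
      Arrow.mk (freePushoutObjObj (S := S) sq).ι ≅ Arrow.mk ((free S).map sq.ι)) p).trans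
    ((freeAdj S).hasLiftingProperty_iff sq.ι p)

end FreeTensor

end CategoryTheory.Mod

namespace HomotopicalAlgebra

section PushoutProduct

open MonoidalCategory.Arrow

variable {E : Type u} [Category.{v} E] [MonoidalCategory E]

lemma hasLiftingProperty_ι_iff {X₁ Y₁ X₂ Y₂ X Y : E} {f₁ : X₁ ⟶ Y₁} {f₂ : X₂ ⟶ Y₂} {p : X ⟶ Y}
    (sq sq' : (curriedTensor E).PushoutObjObj f₁ f₂) :
    HasLiftingProperty sq.ι p ↔ HasLiftingProperty sq'.ι p :=
  HasLiftingProperty.iff_of_arrow_iso_left (Functor.PushoutObjObj.ι_iso_of_iso_left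
    (f₁ := Arrow.mk f₁) (f₁' := Arrow.mk f₁) (f₂ := Arrow.mk f₂) sq sq' (Iso.refl _)) p

/-- The lifting property of pushout-products against a map can be checked on generators. -/
lemma hasLiftingProperty_pushoutProduct [BraidedCategory E] [MonoidalClosed E] [HasPushouts E]
    [HasPullbacks E] {P₁ P₂ : MorphismProperty E} {X Y : E} {p : X ⟶ Y}
    (H : ∀ ⦃A₁ B₁ A₂ B₂ : E⦄ (i : A₁ ⟶ B₁) (j : A₂ ⟶ B₂), P₁ i → P₂ j →
      ∃ sq : (curriedTensor E).PushoutObjObj i j, HasLiftingProperty sq.ι p)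
    {X₁ Y₁ X₂ Y₂ : E} {f₁ : X₁ ⟶ Y₁} {f₂ : X₂ ⟶ Y₂} (hf₁ : P₁.rlp.llp f₁) (hf₂ : P₂.rlp.llp f₂)
    (sq : (curriedTensor E).PushoutObjObj f₁ f₂) : HasLiftingProperty sq.ι p := by
  have key {A₁ B₁ A₂ B₂ : E} (f : A₁ ⟶ B₁) (g : A₂ ⟶ B₂)
      (sq : (curriedTensor E).PushoutObjObj f g) :
      HasLiftingProperty sq.ι p ↔ HasLiftingProperty (f □ g).hom p :=
    hasLiftingProperty_ι_iff sq (Functor.PushoutObjObj.ofHasPushout _ _ _)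
  rw [key, PushoutProduct.hasLiftingProperty_mk_iff']
  refine hf₁ _ fun A₁ B₁ i hi ↦ ?_
  rw [← PushoutProduct.hasLiftingProperty_mk_iff', PushoutProduct.hasLiftingProperty_mk_iff]
  refine hf₂ _ fun A₂ B₂ j hj ↦ ?_
  rw [← PushoutProduct.hasLiftingProperty_mk_iff]
  obtain ⟨sq, h⟩ := H i j hi hj
  exact (key _ _ sq).1 h

end PushoutProduct

end HomotopicalAlgebra

/-! ### The unit axiom, up to weak equivalence -/

namespace HomotopicalAlgebra

section UnitAxiom

variable {M : Type u₁} [Category.{v₁} M] [ModelCategory M]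
  {N : Type u₂} [Category.{v₂} N] [ModelCategory N]

lemma exists_lift_of_isCofibrant {K P Z : M} [IsCofibrant K] (p : P ⟶ Z) [Fibration p]
    [WeakEquivalence p] (k : K ⟶ Z) : ∃ s : K ⟶ P, s ≫ p = k := by
  have sq : CommSq (initial.to P) (initial.to K) p k := ⟨initial.hom_ext _ _⟩
  exact ⟨sq.lift, sq.fac_right⟩

/-- In the situation of a Quillen adjunction `L ⊣ U`, a map `σ : Y ⟶ Z` of fibrant objects is sent
by `U` to a weak equivalence if it induces bijections on homotopy classes of maps out of the images
under `L` of the cofibrant objects. -/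
lemma IsQuillenAdjunction.weakEquivalence_rightAdjoint_map {L : M ⥤ N} {U : N ⥤ M} {adj : L ⊣ U}
    (h : IsQuillenAdjunction adj) {Y Z : N} [IsFibrant Y] [IsFibrant Z] (σ : Y ⟶ Z)
    (hσ : ∀ (A : M) [IsCofibrant A], Function.Bijective
      fun g : (weakEquivalences N).Q.obj (L.obj A) ⟶ (weakEquivalences N).Q.obj Y ↦
        g ≫ (weakEquivalences N).Q.map σ) : WeakEquivalence (U.map σ) := by
  refine weakEquivalence_of_bijective_postcomp _ fun A _ ↦ ?_
  obtain ⟨e₁, he₁⟩ := h.exists_equiv A Y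
  obtain ⟨e₂, he₂⟩ := h.exists_equiv A Z
  have := h.isCofibrant_obj A
  have key : (fun g ↦ g ≫ (weakEquivalences M).Q.map (U.map σ)) ∘ e₁ =
      e₂ ∘ fun g ↦ g ≫ (weakEquivalences N).Q.map σ := by
    funext g
    obtain ⟨g, rfl⟩ := map_surjective_of_isLocalization (weakEquivalences N).Q _ _ g
    simp only [Function.comp_apply]
    rw [← Functor.map_comp, he₁, he₂, adj.homEquiv_naturality_right, Functor.map_comp]
  rw [← Function.Bijective.of_comp_iff _ e₁.bijective, key]
  exact e₂.bijective.comp (hσ A)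

variable [MonoidalCategory N] [MonoidalClosed N]

/-- Let `L ⊣ U` be a Quillen adjunction whose right adjoint detects weak equivalences, from a
model category to a monoidal one in which tensoring with a cofibrant object is a left Quillen
functor. If a map `k : K ⟶ 𝟙` is a unit up to weak equivalence for the objects `L A` with `A`
cofibrant, then so it is for all cofibrant objects. -/
lemma weakEquivalence_whiskerRight_leftUnitor {L : M ⥤ N} {U : N ⥤ M} {adj : L ⊣ U}
    (h : IsQuillenAdjunction adj)
    (hU : ∀ ⦃X Y : N⦄ (f : X ⟶ Y), WeakEquivalence (U.map f) → WeakEquivalence f)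
    {K : N} (hK : IsQuillenAdjunction (ihom.adjunction K)) (k : K ⟶ 𝟙_ N)
    (hk : ∀ (A : M) [IsCofibrant A], WeakEquivalence (k ▷ L.obj A ≫ (λ_ (L.obj A)).hom))
    (X : N) [IsCofibrant X] : WeakEquivalence (k ▷ X ≫ (λ_ X).hom) := by
  -- the adjunct of `k ⊗ Y`, conjugate to tensoring with `k`
  let σ (Y : N) : Y ⟶ (ihom K).obj Y := MonoidalClosed.curry (k ▷ Y ≫ (λ_ Y).hom)
  have hσ {X Y : N} (f : X ⟶ Y) :
      (ihom.adjunction K).homEquiv _ _ ((k ▷ X ≫ (λ_ X).hom) ≫ f) = f ≫ σ Y := by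
    have h : MonoidalClosed.curry ((k ▷ X ≫ (λ_ X).hom) ≫ f) = f ≫ σ Y := by
      rw [← MonoidalClosed.curry_natural_left, whisker_exchange_assoc, leftUnitor_naturality,
        Category.assoc]
    exact h
  have hσ' (Y : N) [IsFibrant Y] : WeakEquivalence (σ Y) := by
    have := hK.isFibrant_obj Y
    refine hU _ (h.weakEquivalence_rightAdjoint_map _ fun A _ ↦ ?_)
    have := h.isCofibrant_obj A
    have := hk A
    -- on homotopy classes of maps out of `L A`, precomposition with the weak equivalence
    -- `K ⊗ L A ⟶ L A` is a bijection, and so is postcomposition with `σ Y`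
    exact (hK.bijective_precomp_iff _ _ hσ).1
      ((asIso ((weakEquivalences N).Q.map (k ▷ L.obj A ≫ (λ_ (L.obj A)).hom))).homFromEquiv.symm
        |>.bijective)
  refine weakEquivalence_of_bijective_precomp _ fun Y _ ↦ ?_
  have := hσ' Y
  exact (hK.bijective_precomp_iff _ _ hσ).2
    ((asIso ((weakEquivalences N).Q.map (σ Y))).homToEquiv |>.bijective)

variable [SymmetricCategory N]

/-- The unit axiom holds for all cofibrant replacements of the unit if some map `k : K ⟶ 𝟙` out of a
cofibrant object is a unit up to weak equivalence for all cofibrant objects. It is not assumed that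
`k` is a weak equivalence: by the two-out-of-six property applied to
`K ⊗ K ⟶ K ⊗ P ⟶ K ⟶ P`, where `P` is a cofibrant replacement of the unit,
this is automatic. -/
lemma unit_axiom_of_weakEquivalence
    (hT : ∀ (X : N) [IsCofibrant X], IsQuillenAdjunction (ihom.adjunction X))
    {K : N} [IsCofibrant K] (k : K ⟶ 𝟙_ N)
    (hk : ∀ (X : N) [IsCofibrant X], WeakEquivalence (k ▷ X ≫ (λ_ X).hom))
    {Q : N} [IsCofibrant Q] (q : Q ⟶ 𝟙_ N) [WeakEquivalence q] (X : N) [IsCofibrant X] :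
    WeakEquivalence (q ▷ X ≫ (λ_ X).hom) := by
  obtain ⟨P, _, p, _, _⟩ := CofibrantObject.HoCat.exists_resolution (𝟙_ N)
  obtain ⟨s, hs⟩ := exists_lift_of_isCofibrant p k
  obtain ⟨t, ht⟩ := exists_lift_of_isCofibrant p q
  have : WeakEquivalence (t ≫ p) := by rwa [ht]
  have : WeakEquivalence t := weakEquivalence_of_postcomp t p
  have hs' : WeakEquivalence s := by
    have h₁ : K ◁ s ≫ K ◁ p ≫ (ρ_ K).hom = (β_ K K).hom ≫ k ▷ K ≫ (λ_ K).hom := by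
      rw [← whiskerLeft_comp_assoc, hs, ← BraidedCategory.braiding_naturality_right_assoc,
        braiding_leftUnitor]
    have h₂ : ((K ◁ p ≫ (ρ_ K).hom) ≫ s) ≫ p = (k ▷ P ≫ (λ_ P).hom) ≫ p := by
      rw [Category.assoc, hs, Category.assoc, Category.assoc, ← leftUnitor_naturality,
        ← whisker_exchange_assoc, unitors_equal, rightUnitor_naturality]
    have := hk K
    have := hk P
    have : WeakEquivalence (K ◁ s ≫ K ◁ p ≫ (ρ_ K).hom) := by
      rw [h₁]
      infer_instance
    have : WeakEquivalence (((K ◁ p ≫ (ρ_ K).hom) ≫ s) ≫ p) := by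
      rw [h₂]
      infer_instance
    have : WeakEquivalence ((K ◁ p ≫ (ρ_ K).hom) ≫ s) := weakEquivalence_of_postcomp _ p
    exact weakEquivalence_of_twoOutOfSix (K ◁ s) (K ◁ p ≫ (ρ_ K).hom) s
  have hX {A B : N} [IsCofibrant A] [IsCofibrant B] (f : A ⟶ B) [WeakEquivalence f] :
      WeakEquivalence (f ▷ X) := by
    have : WeakEquivalence (X ◁ f) := (hT X).weakEquivalence_map f
    have h : f ▷ X = (β_ A X).hom ≫ X ◁ f ≫ (β_ B X).inv := by simp
    rw [h]
    infer_instance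
  have := hX s
  have := hX t
  have : WeakEquivalence (s ▷ X ≫ p ▷ X ≫ (λ_ X).hom) := by
    rw [← comp_whiskerRight_assoc, hs]
    exact hk X
  have : WeakEquivalence (p ▷ X ≫ (λ_ X).hom) := weakEquivalence_of_precomp (s ▷ X) _
  rw [← ht, comp_whiskerRight_assoc]
  infer_instance

end UnitAxiom

end HomotopicalAlgebra

/-! ### The symmetric monoidal model structure on modules -/

namespace HomotopicalAlgebra

/-- By the pushout-product axiom, tensoring with a cofibrant object is a left Quillen functor. -/
lemma isQuillenAdjunction_ihom {E : Type u} [Category.{v} E] [ModelCategory E]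
    [MonoidalCategory E] [SymmetricCategory E] [MonoidalClosed E]
    (hE : ∀ {X₁ Y₁ X₂ Y₂ : E} (f₁ : X₁ ⟶ Y₁) (f₂ : X₂ ⟶ Y₂) [Cofibration f₁] [Cofibration f₂]
      (sq : (curriedTensor E).PushoutObjObj f₁ f₂),
      Cofibration sq.ι ∧ (WeakEquivalence f₁ ∨ WeakEquivalence f₂ → WeakEquivalence sq.ι))
    (X : E) [IsCofibrant X] : IsQuillenAdjunction (ihom.adjunction X) := by
  have (Z : E) : PreservesColimitsOfShape (Discrete PEmpty.{1}) ((curriedTensor E).flip.obj Z) := by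
    have : PreservesColimitsOfShape (Discrete PEmpty.{1}) (tensorLeft Z) :=
      (ihom.adjunction Z).leftAdjoint_preservesColimits.preservesColimitsOfShape
    exact preservesColimitsOfShape_of_natIso (BraidedCategory.tensorLeftIsoTensorRight Z)
  let sq {A B : E} (f : A ⟶ B) : (curriedTensor E).PushoutObjObj (initial.to X) f :=
    .ofIsInitialLeft _ _ _ initialIsInitial
  exact
    { cofibrations_le A B f hf := by
        have : Cofibration f := (cofibration_iff _).2 hf
        exact (cofibration_iff _).1 (hE _ f (sq f)).1
      trivialCofibrations_le A B f hf := by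
        obtain ⟨_, _⟩ := (mem_trivialCofibrations_iff _).1 hf
        obtain ⟨h₁, h₂⟩ := hE _ f (sq f)
        exact (mem_trivialCofibrations_iff _).2 ⟨h₁, h₂ (Or.inr inferInstance)⟩ }

end HomotopicalAlgebra

namespace CategoryTheory.Mod

open MorphismProperty

variable {C : Type u} [Category.{v} C] [MonoidalCategory C] [SymmetricCategory C]
  [CategoryWithWeakEquivalences C] [CategoryWithCofibrations C] [CategoryWithFibrations C]
  [IsSymmetricMonoidalModelCategory C]

/-- The model category of modules over a monoid. -/
noncomputable abbrev modelCategory (R : C) [MonObj R] (hC : IsCofibrantlyGenerated C)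
    (hC' : MonoidAxiom C) : ModelCategory (Mod C R) :=
  modelCategoryOfExists (exists_modelCategory R hC hC')

variable (S : C) [MonObj S] [IsCommMonObj S]

/-- The pushout-product axiom for modules, deduced from that of the base category. -/
lemma pushoutProduct_axiom (hC : IsCofibrantlyGenerated C) (hC' : MonoidAxiom C)
    {X₁ Y₁ X₂ Y₂ : Mod C S} (f₁ : X₁ ⟶ Y₁) (f₂ : X₂ ⟶ Y₂) [Cofibration f₁] [Cofibration f₂]
    (sq : (curriedTensor (Mod C S)).PushoutObjObj f₁ f₂) :
    Cofibration sq.ι ∧ (WeakEquivalence f₁ ∨ WeakEquivalence f₂ → WeakEquivalence sq.ι) := by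
  let := IsSymmetricMonoidalModelCategory.modelCategory C
  let := modelCategory S hC hC'
  let := (IsSymmetricMonoidalModelCategory.closed (C := C)).some
  have hcof : cofibrations (Mod C S) = ((cofibrations C).strictMap (free S)).rlp.llp := by
    rw [strictMap_free_rlp S (rlp_eq_of_wfs (cofibrations C) (trivialFibrations C))]
    rfl
  have htcof : trivialCofibrations (Mod C S) =
      ((trivialCofibrations C).strictMap (free S)).rlp.llp := by
    rw [strictMap_free_rlp S (rlp_eq_of_wfs (trivialCofibrations C) (fibrations C))]
    exact (fibrations_llp (Mod C S)).symm
  have key {P₁ P₂ : MorphismProperty C} {M N : Mod C S} {p : M ⟶ N}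
      (h₁ : (P₁.strictMap (free S)).rlp.llp f₁) (h₂ : (P₂.strictMap (free S)).rlp.llp f₂)
      (H : ∀ ⦃A₁ B₁ A₂ B₂ : C⦄ (i : A₁ ⟶ B₁) (j : A₂ ⟶ B₂) (_ : P₁ i) (_ : P₂ j)
        (sq : (curriedTensor C).PushoutObjObj i j), HasLiftingProperty sq.ι p.hom) :
      HasLiftingProperty sq.ι p := by
    refine hasLiftingProperty_pushoutProduct ?_ h₁ h₂ sq
    rintro _ _ _ _ _ _ ⟨hi⟩ ⟨hj⟩
    exact ⟨freePushoutObjObj (.ofHasPushout _ _ _),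
      (freePushoutObjObj_hasLiftingProperty_iff _ _).2 (H _ _ hi hj _)⟩
  have hf₁ := mem_cofibrations f₁
  have hf₂ := mem_cofibrations f₂
  rw [hcof] at hf₁ hf₂
  refine ⟨(cofibration_iff _).2 fun M N p hp ↦ key hf₁ hf₂ fun A₁ B₁ A₂ B₂ i j hi hj sq ↦ ?_,
    fun hf ↦ ?_⟩
  · have := (cofibration_iff _).2 hi
    have := (cofibration_iff _).2 hj
    exact hasLiftingProperty_of_wfs (W₁ := cofibrations C) (W₂ := trivialFibrations C) _ _
      ((cofibration_iff _).1 (IsSymmetricMonoidalModelCategory.pushoutProduct i j sq).1) hp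
  · suffices trivialCofibrations (Mod C S) sq.ι from ((mem_trivialCofibrations_iff _).1 this).2
    rw [← fibrations_llp]
    intro M N p hp
    obtain hf | hf := hf
    · have hf₁' := mem_trivialCofibrations f₁
      rw [htcof] at hf₁'
      refine key hf₁' hf₂ fun A₁ B₁ A₂ B₂ i j hi hj sq ↦ ?_
      obtain ⟨_, _⟩ := (mem_trivialCofibrations_iff _).1 hi
      have := (cofibration_iff _).2 hj
      obtain ⟨h₁, h₂⟩ := IsSymmetricMonoidalModelCategory.pushoutProduct i j sq
      exact hasLiftingProperty_of_wfs (W₁ := trivialCofibrations C) (W₂ := fibrations C) _ _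
        ((mem_trivialCofibrations_iff _).2 ⟨h₁, h₂ (Or.inl inferInstance)⟩) hp
    · have hf₂' := mem_trivialCofibrations f₂
      rw [htcof] at hf₂'
      refine key hf₁ hf₂' fun A₁ B₁ A₂ B₂ i j hi hj sq ↦ ?_
      obtain ⟨_, _⟩ := (mem_trivialCofibrations_iff _).1 hj
      have := (cofibration_iff _).2 hi
      obtain ⟨h₁, h₂⟩ := IsSymmetricMonoidalModelCategory.pushoutProduct i j sq
      exact hasLiftingProperty_of_wfs (W₁ := trivialCofibrations C) (W₂ := fibrations C) _ _
        ((mem_trivialCofibrations_iff _).2 ⟨h₁, h₂ (Or.inr inferInstance)⟩) hp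

/-- The modules over a commutative monoid form a symmetric monoidal model category. -/
theorem isSymmetricMonoidalModelCategory (hC : IsCofibrantlyGenerated C) (hC' : MonoidAxiom C) :
    IsSymmetricMonoidalModelCategory (Mod C S) where
  exists_modelCategory := exists_modelCategory S hC hC'
  closed :=
    let := (IsSymmetricMonoidalModelCategory.closed (C := C)).some
    ⟨inferInstance⟩
  pushoutProduct f₁ f₂ _ _ sq := pushoutProduct_axiom S hC hC' f₁ f₂ sq
  unit {Q} _ q _ X _ := by
    let := IsSymmetricMonoidalModelCategory.modelCategory C
    let := modelCategory S hC hC'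
    let := (IsSymmetricMonoidalModelCategory.closed (C := C)).some
    have hT (X : Mod C S) [IsCofibrant X] : IsQuillenAdjunction (ihom.adjunction X) :=
      isQuillenAdjunction_ihom (pushoutProduct_axiom S hC hC') X
    have hfree : IsQuillenAdjunction (freeAdj S) := .of_rightAdjoint le_rfl le_rfl
    -- the free module on a cofibrant replacement of the unit is a unit up to weak equivalence
    -- for free modules, by the unit axiom of the base category and Ken Brown's lemma
    obtain ⟨K, _, k, _, _⟩ := CofibrantObject.HoCat.exists_resolution (𝟙_ C)
    have := hfree.isCofibrant_obj K
    refine unit_axiom_of_weakEquivalence hT (freeDesc (M := 𝟙_ (Mod C S)) (k ≫ MonObj.one (X := S)))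
      (fun X _ ↦ ?_) q X
    refine weakEquivalence_whiskerRight_leftUnitor hfree (fun _ _ f h ↦ ⟨h.mem⟩) (hT _) _ (fun A _ ↦ ?_) X
    rw [freeTensorIso_hom_unit]
    have : WeakEquivalence (k ▷ A ≫ (λ_ A).hom) := IsSymmetricMonoidalModelCategory.unit k A
    have : IsCofibrant (K ⊗ A) :=
      (isQuillenAdjunction_ihom IsSymmetricMonoidalModelCategory.pushoutProduct K).isCofibrant_obj A
    have := hfree.weakEquivalence_map (k ▷ A ≫ (λ_ A).hom)
    infer_instance

end CategoryTheory.Mod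

/-! ### The induced functor on modules is strong symmetric monoidal -/

namespace CategoryTheory

open Functor.LaxMonoidal Functor.OplaxMonoidal

section MapMod

variable {C : Type u₁} [Category.{v₁} C] [MonoidalCategory C] [SymmetricCategory C]
  {D : Type u₂} [Category.{v₂} D] [MonoidalCategory D] [SymmetricCategory D]
  (F : C ⥤ D) [F.Braided] (S : C) [MonObj S]

/-- As `F` is braided, the right action on `FM` is the image of the right action on `M`. -/
lemma mapMod_obj_ract (M : Mod C S) :
    ((mapMod F S).obj M).ract = Functor.LaxMonoidal.μ F M.X S ≫ F.map M.ract := by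
  have h : (β_ (F.obj M.X) (F.obj S)).hom ≫ Functor.LaxMonoidal.μ F S M.X ≫ F.map M.act =
      Functor.LaxMonoidal.μ F M.X S ≫ F.map M.ract := by
    rw [Mod.ract, F.map_comp, Functor.LaxBraided.braided_assoc]
  exact h

variable {S}

/-- A map out of `FM ⊗ FN` which is balanced over `F S` coequalizes the images under `F` of the two
maps `(M ⊗ S) ⊗ N ⟶ M ⊗ N`. -/
lemma map_ract_whiskerRight_δ (M N : Mod C S) {Z : D} (z : F.obj M.X ⊗ F.obj N.X ⟶ Z)
    (hz : (Functor.LaxMonoidal.μ F M.X S ≫ F.map M.ract) ▷ F.obj N.X ≫ z =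
      (α_ (F.obj M.X) (F.obj S) (F.obj N.X)).hom ≫
        F.obj M.X ◁ (Functor.LaxMonoidal.μ F S N.X ≫ F.map N.act) ≫ z) :
    F.map (M.ract ▷ N.X) ≫ Functor.OplaxMonoidal.δ F M.X N.X ≫ z =
      F.map ((α_ M.X S N.X).hom ≫ M.X ◁ N.act) ≫ Functor.OplaxMonoidal.δ F M.X N.X ≫ z := by
  rw [← cancel_epi (Functor.LaxMonoidal.μ F (M.X ⊗ S) N.X),
    ← cancel_epi (Functor.LaxMonoidal.μ F M.X S ▷ F.obj N.X), F.map_comp, Category.assoc,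
    Functor.LaxMonoidal.associativity_assoc, ← μ_natural_left_assoc, ← μ_natural_right_assoc,
    Functor.Monoidal.μ_δ_assoc, ← comp_whiskerRight_assoc, hz, whiskerLeft_comp_assoc]

variable [HasCoequalizers C] [∀ X : C, PreservesColimitsOfSize.{0, 0} (tensorLeft X)]
  [IsCommMonObj S]

/-- As `F` preserves the coequalizer defining `M ⊗[S] N`, a map out of `F (M ⊗[S] N)` may be
constructed on `FM ⊗ FN`. -/
lemma exists_map_π_comp [PreservesColimitsOfShape WalkingParallelPair F] (M N : Mod C S) {Z : D}
    (z : F.obj M.X ⊗ F.obj N.X ⟶ Z)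
    (hz : (Functor.LaxMonoidal.μ F M.X S ≫ F.map M.ract) ▷ F.obj N.X ≫ z =
      (α_ (F.obj M.X) (F.obj S) (F.obj N.X)).hom ≫
        F.obj M.X ◁ (Functor.LaxMonoidal.μ F S N.X ≫ F.map N.act) ≫ z) :
    ∃ g : F.obj (M ⊗ N).X ⟶ Z,
      F.map (Mod.π M N) ≫ g = Functor.OplaxMonoidal.δ F M.X N.X ≫ z :=
  ⟨Cofork.IsColimit.desc (isColimitOfHasCoequalizerOfPreservesColimit F _ _) _
      (map_ract_whiskerRight_δ F M N z hz),
    Cofork.IsColimit.π_desc' (isColimitOfHasCoequalizerOfPreservesColimit F _ _) _ _⟩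

lemma mapModμ_linear (M N : Mod C S) :
    (Functor.LaxMonoidal.μ F S M.X ≫ F.map M.act) ▷ F.obj N.X ≫
        Functor.LaxMonoidal.μ F M.X N.X ≫ F.map (Mod.π M N) =
      (α_ (F.obj S) (F.obj M.X) (F.obj N.X)).hom ≫
        F.obj S ◁ (Functor.LaxMonoidal.μ F M.X N.X ≫ F.map (Mod.π M N)) ≫
          Functor.LaxMonoidal.μ F S (M ⊗ N).X ≫ F.map (M ⊗ N).act := by
  have h : M.act ▷ N.X ≫ Mod.π M N = (α_ S M.X N.X).hom ≫ S ◁ Mod.π M N ≫ (M ⊗ N).act := by simp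
  rw [comp_whiskerRight_assoc, μ_natural_left_assoc, ← F.map_comp, h, whiskerLeft_comp_assoc,
    μ_natural_right_assoc, F.map_comp, F.map_comp, Functor.LaxMonoidal.associativity_assoc]

lemma mapModμ_balanced (M N : Mod C S) :
    (Functor.LaxMonoidal.μ F M.X S ≫ F.map M.ract) ▷ F.obj N.X ≫
        Functor.LaxMonoidal.μ F M.X N.X ≫ F.map (Mod.π M N) =
      (α_ (F.obj M.X) (F.obj S) (F.obj N.X)).hom ≫
        F.obj M.X ◁ (Functor.LaxMonoidal.μ F S N.X ≫ F.map N.act) ≫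
          Functor.LaxMonoidal.μ F M.X N.X ≫ F.map (Mod.π M N) := by
  rw [comp_whiskerRight_assoc, μ_natural_left_assoc, ← F.map_comp, Mod.π_condition,
    whiskerLeft_comp_assoc, μ_natural_right_assoc, F.map_comp, F.map_comp,
    Functor.LaxMonoidal.associativity_assoc]

variable [HasCoequalizers D] [∀ X : D, PreservesColimitsOfSize.{0, 0} (tensorLeft X)]

/-- The comparison map `FM ⊗[F S] FN ⟶ F (M ⊗[S] N)`. -/
noncomputable def mapModμ (M N : Mod C S) :
    (mapMod F S).obj M ⊗ (mapMod F S).obj N ⟶ (mapMod F S).obj (M ⊗ N) :=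
  Mod.desc (N := (mapMod F S).obj (M ⊗ N))
    (Functor.LaxMonoidal.μ F M.X N.X ≫ F.map (Mod.π M N)) (mapModμ_linear F M N)
    (by rw [mapMod_obj_ract]; exact mapModμ_balanced F M N)

lemma π_mapModμ (M N : Mod C S) :
    Mod.π ((mapMod F S).obj M) ((mapMod F S).obj N) ≫ (mapModμ F M N).hom =
      Functor.LaxMonoidal.μ F M.X N.X ≫ F.map (Mod.π M N) :=
  Mod.π_desc _ _ _

lemma π_mapModμ_comp (M N : Mod C S) {P : Mod D (F.obj S)} (g : (mapMod F S).obj (M ⊗ N) ⟶ P) :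
    Mod.π ((mapMod F S).obj M) ((mapMod F S).obj N) ≫ (mapModμ F M N ≫ g).hom =
      Functor.LaxMonoidal.μ F M.X N.X ≫ F.map (Mod.π M N) ≫ g.hom :=
  (Category.assoc _ _ _).symm.trans ((congrArg
    (fun t : F.obj M.X ⊗ F.obj N.X ⟶ F.obj (M ⊗ N).X ↦ t ≫ g.hom) (π_mapModμ F M N)).trans
      (Category.assoc _ _ _))

lemma mapModμ_natural_left {M M' : Mod C S} (f : M ⟶ M') (N : Mod C S) :
    (mapMod F S).map f ▷ (mapMod F S).obj N ≫ mapModμ F M' N =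
      mapModμ F M N ≫ (mapMod F S).map (f ▷ N) := by
  have h : F.map f.hom ▷ F.obj N.X ≫ Functor.LaxMonoidal.μ F M'.X N.X ≫ F.map (Mod.π M' N) =
      Functor.LaxMonoidal.μ F M.X N.X ≫ F.map (Mod.π M N) ≫ F.map (f ▷ N).hom := by
    rw [μ_natural_left_assoc, ← F.map_comp, ← F.map_comp, Mod.π_whiskerRight]
  refine Mod.tensor_hom_ext (Eq.trans ?_ (h.trans (π_mapModμ_comp F M N ((mapMod F S).map (f ▷ N))).symm))
  exact (Mod.π_whiskerRight_assoc ((mapMod F S).map f) ((mapMod F S).obj N)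
    (mapModμ F M' N).hom).trans (congrArg
      (fun t : F.obj M'.X ⊗ F.obj N.X ⟶ F.obj (M' ⊗ N).X ↦ F.map f.hom ▷ F.obj N.X ≫ t)
      (π_mapModμ F M' N))

lemma mapModμ_natural_right (M : Mod C S) {N N' : Mod C S} (f : N ⟶ N') :
    (mapMod F S).obj M ◁ (mapMod F S).map f ≫ mapModμ F M N' =
      mapModμ F M N ≫ (mapMod F S).map (M ◁ f) := by
  have h : F.obj M.X ◁ F.map f.hom ≫ Functor.LaxMonoidal.μ F M.X N'.X ≫ F.map (Mod.π M N') =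
      Functor.LaxMonoidal.μ F M.X N.X ≫ F.map (Mod.π M N) ≫ F.map (M ◁ f).hom := by
    rw [μ_natural_right_assoc, ← F.map_comp, ← F.map_comp, Mod.π_whiskerLeft]
  refine Mod.tensor_hom_ext (Eq.trans ?_ (h.trans (π_mapModμ_comp F M N ((mapMod F S).map (M ◁ f))).symm))
  exact (Mod.π_whiskerLeft_assoc ((mapMod F S).obj M) ((mapMod F S).map f)
    (mapModμ F M N').hom).trans (congrArg
      (fun t : F.obj M.X ⊗ F.obj N'.X ⟶ F.obj (M ⊗ N').X ↦ F.obj M.X ◁ F.map f.hom ≫ t)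
      (π_mapModμ F M N'))

lemma Mod.π_whiskerRight_comp {A B P Q Z : Mod C S} (f : A ⊗ B ⟶ Q) (g : Q ⊗ P ⟶ Z) :
    Mod.π A B ▷ P.X ≫ Mod.π (A ⊗ B) P ≫ (f ▷ P ≫ g).hom =
      (Mod.π A B ≫ f.hom) ▷ P.X ≫ Mod.π Q P ≫ g.hom := by
  simp

lemma Mod.π_associator_whiskerLeft_comp {A B P Q Z : Mod C S} (f : B ⊗ P ⟶ Q) (g : A ⊗ Q ⟶ Z) :
    Mod.π A B ▷ P.X ≫ Mod.π (A ⊗ B) P ≫ ((α_ A B P).hom ≫ A ◁ f ≫ g).hom =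
      (α_ A.X B.X P.X).hom ≫ A.X ◁ (Mod.π B P ≫ f.hom) ≫ Mod.π A Q ≫ g.hom := by
  simp

lemma mapModμ_associativity (M N P : Mod C S) :
    mapModμ F M N ▷ (mapMod F S).obj P ≫ mapModμ F (M ⊗ N) P ≫ (mapMod F S).map (α_ M N P).hom =
      (α_ ((mapMod F S).obj M) ((mapMod F S).obj N) ((mapMod F S).obj P)).hom ≫
        (mapMod F S).obj M ◁ mapModμ F N P ≫ mapModμ F M (N ⊗ P) := by
  have h : (Functor.LaxMonoidal.μ F M.X N.X ≫ F.map (Mod.π M N)) ▷ F.obj P.X ≫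
        Functor.LaxMonoidal.μ F (M ⊗ N).X P.X ≫ F.map (Mod.π (M ⊗ N) P) ≫
          F.map (α_ M N P).hom.hom =
      (α_ (F.obj M.X) (F.obj N.X) (F.obj P.X)).hom ≫
        F.obj M.X ◁ (Functor.LaxMonoidal.μ F N.X P.X ≫ F.map (Mod.π N P)) ≫
          Functor.LaxMonoidal.μ F M.X (N ⊗ P).X ≫ F.map (Mod.π M (N ⊗ P)) := by
    rw [comp_whiskerRight_assoc, μ_natural_left_assoc, ← F.map_comp, ← F.map_comp,
      Mod.π_associator, whiskerLeft_comp_assoc, μ_natural_right_assoc, F.map_comp, F.map_comp,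
      Functor.LaxMonoidal.associativity_assoc]
  have h₁ := congrArg₂ (fun (s : F.obj M.X ⊗ F.obj N.X ⟶ F.obj (M ⊗ N).X)
    (t : F.obj (M ⊗ N).X ⊗ F.obj P.X ⟶ F.obj (M ⊗ (N ⊗ P)).X) ↦ s ▷ F.obj P.X ≫ t)
    (π_mapModμ F M N) (π_mapModμ_comp F (M ⊗ N) P ((mapMod F S).map (α_ M N P).hom))
  have h₂ := congrArg₂ (fun (s : F.obj N.X ⊗ F.obj P.X ⟶ F.obj (N ⊗ P).X)
    (t : F.obj M.X ⊗ F.obj (N ⊗ P).X ⟶ F.obj (M ⊗ (N ⊗ P)).X) ↦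
      (α_ (F.obj M.X) (F.obj N.X) (F.obj P.X)).hom ≫ F.obj M.X ◁ s ≫ t)
    (π_mapModμ F N P) (π_mapModμ F M (N ⊗ P))
  exact Mod.tensor₃_hom_ext (((Mod.π_whiskerRight_comp (mapModμ F M N) _).trans (h₁.trans h)).trans
    (h₂.symm.trans (Mod.π_associator_whiskerLeft_comp (mapModμ F N P) (mapModμ F M (N ⊗ P))).symm))

variable (S) in
/-- The unit of `F S`-modules is the image of the unit of `S`-modules, by the identity of `F S`. -/
noncomputable def mapModε : 𝟙_ (Mod D (F.obj S)) ≅ (mapMod F S).obj (𝟙_ (Mod C S)) where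
  hom := Mod.ofHom (M := Mod.tUnit (F.obj S)) (N := (mapMod F S).obj (Mod.tUnit S))
    (𝟙 (F.obj S)) (by
      have h : (Functor.LaxMonoidal.μ F S S ≫ F.map (MonObj.mul (X := S))) ≫ 𝟙 (F.obj S) =
          F.obj S ◁ 𝟙 (F.obj S) ≫ Functor.LaxMonoidal.μ F S S ≫ F.map (MonObj.mul (X := S)) := by
        simp
      exact h)
  inv := mapModUnit F S
  hom_inv_id := by ext; exact Category.comp_id (𝟙 (F.obj S))
  inv_hom_id := by ext; exact Category.comp_id (𝟙 (F.obj S))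

lemma mapModμ_left_unitality (M : Mod C S) :
    (λ_ ((mapMod F S).obj M)).hom =
      (mapModε F S).hom ▷ (mapMod F S).obj M ≫ mapModμ F (𝟙_ _) M ≫ (mapMod F S).map (λ_ M).hom := by
  have h : 𝟙 (F.obj S) ▷ F.obj M.X ≫ Functor.LaxMonoidal.μ F S M.X ≫
      F.map (Mod.π (𝟙_ (Mod C S)) M) ≫ F.map (λ_ M).hom.hom =
      Functor.LaxMonoidal.μ F S M.X ≫ F.map M.act := by
    rw [id_whiskerRight, Category.id_comp, ← F.map_comp]
    exact congrArg (fun t ↦ Functor.LaxMonoidal.μ F S M.X ≫ F.map t) (Mod.π_leftUnitor M)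
  have h₁ := congrArg (fun t : F.obj S ⊗ F.obj M.X ⟶ F.obj M.X ↦ 𝟙 (F.obj S) ▷ F.obj M.X ≫ t)
    (π_mapModμ_comp F (𝟙_ _) M ((mapMod F S).map (λ_ M).hom))
  exact Mod.tensor_hom_ext ((Mod.π_leftUnitor _).trans (h.symm.trans (h₁.symm.trans
    (Mod.π_whiskerRight_assoc (mapModε F S).hom ((mapMod F S).obj M) _).symm)))

lemma mapModμ_right_unitality (M : Mod C S) :
    (ρ_ ((mapMod F S).obj M)).hom =
      (mapMod F S).obj M ◁ (mapModε F S).hom ≫ mapModμ F M (𝟙_ _) ≫ (mapMod F S).map (ρ_ M).hom := by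
  have h : F.obj M.X ◁ 𝟙 (F.obj S) ≫ Functor.LaxMonoidal.μ F M.X S ≫
      F.map (Mod.π M (𝟙_ (Mod C S))) ≫ F.map (ρ_ M).hom.hom =
      Functor.LaxMonoidal.μ F M.X S ≫ F.map M.ract := by
    rw [whiskerLeft_id, Category.id_comp, ← F.map_comp]
    exact congrArg (fun t ↦ Functor.LaxMonoidal.μ F M.X S ≫ F.map t) (Mod.π_rightUnitor M)
  have h₁ := congrArg (fun t : F.obj M.X ⊗ F.obj S ⟶ F.obj M.X ↦ F.obj M.X ◁ 𝟙 (F.obj S) ≫ t)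
    (π_mapModμ_comp F M (𝟙_ _) ((mapMod F S).map (ρ_ M).hom))
  exact Mod.tensor_hom_ext ((Mod.π_rightUnitor _).trans ((mapMod_obj_ract F S M).trans
    (h.symm.trans (h₁.symm.trans
      (Mod.π_whiskerLeft_assoc ((mapMod F S).obj M) (mapModε F S).hom _).symm))))

variable [PreservesColimitsOfShape WalkingParallelPair F]

instance (M N : Mod C S) : Epi (F.map (Mod.π M N)) :=
  inferInstanceAs (Epi (F.map (coequalizer.π _ _)))

instance (M N : Mod C S) : IsIso (mapModμ F M N) := by
  have h := Mod.π_condition ((mapMod F S).obj M) ((mapMod F S).obj N)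
  rw [mapMod_obj_ract] at h
  obtain ⟨g, hg⟩ := exists_map_π_comp F M N _ h
  suffices IsIso ((Mod.forget (F.obj S)).map (mapModμ F M N)) from
    isIso_of_reflects_iso _ (Mod.forget (F.obj S))
  have h₁ : Functor.LaxMonoidal.μ F M.X N.X ≫ F.map (Mod.π M N) ≫ g =
      Mod.π ((mapMod F S).obj M) ((mapMod F S).obj N) := by
    rw [hg]
    exact Functor.Monoidal.μ_δ_assoc F M.X N.X _
  have h₂ : F.map (Mod.π M N) ≫ g ≫ (mapModμ F M N).hom = F.map (Mod.π M N) := by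
    refine ((reassoc_of% hg) (mapModμ F M N).hom).trans ((Category.assoc _ _ _).trans ?_)
    refine (congrArg (fun t : F.obj M.X ⊗ F.obj N.X ⟶ F.obj (M ⊗ N).X ↦
      Functor.OplaxMonoidal.δ F M.X N.X ≫ t) (π_mapModμ F M N)).trans ?_
    simp
  refine ⟨g, (cancel_epi (Mod.π ((mapMod F S).obj M) ((mapMod F S).obj N))).1 ?_,
    (cancel_epi (F.map (Mod.π M N))).1 (h₂.trans (Category.comp_id _).symm)⟩
  refine ((Category.assoc _ _ _).symm.trans ((congrArg
    (fun t : F.obj M.X ⊗ F.obj N.X ⟶ F.obj (M ⊗ N).X ↦ t ≫ g) (π_mapModμ F M N)).trans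
      ((Category.assoc _ _ _).trans h₁))).trans (Category.comp_id _).symm

/-- The strong monoidal structure on the functor induced by `F` on modules. -/
noncomputable def mapModCore :
    (mapMod F S).CoreMonoidal where
  εIso := mapModε F S
  μIso M N := asIso (mapModμ F M N)
  μIso_hom_natural_left f N := mapModμ_natural_left F f N
  μIso_hom_natural_right M f := mapModμ_natural_right F M f
  associativity := mapModμ_associativity F
  left_unitality := mapModμ_left_unitality F
  right_unitality := mapModμ_right_unitality F


/-- The functor induced by `F` on modules is braided, as the projections from `FM ⊗ FN` are epi. -/
noncomputable abbrev mapModBraided :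
    (mapMod F S).Braided where
  toMonoidal := (mapModCore F).toMonoidal
  braided M N := by
    have h : Functor.LaxMonoidal.μ F M.X N.X ≫ F.map (Mod.π M N) ≫ F.map (β_ M N).hom.hom =
        (β_ (F.obj M.X) (F.obj N.X)).hom ≫
          Functor.LaxMonoidal.μ F N.X M.X ≫ F.map (Mod.π N M) := by
      rw [← F.map_comp, Mod.π_braiding, F.map_comp, Functor.LaxBraided.braided_assoc]
    have h₁ := congrArg (fun t : F.obj N.X ⊗ F.obj M.X ⟶ F.obj (N ⊗ M).X ↦
      (β_ (F.obj M.X) (F.obj N.X)).hom ≫ t) (π_mapModμ F N M)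
    refine Mod.tensor_hom_ext ?_
    exact ((π_mapModμ_comp F M N ((mapMod F S).map (β_ M N).hom)).trans
      (h.trans (h₁.symm.trans
        (Mod.π_braiding_assoc ((mapMod F S).obj M) ((mapMod F S).obj N) (mapModμ F N M).hom).symm)))

/-- The inverse of the comparison map is compatible with the projections. -/
lemma map_π_inv_mapModμ (M N : Mod C S) :
    F.map (Mod.π M N) ≫ (inv (mapModμ F M N)).hom =
      Functor.OplaxMonoidal.δ F M.X N.X ≫
        Mod.π ((mapMod F S).obj M) ((mapMod F S).obj N) := by
  have h : (mapModμ F M N).hom ≫ (inv (mapModμ F M N)).hom = 𝟙 _ :=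
    congrArg Mod.Hom.hom (IsIso.hom_inv_id (mapModμ F M N))
  have h₁ : Functor.LaxMonoidal.μ F M.X N.X ≫ F.map (Mod.π M N) ≫ (inv (mapModμ F M N)).hom =
      Mod.π ((mapMod F S).obj M) ((mapMod F S).obj N) :=
    (π_mapModμ_comp F M N (inv (mapModμ F M N))).symm.trans
      ((congrArg (fun t ↦ Mod.π ((mapMod F S).obj M) ((mapMod F S).obj N) ≫ t) h).trans
        (Category.comp_id _))
  refine (cancel_epi (Functor.LaxMonoidal.μ F M.X N.X)).1 (h₁.trans ?_)
  exact (Functor.Monoidal.μ_δ_assoc F M.X N.X _).symm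

lemma exists_braided_mapMod : ∃ _ : (mapMod F S).Braided,
    (∀ M N : Mod C S, F.map (Mod.π M N) ≫ (Functor.OplaxMonoidal.δ (mapMod F S) M N).hom =
      Functor.OplaxMonoidal.δ F M.X N.X ≫
        Mod.π ((mapMod F S).obj M) ((mapMod F S).obj N)) ∧
    Functor.OplaxMonoidal.η (mapMod F S) = mapModUnit F S :=
  ⟨mapModBraided F, fun M N ↦ map_π_inv_mapModμ F M N, rfl⟩

end MapMod

section MapModAdjunction

variable {C : Type u₁} [Category.{v₁} C] [MonoidalCategory C]
  {D : Type u₂} [Category.{v₂} D] [MonoidalCategory D]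
  {F : C ⥤ D} [F.Monoidal] {G : D ⥤ C} (adj : F ⊣ G) (S : C) [MonObj S]

lemma mapModAdjunction_homEquiv_hom {M : Mod C S} {N : Mod D (F.obj S)}
    (f : (mapMod F S).obj M ⟶ N) :
    ((mapModAdjunction adj S).homEquiv M N f).hom = adj.homEquiv M.X N.X f.hom := by
  unfold mapModAdjunction
  rw [Adjunction.mkOfHomEquiv_homEquiv]
  rfl

end MapModAdjunction

end CategoryTheory

/-! ### The induced Quillen equivalence -/

namespace CategoryTheory

variable {C : Type u₁} [Category.{v₁} C] [MonoidalCategory C] [SymmetricCategory C]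
  [CategoryWithWeakEquivalences C] [CategoryWithCofibrations C] [CategoryWithFibrations C]
  [IsSymmetricMonoidalModelCategory C]
  {D : Type u₂} [Category.{v₂} D] [MonoidalCategory D] [SymmetricCategory D]
  [CategoryWithWeakEquivalences D] [CategoryWithCofibrations D] [CategoryWithFibrations D]
  [IsSymmetricMonoidalModelCategory D]
  {F : C ⥤ D} {G : D ⥤ C} {adj : F ⊣ G}

/-- As `F` preserves all weak equivalences, the adjunction criterion for a Quillen equivalence holds
for arbitrary, not necessarily cofibrant, objects of `C`. -/
lemma weakEquivalence_homEquiv_iff (h : IsQuillenEquivalence adj)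
    (hF : ∀ ⦃X Y : C⦄ (f : X ⟶ Y), WeakEquivalence f → WeakEquivalence (F.map f))
    (X : C) (Y : D) [IsFibrant Y] (f : F.obj X ⟶ Y) :
    WeakEquivalence f ↔ WeakEquivalence (adj.homEquiv X Y f) := by
  let := IsSymmetricMonoidalModelCategory.modelCategory C
  let := IsSymmetricMonoidalModelCategory.modelCategory D
  obtain ⟨K, _, k, _, _⟩ := CofibrantObject.HoCat.exists_resolution X
  have := hF k inferInstance
  rw [← weakEquivalence_precomp_iff (F.map k) f, h.weakEquivalence_iff,
    adj.homEquiv_naturality_left, weakEquivalence_precomp_iff]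

variable [F.Braided]

/-- The right adjoint is `G` on underlying objects, where fibrations and trivial fibrations are
detected. -/
lemma isQuillenAdjunction_mapModAdjunction (hC : IsCofibrantlyGenerated C)
    (hD : IsCofibrantlyGenerated D) (hC' : MonoidAxiom C) (hD' : MonoidAxiom D)
    (h : IsQuillenAdjunction adj) (S : C) [MonObj S] :
    IsQuillenAdjunction (mapModAdjunction adj S) := by
  let := IsSymmetricMonoidalModelCategory.modelCategory C
  let := IsSymmetricMonoidalModelCategory.modelCategory D
  let := Mod.modelCategory S hC hC'
  let := Mod.modelCategory (F.obj S) hD hD'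
  refine .of_rightAdjoint (fun M N p hp ↦ ?_) (fun M N p hp ↦ ?_)
  · have : Fibration p.hom := (fibration_iff _).2 hp
    exact (h.fibration_map p.hom).mem
  · obtain ⟨hp₁, hp₂⟩ := (mem_trivialFibrations_iff _).1 hp
    have : Fibration p.hom := (fibration_iff _).2 hp₁.mem
    have : WeakEquivalence p.hom := (weakEquivalence_iff _).2 hp₂.mem
    exact (mem_trivialFibrations_iff _).2
      ⟨⟨(h.fibration_map p.hom).mem⟩, ⟨(h.weakEquivalence_map_of_fibration p.hom).mem⟩⟩

lemma isQuillenEquivalence_mapModAdjunction (hC : IsCofibrantlyGenerated C)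
    (hD : IsCofibrantlyGenerated D) (hC' : MonoidAxiom C) (hD' : MonoidAxiom D)
    (h : IsQuillenEquivalence adj)
    (hF : ∀ ⦃X Y : C⦄ (f : X ⟶ Y), WeakEquivalence f → WeakEquivalence (F.map f))
    (S : C) [MonObj S] :
    IsQuillenEquivalence (mapModAdjunction adj S) where
  toIsQuillenAdjunction :=
    isQuillenAdjunction_mapModAdjunction hC hD hC' hD' h.toIsQuillenAdjunction S
  weakEquivalence_iff M _ N _ f := by
    let := IsSymmetricMonoidalModelCategory.modelCategory D
    let := Mod.modelCategory (F.obj S) hD hD'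
    have hfree : IsQuillenAdjunction (Mod.freeAdj (F.obj S)) := .of_rightAdjoint le_rfl le_rfl
    -- the forgetful functor is right Quillen and creates weak equivalences, so the question
    -- concerns the underlying map `F M ⟶ N` in `D`, where `M` need not be cofibrant in `C`
    have : IsFibrant N.X := hfree.isFibrant_obj N
    have key := weakEquivalence_homEquiv_iff h hF M.X N.X f.hom
    rw [← mapModAdjunction_homEquiv_hom] at key
    exact ⟨fun hf ↦ ⟨(key.1 ⟨hf.mem⟩).mem⟩, fun hf ↦ ⟨(key.2 ⟨hf.mem⟩).mem⟩⟩

end CategoryTheory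

theorem mainTheorem8
    {C : Type u₁} [Category.{v₁} C] [MonoidalCategory C] [SymmetricCategory C]
    [CategoryWithWeakEquivalences C] [CategoryWithCofibrations C] [CategoryWithFibrations C]
    [IsSymmetricMonoidalModelCategory C]
    {D : Type u₂} [Category.{v₂} D] [MonoidalCategory D] [SymmetricCategory D]
    [CategoryWithWeakEquivalences D] [CategoryWithCofibrations D] [CategoryWithFibrations D]
    [IsSymmetricMonoidalModelCategory D]
    (hC : IsCofibrantlyGenerated C) (hD : IsCofibrantlyGenerated D)
    (hC' : MonoidAxiom C) (hD' : MonoidAxiom D)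
    (hC'' : QuillenInvarianceOfModules C) (hD'' : QuillenInvarianceOfModules D)
    (F : C ⥤ D) [F.Braided] (G : D ⥤ C) (adj : F ⊣ G)
    (hFG : IsStrongSymmetricMonoidalQuillenEquivalence adj)
    (hF : ∀ ⦃X Y : C⦄ (f : X ⟶ Y), WeakEquivalence f → WeakEquivalence (F.map f))
    (S : C) [MonObj S] [IsCommMonObj S] :
    IsSymmetricMonoidalModelCategory (Mod C S) ∧
    IsSymmetricMonoidalModelCategory (Mod D (F.obj S)) ∧
    ∃ _ : (mapMod F S).Braided,
      (∀ M N : Mod C S, F.map (Mod.π M N) ≫ (Functor.OplaxMonoidal.δ (mapMod F S) M N).hom =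
        Functor.OplaxMonoidal.δ F M.X N.X ≫
          Mod.π ((mapMod F S).obj M) ((mapMod F S).obj N)) ∧
      Functor.OplaxMonoidal.η (mapMod F S) = mapModUnit F S ∧
      IsStrongSymmetricMonoidalQuillenEquivalence (mapModAdjunction adj S) := by
  have : PreservesColimitsOfShape WalkingParallelPair F :=
    adj.leftAdjoint_preservesColimits.preservesColimitsOfShape
  obtain ⟨_, hδ, hη⟩ := exists_braided_mapMod F (S := S)
  refine ⟨Mod.isSymmetricMonoidalModelCategory S hC hC',
    Mod.isSymmetricMonoidalModelCategory (F.obj S) hD hD', inferInstance, hδ, hη,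
    { toIsQuillenEquivalence := isQuillenEquivalence_mapModAdjunction hC hD hC' hD'
        hFG.toIsQuillenEquivalence hF S
      unit := fun Q _ q _ ↦ ?_ }⟩
  rw [hη]
  have h : F.map q.hom ≫ 𝟙 (F.obj S) = F.map q.hom := Category.comp_id _
  have hq : WeakEquivalence (F.map q.hom ≫ 𝟙 (F.obj S)) := by
    rw [h]
    exact hF q.hom ⟨WeakEquivalence.mem (f := q)⟩
  exact ⟨hq.mem⟩
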